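/- **Setting.** Let $(M,c)$ be a smooth conformal manifold of dimension $d\ge 3$ and of any signature, and let $\sigma\in\Gamma\mathcal E[1]$ be a real density of conformal weight $1$ with scale tractor $I=\frac1d D\sigma$, where $D$ is the tractor (Thomas) $D$-operator. Assume that $I^2=I^AI_A$ is nowhere zero, and let $\Sigma=\{\sigma=0\}$. Let $\mathcal E^\Phi$ be any tractor bundle (a tensor part of a tensor power of the standard tractor bundle, cut out by a smooth parallel projection; densities are complex valued), and $\mathcal E^\Phi[w]=\mathcal E^\Phi\otimes\mathcal E[w]$. Let $I\cdot D=I^AD_A:\mathcal E^\Phi[w]\to\mathcal E^\Phi[w-1]$, $x=\sigma$, $y=-\frac1{I^2}I\cdot D$, $w_0\in\mathbb C$, $h_0=d+2w_0$ and $\overline h_0=2-h_0$. For $h\notin\mathbb Z_{\ge2}$ let $$K^{h}(z)=\sum_{m\ge0}\frac{(-z)^m}{m!\,(m+1-h)_m},\qquad (a)_m=a(a-1)\cdots(a-m+1),$$ and for $K(z)=\sum_m K_mz^m$ let $:\!K\!:f=\sum_m K_m\,x^m y^m f$, a formal series in $\sigma$. All expansions are considered on the side $\sigma>0$ of $\Sigma$;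 there $O(\sigma^\beta)$ denotes $\sigma^\beta$ times a section that is smooth on $M$. For $\alpha\in\mathbb C$ and $\ell\in\mathbb N\cup\{\infty\}$, a *solution of order $\ell$ with exponent $\alpha$ and leading coefficient $\bar f_0$* is an expansion $\bar f=\sigma^\alpha(\bar f_0+\sigma\bar f_1+\sigma^2\bar f_2+\cdots)$ with $\bar f_i\in\Gamma\mathcal E^\Phi[w_0-\alpha-i]$ whose truncation at order $\ell$ satisfies $I\cdot D\,\bar f=O(\sigma^{\ell+\alpha})$ (for $\ell=\infty$: this holds for the truncation at every finite order). Two expansions are *formally equal* if their truncations agree to every finite order. **Proposition.** 1. If there is a solution of some order $\ell$ with exponent $\alpha$ whose leading coefficient does not vanish identically along $\Sigma$, then $\alpha=0$ or $\alpha=h_0-1$. 2. Every smooth section of $\mathcal E^\Phi[w]|_\Sigma$ extends to a smooth section of $\mathcal E^\Phi[w]$ over $M$. 3. If $h_0\notin\mathbb Z_{\ge2}$, then for every $f_0\in\Gamma\mathcal E^\Phi[w_0]$ the series $:\!K^{h_0}\!:f_0$ is an infinite order solution with exponent $0$ and leading coefficient $f_0$. Up to formal equality it depends only on $f_0|_\Sigma$;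 thus $:\!K^{h_0}\!:$ is a well-defined solution operator on $\Gamma\mathcal E^\Phi[w_0]|_\Sigma$. 4. If $h_0\notin\mathbb Z_{\le0}$, then for every $\bar f_0\in\Gamma\mathcal E^\Phi[-d-w_0+1]$ the expansion $x^{h_0-1}:\!K^{\overline h_0}\!:\bar f_0$ is an infinite order solution with exponent $h_0-1$ and leading coefficient $\bar f_0$. Up to formal equality it depends only on $\bar f_0|_\Sigma$; thus $x^{h_0-1}:\!K^{\overline h_0}\!:$ is a well-defined solution operator on $\Gamma\mathcal E^\Phi[w_0-h_0+1]|_\Sigma$. 5. Let $h_0\notin\mathbb Z$. If $f_0|_\Sigma$ and $\bar f_0|_\Sigma$ are not identically zero, then $:\!K^{h_0}\!:f_0$ and $x^{h_0-1}:\!K^{\overline h_0}\!:\bar f_0$ are not formally equal. Moreover every formal solution of $I\cdot D f=0$ of weight $w_0$, that is, every finite sum $f=\sum_{\alpha\in S}\sigma^\alpha(c_{\alpha,0}+\sigma c_{\alpha,1}+\cdots)$ with $S\subset\mathbb C$ finite and $c_{\alpha,i}\in\Gamma\mathcal E^\Phi[w_0-\alpha-i]$ such that, for every $N$, applying $I\cdot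 D$ to the truncations at order $N$ gives $\sum_{\alpha\in S}O(\sigma^{\alpha+N})$, is formally equal to $:\!K^{h_0}\!:f_0+x^{h_0-1}:\!K^{\overline h_0}\!:\bar f_0$ for some $f_0\in\Gamma\mathcal E^\Phi[w_0]$ and $\bar f_0\in\Gamma\mathcal E^\Phi[-d-w_0+1]$. -/

import Mathlib

open Set Bundle
open scoped Manifold ContDiff Topology

noncomputable section

namespace BoundaryCalculus

/-! ## Vector fields, metrics and the Levi-Civita connection

Throughout `M` is a smooth `d`-manifold.  A conformal structure `c` is handled through a
representative `g ∈ c`: the metric `g` trivialises every density bundle `𝓔[w]` (so that a density is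
a function) and splits the tractor bundles.  All conformally invariant operators below are given by
their formula in the scale `g`, the weight `w` of the section they act on being a parameter. -/

section Geometry

variable {d : ℕ} {M : Type*} [TopologicalSpace M] [ChartedSpace (EuclideanSpace ℝ (Fin d)) M]

/-- The tangent space at `p`. -/
abbrev Tan (d : ℕ) {M : Type*} [TopologicalSpace M]
    [ChartedSpace (EuclideanSpace ℝ (Fin d)) M] (p : M) : Type :=
  TangentSpace (𝓡 d) p

/-- (Not necessarily continuous) vector fields. -/
abbrev VField (d : ℕ) (M : Type*) [TopologicalSpace M]
    [ChartedSpace (EuclideanSpace ℝ (Fin d)) M] : Type _ :=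
  ∀ p : M, Tan d p

/-- The derivative at `p`, in the direction `v`, of a vector valued function. -/
def dirDeriv {F : Type*} [NormedAddCommGroup F] [NormedSpace ℝ F] (u : M → F) (p : M)
    (v : Tan d p) : F :=
  mvfderiv (𝓡 d) u p v

/-- The coordinate basis of `T_p M` given by the preferred chart at `p`. -/
def coordBasis (p : M) : Module.Basis (Fin d) ℝ (Tan d p) :=
  (EuclideanSpace.basisFun (Fin d) ℝ).toBasis

variable [IsManifold (𝓡 d) ∞ M]

/-- Smoothness of a vector field on a set. -/
def SmoothVFieldOn (U : Set M) (X : VField d M) : Prop :=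
  ContMDiffOn (𝓡 d) ((𝓡 d).prod 𝓘(ℝ, EuclideanSpace ℝ (Fin d))) ∞
    (fun p => (⟨p, X p⟩ : TangentBundle (𝓡 d) M)) U

/-- The coordinate vector field `∂_i` of the preferred chart at `p` (extended by zero outside of
the domain of that chart). -/
def coordField (p : M) (i : Fin d) : VField d M :=
  FiberBundle.extend (EuclideanSpace ℝ (Fin d)) (coordBasis p i)

/-- A smooth pseudo-Riemannian metric of arbitrary signature. -/
structure PseudoMetric (d : ℕ) (M : Type*) [TopologicalSpace M]
    [ChartedSpace (EuclideanSpace ℝ (Fin d)) M] [IsManifold (𝓡 d) ∞ M] where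
  /-- the bilinear form at each point -/
  val : ∀ p : M, Tan d p →ₗ[ℝ] Tan d p →ₗ[ℝ] ℝ
  symm : ∀ p v w, val p v w = val p w v
  nondegenerate : ∀ p v, (∀ w, val p v w = 0) → v = 0
  smooth : ∀ U : Set M, IsOpen U → ∀ X Y : VField d M, SmoothVFieldOn U X → SmoothVFieldOn U Y →
    ContMDiffOn (𝓡 d) 𝓘(ℝ, ℝ) ∞ (fun p => val p (X p) (Y p)) U

variable (g : PseudoMetric d M)

/-- The matrix `g^{ij}` at `p`, in the coordinates of the preferred chart at `p`. -/
def invGram (p : M) : Matrix (Fin d) (Fin d) ℝ :=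
  (Matrix.of fun i j => g.val p (coordBasis p i) (coordBasis p j))⁻¹

/-- The vector `g^{ij} a_j ∂_i` at `p`. -/
def sharp (p : M) (a : Fin d → ℝ) : Tan d p :=
  ∑ i, ∑ j, (invGram g p i j * a j) • coordBasis p i

/-- The metric trace `g^{ij} β_{ij}` at `p`. -/
def metricTrace {F : Type*} [AddCommGroup F] [Module ℝ F] (p : M) (β : Fin d → Fin d → F) : F :=
  ∑ i, ∑ j, invGram g p i j • β i j

/-- The right hand side of the Koszul formula for `g(∇_X Y, Z)`. -/
def koszul (X Y Z : VField d M) (p : M) : ℝ :=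
  (dirDeriv (fun q => g.val q (Y q) (Z q)) p (X p)
    + dirDeriv (fun q => g.val q (X q) (Z q)) p (Y p)
    - dirDeriv (fun q => g.val q (X q) (Y q)) p (Z p)
    + g.val p (VectorField.mlieBracket (𝓡 d) X Y p) (Z p)
    - g.val p (VectorField.mlieBracket (𝓡 d) X Z p) (Y p)
    - g.val p (VectorField.mlieBracket (𝓡 d) Y Z p) (X p)) / 2

/-- The Levi-Civita connection: `lc g X Y = ∇_X Y`. -/
def lc (X Y : VField d M) : VField d M := fun p =>
  sharp g p fun j => koszul g X Y (coordField p j) p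

/-- The curvature `R(X,Y)Z = ∇_X ∇_Y Z - ∇_Y ∇_X Z - ∇_{[X,Y]} Z`. -/
def riem (X Y Z : VField d M) : VField d M := fun p =>
  lc g X (lc g Y Z) p - lc g Y (lc g X Z) p - lc g (VectorField.mlieBracket (𝓡 d) X Y) Z p

/-- The Ricci tensor, `Ric(Y,Z) = tr (X ↦ R(X,Y)Z)`. -/
def ric (Y Z : VField d M) (p : M) : ℝ :=
  ∑ i, (coordBasis p).repr (riem g (coordField p i) Y Z p) i

/-- `J = Sc / (2(d-1))`, the trace of the Schouten tensor. -/
def schoutenJ (p : M) : ℝ :=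
  metricTrace g p (fun i j => ric g (coordField p i) (coordField p j) p) / (2 * ((d : ℝ) - 1))

/-- The Schouten tensor, determined by `Ric = (d-2) P + J g`. -/
def schouten (X Y : VField d M) (p : M) : ℝ :=
  (ric g X Y p - schoutenJ g p * g.val p (X p) (Y p)) / ((d : ℝ) - 2)

/-- The gradient of a function. -/
def grad (s : M → ℝ) : VField d M := fun p =>
  sharp g p fun j => dirDeriv s p (coordBasis p j)

/-- The Laplacian `g^{ab} ∇_a ∇_b` on functions. -/
def laplacianFun (s : M → ℝ) (p : M) : ℝ :=
  metricTrace g p fun i j =>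
    dirDeriv (fun q => dirDeriv s q (coordField p j q)) p (coordField p i p)
      - dirDeriv s p (lc g (coordField p i) (coordField p j) p)

/-! ## Standard tractors -/

/-- The fibre of the standard tractor bundle, in the splitting `𝓔[1] ⊕ T^*M[1] ⊕ 𝓔[-1]` determined
by `g`; the middle slot is identified with a tangent vector by means of `g`. -/
abbrev TractorFibre (d : ℕ) {M : Type*} [TopologicalSpace M]
    [ChartedSpace (EuclideanSpace ℝ (Fin d)) M] (p : M) : Type :=
  ℝ × Tan d p × ℝ

/-- (Not necessarily continuous) sections of the standard tractor bundle. -/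
abbrev TractorField (d : ℕ) (M : Type*) [TopologicalSpace M]
    [ChartedSpace (EuclideanSpace ℝ (Fin d)) M] : Type _ :=
  ∀ p : M, TractorFibre d p

/-- Smoothness of a standard tractor field on a set. -/
def SmoothTractorOn (U : Set M) (T : TractorField d M) : Prop :=
  ContMDiffOn (𝓡 d) 𝓘(ℝ, ℝ) ∞ (fun p => (T p).1) U ∧
    SmoothVFieldOn U (fun p => (T p).2.1) ∧
    ContMDiffOn (𝓡 d) 𝓘(ℝ, ℝ) ∞ (fun p => (T p).2.2) U

/-- The tractor metric `g^{-1}(μ,μ') + σ ρ' + ρ σ'`. -/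
def tractorMetric (p : M) (T T' : TractorFibre d p) : ℝ :=
  g.val p T.2.1 T'.2.1 + T.1 * T'.2.2 + T.2.2 * T'.1

/-- The normal tractor connection
`∇_a (σ, μ_b, ρ) = (∇_a σ - μ_a, ∇_a μ_b + g_{ab} ρ + P_{ab} σ, ∇_a ρ - P_{ac} μ^c)`. -/
def tractorConn (X : VField d M) (T : TractorField d M) : TractorField d M := fun p =>
  (dirDeriv (fun q => (T q).1) p (X p) - g.val p (X p) (T p).2.1,
    lc g X (fun q => (T q).2.1) p + (T p).2.2 • X p
      + (T p).1 • sharp g p (fun j => schouten g X (coordField p j) p),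
    dirDeriv (fun q => (T q).2.2) p (X p) - schouten g X (fun q => (T q).2.1) p)

/-! ## Tractor tensors -/

/-- The fibre of `⊗^k 𝓣 ⊗ 𝓔[w]` in the scale `g`: complex valued `k`-linear forms on the standard
tractors (`𝓣` is identified with its dual by the tractor metric). -/
abbrev TensorFibre (d : ℕ) {M : Type*} [TopologicalSpace M]
    [ChartedSpace (EuclideanSpace ℝ (Fin d)) M] (k : ℕ) (p : M) : Type :=
  MultilinearMap ℝ (fun _ : Fin k => TractorFibre d p) ℂ

/-- (Not necessarily continuous) weighted tractor tensor fields, in the scale `g`. -/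
abbrev TensorField (d : ℕ) (M : Type*) [TopologicalSpace M]
    [ChartedSpace (EuclideanSpace ℝ (Fin d)) M] (k : ℕ) : Type _ :=
  ∀ p : M, TensorFibre d k p

variable {k : ℕ}

/-- Smoothness of a tractor tensor field on a set. -/
def SmoothTensorOn (U : Set M) (f : TensorField d M k) : Prop :=
  ∀ V : Set M, IsOpen V → V ⊆ U → ∀ T : Fin k → TractorField d M,
    (∀ i, SmoothTractorOn V (T i)) →
      ContMDiffOn (𝓡 d) 𝓘(ℝ, ℂ) ∞ (fun p => f p (fun i => T i p)) V

/-- The coupled Levi-Civita-tractor connection on tractor tensors: `∇_X f` is the tensor with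
`(∇_X f)(T_1, …, T_k) = X (f(T_1, …, T_k)) - ∑_i f(T_1, …, ∇_X T_i, …, T_k)`
for all smooth local tractor fields `T_i`. -/
def covDeriv (X : VField d M) (f : TensorField d M k) : TensorField d M k := fun p =>
  Classical.epsilon fun φ : TensorFibre d k p =>
    ∀ V : Set M, IsOpen V → p ∈ V → ∀ T : Fin k → TractorField d M,
      (∀ i, SmoothTractorOn V (T i)) →
        φ (fun i => T i p) =
          dirDeriv (fun q => f q (fun i => T i q)) p (X p)
            - ∑ i, f p (Function.update (fun j => T j p) i (tractorConn g X (T i) p))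

/-- The Laplacian `g^{ab} ∇_a ∇_b` on tractor tensors. -/
def laplacian (f : TensorField d M k) : TensorField d M k := fun p =>
  metricTrace g p fun i j =>
    covDeriv g (coordField p i) (covDeriv g (coordField p j) f) p
      - covDeriv g (lc g (coordField p i) (coordField p j)) f p

/-- An arbitrary tractor bundle `𝓔^Φ`: the part of a tensor power `⊗^k 𝓣` (complexified, as the
density bundles are) cut out by a smooth parallel idempotent.  Every tensor part is of this form;
the identity gives `⊗^k 𝓣` itself, and `k = 0` gives densities. -/
structure TractorBundle (g : PseudoMetric d M) (k : ℕ) where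
  /-- the idempotent -/
  proj : ∀ p : M, TensorFibre d k p →ₗ[ℂ] TensorFibre d k p
  idem : ∀ p φ, proj p (proj p φ) = proj p φ
  smooth : ∀ U : Set M, IsOpen U → ∀ f : TensorField d M k, SmoothTensorOn U f →
    SmoothTensorOn U (fun p => proj p (f p))
  parallel : ∀ U : Set M, IsOpen U → ∀ f : TensorField d M k, SmoothTensorOn U f →
    ∀ X : VField d M, SmoothVFieldOn U X → ∀ p ∈ U,
      covDeriv g X (fun q => proj q (f q)) p = proj p (covDeriv g X f p)

variable {g}

/-- Smooth sections over an open set `U` of the tractor bundle `B` (of any weight, in the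
scale `g`). -/
def TractorBundle.IsSectionOn (B : TractorBundle g k) (U : Set M) (f : TensorField d M k) : Prop :=
  SmoothTensorOn U f ∧ ∀ p ∈ U, B.proj p (f p) = f p

/-- Smooth sections over `M` of the tractor bundle `B`. -/
def TractorBundle.IsSection (B : TractorBundle g k) (f : TensorField d M k) : Prop :=
  B.IsSectionOn univ f

/-- Smooth sections of `B` along the zero locus of `s`; only the values of `φ` there matter. -/
def TractorBundle.IsSectionAlong (B : TractorBundle g k) (s : M → ℝ)
    (φ : TensorField d M k) : Prop :=
  ∀ p, s p = 0 → ∃ U : Set M, IsOpen U ∧ p ∈ U ∧ ∃ f, B.IsSectionOn U f ∧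
    ∀ q ∈ U, s q = 0 → f q = φ q

variable (g)

/-! ## The scale tractor and the degenerate Laplacian

`s` is the function representing `σ ∈ Γ𝓔[1]` in the scale `g`. -/

/-- The scale tractor `I = (1/d) D σ = (σ, ∇σ, -(1/d)(Δσ + J σ))`. -/
def scaleTractor (s : M → ℝ) : TractorField d M := fun p =>
  (s p, grad g s p, -(laplacianFun g s p + schoutenJ g p * s p) / d)

/-- `I² = h(I, I)`. -/
def scaleTractorSq (s : M → ℝ) (p : M) : ℝ :=
  tractorMetric g p (scaleTractor g s p) (scaleTractor g s p)

/-- Top slot `(d + 2w - 2) w f` of the Thomas operator on sections of weight `w`. -/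
def thomasTop (w : ℂ) (f : TensorField d M k) : TensorField d M k := fun p =>
  (((d : ℂ) + 2 * w - 2) * w) • f p

/-- Middle slot `(d + 2w - 2) ∇_X f` of the Thomas operator on sections of weight `w`. -/
def thomasMid (w : ℂ) (f : TensorField d M k) (X : VField d M) : TensorField d M k := fun p =>
  ((d : ℂ) + 2 * w - 2) • covDeriv g X f p

/-- Bottom slot `-(Δ + J w) f` of the Thomas operator on sections of weight `w`. -/
def thomasBot (w : ℂ) (f : TensorField d M k) : TensorField d M k := fun p =>
  -(laplacian g f p + ((schoutenJ g p : ℂ) * w) • f p)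

/-- The degenerate Laplacian `I·D = I^A D_A : 𝓔^Φ[w] → 𝓔^Φ[w-1]`, the contraction being that of the
tractor metric. -/
def iDotD (s : M → ℝ) (w : ℂ) (f : TensorField d M k) : TensorField d M k := fun p =>
  ((scaleTractor g s p).1 : ℂ) • thomasBot g w f p
    + thomasMid g w f (fun q => (scaleTractor g s q).2.1) p
    + ((scaleTractor g s p).2.2 : ℂ) • thomasTop w f p

/-- `y = -(1/I²) I·D : 𝓔^Φ[w] → 𝓔^Φ[w-1]`. -/
def yOp (s : M → ℝ) (w : ℂ) (f : TensorField d M k) : TensorField d M k := fun p =>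
  (-(1 / (scaleTractorSq g s p : ℂ))) • iDotD g s w f p

/-- `y^m : 𝓔^Φ[w] → 𝓔^Φ[w-m]`. -/
def yPow (s : M → ℝ) (w : ℂ) : ℕ → TensorField d M k → TensorField d M k
  | 0, f => f
  | m + 1, f => yOp g s (w - m) (yPow s w m f)

/-! ## Formal solutions -/

/-- The series `K^h(z) = ∑ (-z)^m / (m! (m+1-h)_m)`, where `(a)_m = a (a-1) ⋯ (a-m+1)`. -/
def besselK (h : ℂ) : PowerSeries ℂ :=
  PowerSeries.mk fun m => (-1) ^ m / ((m.factorial : ℂ) * (descPochhammer ℂ m).eval ((m : ℂ) + 1 - h))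

/-- The coefficients `f_m = K_m y^m f_0` of the expansion `:K: f_0 = ∑ σ^m K_m y^m f_0`, for `f_0`
of weight `w`; here `:z^m: = x^m y^m` and `x = σ`. -/
def normalOrdered (s : M → ℝ) (w : ℂ) (K : PowerSeries ℂ) (f : TensorField d M k) :
    ℕ → TensorField d M k := fun m p =>
  (PowerSeries.coeff m K) • yPow g s w m f p

variable {g}

/-- The truncation `σ^α (f_0 + σ f_1 + ⋯ + σ^N f_N)`, relevant on `{σ > 0}`. -/
def partialSum (s : M → ℝ) (α : ℂ) (f : ℕ → TensorField d M k) (N : ℕ) : TensorField d M k :=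
  fun p => ∑ i ∈ Finset.range (N + 1), ((s p : ℂ) ^ (α + i)) • f i p

/-- `u = ∑_{α ∈ S} O(σ^{α+e})` on the side `{σ > 0}` of the zero locus of `σ`, where `O(σ^β)` stands
for `σ^β` times a section that is smooth over `M` (hence up to and across the zero locus). -/
def TractorBundle.IsBigO (B : TractorBundle g k) (s : M → ℝ) (S : Finset ℂ) (e : ℕ)
    (u : TensorField d M k) : Prop :=
  ∃ r : ℂ → TensorField d M k, (∀ α ∈ S, B.IsSection (r α)) ∧
    ∀ p, 0 < s p → u p = ∑ α ∈ S, ((s p : ℂ) ^ (α + e)) • r α p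

/-- `σ^α (f_0 + σ f_1 + ⋯ + O(σ^{ℓ+1}))`, a section of weight `w`, solves
`I·D f = O(σ^{ℓ+α})` off the zero locus of `σ`. -/
def TractorBundle.SolvesToOrder (B : TractorBundle g k) (s : M → ℝ) (w α : ℂ)
    (f : ℕ → TensorField d M k) (ℓ : ℕ) : Prop :=
  (∀ i, B.IsSection (f i)) ∧ B.IsBigO s {α} ℓ (iDotD g s w (partialSum s α f ℓ))

/-- `σ^α (f_0 + σ f_1 + ⋯)` is an infinite order solution with leading coefficient `f₀`. -/
def TractorBundle.IsInfiniteOrderSolution (B : TractorBundle g k) (s : M → ℝ) (w α : ℂ)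
    (f₀ : TensorField d M k) (f : ℕ → TensorField d M k) : Prop :=
  f 0 = f₀ ∧ ∀ ℓ, B.SolvesToOrder s w α f ℓ

/-- Two formal expansions with exponents in `S + ℕ`, given by their sequences of truncations, agree
to infinite order. -/
def TractorBundle.FormalEq (B : TractorBundle g k) (s : M → ℝ) (S : Finset ℂ)
    (u v : ℕ → TensorField d M k) : Prop :=
  ∀ N, B.IsBigO s S (N + 1) (u N - v N)

/-- A formal solution, of weight `w`, of `I·D f = 0` off the zero locus of `σ`: a finite sum
`∑_{α ∈ S} σ^α (c_{α,0} + σ c_{α,1} + ⋯)` with arbitrary complex exponents that is annihilated by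
`I·D` to infinite order. -/
def TractorBundle.IsFormalSolution (B : TractorBundle g k) (s : M → ℝ) (w : ℂ) (S : Finset ℂ)
    (c : ℂ → ℕ → TensorField d M k) : Prop :=
  (∀ α ∈ S, ∀ i, B.IsSection (c α i)) ∧
    ∀ N, B.IsBigO s S N (iDotD g s w (∑ α ∈ S, partialSum s α (c α) N))

end Geometry

end BoundaryCalculus

end

open BoundaryCalculus
open scoped Manifold ContDiff

set_option autoImplicit false

noncomputable section

/-! Write `s` for the function representing `σ`, and `Σ` for its zero locus. Everything rests on one
commutator (`iDotD_cpow_smul`): where `s > 0`, `I·D (s^α f) = s^α I·D f + α (h₀ - 1 - α) s^(α-1) I²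
f`, the first two `I·D` taken at the weights of their arguments. Hence `s^(1-α) I·D s^α` is an
operator that is smooth across `Σ` (`indicial`), and along `Σ` it is multiplication by `α (h₀ - 1 -
α) I²`. Since `I² ≠ 0`, a nonzero leading coefficient forces `α` to be `0` or `h₀ - 1`.

Existence. By definition of `y`, `I·D y^m f = -I² y^(m+1) f`. Starting from a root, the coefficients
of `K^h` satisfy exactly the recursion that makes the commutator terms telescope, so that `I·D` of
the truncation at order `N` is the single term `s^(β+N) I·D f_N` (`iDotD_partialSum_normalOrdered`).
The excluded integers are those at which the recursion divides by zero.

Uniqueness. Along `Σ` one has `ds(grad s) = I² ≠ 0`, so `Σ` is regular, lies in the closure of `{s >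
0}`, and sections vanishing on it are smoothly divisible by `s` (Hadamard's lemma,
`IsSection.exists_eq_smul`). Away from the roots the indicial operator detects vanishing along `Σ`;
alternating this with division by `s` gives vanishing to every order (`exists_eq_pow_smul`).
Extension from `Σ` is a partition of unity.

Generic weights. Powers of `s` with exponents in distinct classes modulo `ℤ` are independent over
smooth germs (`PowerRelation.eq_zero`): Euler operators `s X - c` with `X s = 1` push all classes
but one to high order, and a limit at `Σ` does the rest. A formal solution therefore splits into its
classes, each solving separately. For `h₀ ∉ ℤ` a class contains at most one root; dividing up to
that root and applying uniqueness identifies the class with a solution operator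
(`IsFormalSolution.exists_eq`), and a class without root is negligible.

The first half of the file is preparatory. The geometric operators are defined pointwise, with a
frame centred at the point and, for `covDeriv`, by a choice; their usual algebra and smoothness come
from tensoriality. -/

namespace BoundaryCalculus

/-! ### Germs of smooth functions and vector fields, and local frames. -/

section Calculus

variable {d : ℕ} {M : Type*} [TopologicalSpace M] [ChartedSpace (EuclideanSpace ℝ (Fin d)) M]
variable {F : Type*} [NormedAddCommGroup F] [NormedSpace ℝ F]

/-- `u` is smooth in a neighbourhood of `p`. -/
def SmoothFunNear (d : ℕ) {M : Type*} [TopologicalSpace M]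
    [ChartedSpace (EuclideanSpace ℝ (Fin d)) M] {F : Type*} [NormedAddCommGroup F]
    [NormedSpace ℝ F] (u : M → F) (p : M) : Prop :=
  ∀ᶠ q in 𝓝 p, ContMDiffAt (𝓡 d) 𝓘(ℝ, F) ∞ u q

variable {p : M} {u v : M → F}

namespace SmoothFunNear

theorem contMDiffAt (h : SmoothFunNear d u p) : ContMDiffAt (𝓡 d) 𝓘(ℝ, F) ∞ u p :=
  h.self_of_nhds

theorem mdifferentiableAt (h : SmoothFunNear d u p) : MDifferentiableAt (𝓡 d) 𝓘(ℝ, F) u p :=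
  h.contMDiffAt.mdifferentiableAt (by simp)

theorem eventually (h : SmoothFunNear d u p) : ∀ᶠ q in 𝓝 p, SmoothFunNear d u q :=
  eventually_eventually_nhds.2 h

theorem congr (h : SmoothFunNear d u p) (huv : u =ᶠ[𝓝 p] v) : SmoothFunNear d v p := by
  filter_upwards [h, huv.eventuallyEq_nhds] with q hq hq'
  exact hq.congr_of_eventuallyEq hq'.symm

theorem of_contMDiffOn {U : Set M} (hU : IsOpen U) (hp : p ∈ U)
    (h : ContMDiffOn (𝓡 d) 𝓘(ℝ, F) ∞ u U) : SmoothFunNear d u p := by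
  filter_upwards [hU.mem_nhds hp] with q hq
  exact h.contMDiffAt (hU.mem_nhds hq)

theorem const (c : F) : SmoothFunNear d (fun _ : M => c) p :=
  Filter.Eventually.of_forall fun _ => contMDiffAt_const

theorem add (hu : SmoothFunNear d u p) (hv : SmoothFunNear d v p) :
    SmoothFunNear d (fun q => u q + v q) p := by
  filter_upwards [hu, hv] with q h1 h2 using h1.add h2

theorem sub (hu : SmoothFunNear d u p) (hv : SmoothFunNear d v p) :
    SmoothFunNear d (fun q => u q - v q) p := by
  filter_upwards [hu, hv] with q h1 h2 using h1.sub h2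

theorem neg (hu : SmoothFunNear d u p) : SmoothFunNear d (fun q => - u q) p := by
  filter_upwards [hu] with q h1 using h1.neg

theorem smul {a : M → ℝ} (ha : SmoothFunNear d a p) (hu : SmoothFunNear d u p) :
    SmoothFunNear d (fun q => a q • u q) p := by
  filter_upwards [ha, hu] with q h1 h2 using h1.smul h2

theorem clm {G : Type*} [NormedAddCommGroup G] [NormedSpace ℝ G] (L : F →L[ℝ] G)
    (hu : SmoothFunNear d u p) : SmoothFunNear d (fun q => L (u q)) p := by
  filter_upwards [hu] with q h1
  exact L.contMDiff.contMDiffAt.comp q h1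

theorem mul {A : Type*} [NormedRing A] [NormedAlgebra ℝ A] {a b : M → A}
    (ha : SmoothFunNear d a p) (hb : SmoothFunNear d b p) :
    SmoothFunNear d (fun q => a q * b q) p := by
  filter_upwards [ha, hb] with q h1 h2
  exact (contDiff_mul (𝕜 := ℝ) (𝔸 := A)).contMDiff.contMDiffAt.comp q (h1.prodMk_space h2)

theorem sum {ι : Type*} (S : Finset ι) {a : ι → M → F} (h : ∀ i ∈ S, SmoothFunNear d (a i) p) :
    SmoothFunNear d (fun q => ∑ i ∈ S, a i q) p := by
  classical
  induction S using Finset.induction_on with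
  | empty => simpa using const 0
  | insert i S hi ih =>
    simp only [Finset.sum_insert hi]
    exact (h i (by simp)).add (ih fun j hj => h j (by simp [hj]))

theorem ofReal {a : M → ℝ} (ha : SmoothFunNear d a p) :
    SmoothFunNear d (fun q => (a q : ℂ)) p :=
  ha.clm Complex.ofRealCLM

end SmoothFunNear

theorem dirDeriv_congr (h : u =ᶠ[𝓝 p] v) (X : Tan d p) : dirDeriv u p X = dirDeriv v p X := by
  unfold dirDeriv mvfderiv
  simp only [ContinuousLinearMap.comp_apply, h.mfderiv_eq]
  rfl

theorem dirDeriv_add_right (X Y : Tan d p) : dirDeriv u p (X + Y) = dirDeriv u p X + dirDeriv u p Y :=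
  map_add _ _ _

theorem dirDeriv_smul_right (c : ℝ) (X : Tan d p) : dirDeriv u p (c • X) = c • dirDeriv u p X :=
  map_smul _ _ _

theorem dirDeriv_const (c : F) (X : Tan d p) : dirDeriv (fun _ => c) p X = 0 := by
  simp [dirDeriv, mvfderiv_const]

theorem dirDeriv_add (hu : SmoothFunNear d u p) (hv : SmoothFunNear d v p) (X : Tan d p) :
    dirDeriv (fun q => u q + v q) p X = dirDeriv u p X + dirDeriv v p X := by
  unfold dirDeriv
  rw [mvfderiv_fun_add hu.mdifferentiableAt hv.mdifferentiableAt]; rfl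

theorem dirDeriv_smul {a : M → ℝ} (ha : SmoothFunNear d a p) (hu : SmoothFunNear d u p)
    (X : Tan d p) :
    dirDeriv (fun q => a q • u q) p X = a p • dirDeriv u p X + dirDeriv a p X • u p := by
  unfold dirDeriv
  rw [mvfderiv_fun_smul ha.mdifferentiableAt hu.mdifferentiableAt]; rfl

theorem dirDeriv_clm {G : Type*} [NormedAddCommGroup G] [NormedSpace ℝ G] (L : F →L[ℝ] G)
    (hu : SmoothFunNear d u p) (X : Tan d p) :
    dirDeriv (fun q => L (u q)) p X = L (dirDeriv u p X) := by
  have := (L.hasMFDerivAt (x := u p)).comp p hu.mdifferentiableAt.hasMFDerivAt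
  unfold dirDeriv mvfderiv
  simp only [ContinuousLinearMap.comp_apply]
  rw [show (fun q => L (u q)) = L ∘ u from rfl, this.mfderiv]
  rfl

theorem dirDeriv_mul {A : Type*} [NormedCommRing A] [NormedAlgebra ℝ A] {a b : M → A}
    (ha : SmoothFunNear d a p) (hb : SmoothFunNear d b p) (X : Tan d p) :
    dirDeriv (fun q => a q * b q) p X = a p * dirDeriv b p X + dirDeriv a p X * b p := by
  have h1 := ha.mdifferentiableAt.hasMFDerivAt
  have h2 := hb.mdifferentiableAt.hasMFDerivAt
  have := HasMFDerivAt.mul' h1 h2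
  unfold dirDeriv mvfderiv
  simp only [ContinuousLinearMap.comp_apply]
  rw [show (fun q => a q * b q) = a * b from rfl, this.mfderiv]
  rfl

theorem dirDeriv_ofReal {a : M → ℝ} (ha : SmoothFunNear d a p) (X : Tan d p) :
    dirDeriv (fun q => (a q : ℂ)) p X = ((dirDeriv a p X : ℝ) : ℂ) :=
  dirDeriv_clm Complex.ofRealCLM ha X

theorem dirDeriv_sum {ι : Type*} (S : Finset ι) {a : ι → M → F}
    (h : ∀ i ∈ S, SmoothFunNear d (a i) p) (X : Tan d p) :
    dirDeriv (fun q => ∑ i ∈ S, a i q) p X = ∑ i ∈ S, dirDeriv (a i) p X := by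
  classical
  induction S using Finset.induction_on with
  | empty => simp [dirDeriv_const]
  | insert i S hi ih =>
    simp only [Finset.sum_insert hi]
    rw [dirDeriv_add (h i (by simp)) (.sum S fun j hj => h j (by simp [hj])),
      ih fun j hj => h j (by simp [hj])]

/-- Two vector fields agree in a neighbourhood of `p`. -/
def VFieldEqNear (X Y : VField d M) (p : M) : Prop :=
  ∀ᶠ q in 𝓝 p, X q = Y q

theorem VFieldEqNear.refl (X : VField d M) (p : M) : VFieldEqNear X X p :=
  .of_forall fun _ => rfl

variable [IsManifold (𝓡 d) ∞ M]

/-- The vector field `X` is smooth in a neighbourhood of `p`. -/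
def SmoothVFieldNear (X : VField d M) (p : M) : Prop :=
  ∀ᶠ q in 𝓝 p, ContMDiffAt (𝓡 d) ((𝓡 d).prod 𝓘(ℝ, EuclideanSpace ℝ (Fin d))) ∞
    (fun p => (⟨p, X p⟩ : TangentBundle (𝓡 d) M)) q

namespace SmoothVFieldNear

variable {X Y : VField d M}

theorem contMDiffAt (h : SmoothVFieldNear X p) :
    ContMDiffAt (𝓡 d) ((𝓡 d).prod 𝓘(ℝ, EuclideanSpace ℝ (Fin d))) ∞
    (fun p => (⟨p, X p⟩ : TangentBundle (𝓡 d) M)) p :=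
  h.self_of_nhds

theorem mdifferentiableAt (h : SmoothVFieldNear X p) :
    MDifferentiableAt (𝓡 d) ((𝓡 d).prod 𝓘(ℝ, EuclideanSpace ℝ (Fin d)))
    (fun p => (⟨p, X p⟩ : TangentBundle (𝓡 d) M)) p :=
  h.contMDiffAt.mdifferentiableAt (by simp)

theorem eventually (h : SmoothVFieldNear X p) : ∀ᶠ q in 𝓝 p, SmoothVFieldNear X q :=
  eventually_eventually_nhds.2 h

theorem congr (h : SmoothVFieldNear X p) (hXY : VFieldEqNear X Y p) : SmoothVFieldNear Y p := by
  filter_upwards [h, eventually_eventually_nhds.2 hXY] with q hq hq'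
  exact hq.congr_of_eventuallyEq (hq'.mono fun r hr => by simp [hr])

theorem of_on {U : Set M} (hU : IsOpen U) (hp : p ∈ U)
    (h : SmoothVFieldOn U X) : SmoothVFieldNear X p := by
  filter_upwards [hU.mem_nhds hp] with q hq
  exact ContMDiffOn.contMDiffAt h (hU.mem_nhds hq)

theorem add (hX : SmoothVFieldNear X p) (hY : SmoothVFieldNear Y p) :
    SmoothVFieldNear (fun q => X q + Y q) p := by
  filter_upwards [hX, hY] with q h1 h2 using h1.add_section h2

theorem sub (hX : SmoothVFieldNear X p) (hY : SmoothVFieldNear Y p) :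
    SmoothVFieldNear (fun q => X q - Y q) p := by
  filter_upwards [hX, hY] with q h1 h2 using h1.sub_section h2

theorem smul {a : M → ℝ} (hX : SmoothVFieldNear X p) (ha : SmoothFunNear d a p) :
    SmoothVFieldNear (fun q => a q • X q) p := by
  filter_upwards [ha, hX] with q h1 h2 using h1.smul_section h2

theorem sum {ι : Type*} (S : Finset ι) {X : ι → VField d M}
    (h : ∀ i ∈ S, SmoothVFieldNear (X i) p) :
    SmoothVFieldNear (fun q => ∑ i ∈ S, X i q) p := by
  have := (Filter.eventually_all_finset S).2 h
  filter_upwards [this] with q hq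
  exact ContMDiffAt.sum_section hq

theorem bracket (hX : SmoothVFieldNear X p) (hY : SmoothVFieldNear Y p) :
    SmoothVFieldNear (VectorField.mlieBracket (𝓡 d) X Y) p := by
  have : IsManifold (𝓡 d) (minSmoothness ℝ 2) M := by
    rw [minSmoothness_of_isRCLikeNormedField]; infer_instance
  have : IsManifold (𝓡 d) (((⊤ : ℕ∞) : WithTop ℕ∞) + 1) M := by
    rw [show (((⊤ : ℕ∞) : WithTop ℕ∞) + 1) = ∞ from rfl]; infer_instance
  filter_upwards [hX, hY] with q h1 h2
  exact ContMDiffAt.mlieBracket_vectorField (m := ⊤) (n := ⊤) h1 h2 (by simp)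

theorem dirDeriv (hX : SmoothVFieldNear X p) (hu : SmoothFunNear d u p) :
    SmoothFunNear d (fun q => dirDeriv u q (X q)) p := by
  filter_upwards [hu, hX] with q h1 h2
  have h3 := h1.mfderiv_const (m := ∞) (by simp)
  -- The differential applied to `X` is smooth as a map into the tangent bundle of `F`; its fibre
  -- component is the directional derivative.
  have h4 := ContMDiffAt.clm_apply_of_inCoordinates (b₁ := id) (b₂ := u) (ϕ := fun m => mfderiv (𝓡 d) 𝓘(ℝ, F) u m) (v := X) h3 h2 h1
  exact (contMDiff_snd_tangentBundle_modelSpace F 𝓘(ℝ, F)).contMDiffAt.comp q h4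

end SmoothVFieldNear

theorem SmoothVFieldNear.coordField (p : M) (i : Fin d) : SmoothVFieldNear (coordField p i) p := by
  obtain ⟨s, hs, h⟩ := FiberBundle.exists_contMDiffOn_extend (k := ∞) (𝓡 d) (EuclideanSpace ℝ (Fin d)) (coordBasis p i)
  obtain ⟨t, hts, ht, hp⟩ := mem_nhds_iff.1 hs
  exact .of_on ht hp (ContMDiffOn.mono h hts)

@[simp] theorem coordField_self (p : M) (i : Fin d) : BoundaryCalculus.coordField p i p = coordBasis p i := by
  simp [BoundaryCalculus.coordField]

/-- The frame `coordField p` at a point of the domain of the chart at `p`, as a basis. -/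
def frameBasis (p : M) {q : M}
    (hq : q ∈ (trivializationAt (EuclideanSpace ℝ (Fin d)) (TangentSpace (𝓡 d)) p).baseSet) :
    Module.Basis (Fin d) ℝ (Tan d q) :=
  (trivializationAt (EuclideanSpace ℝ (Fin d)) (TangentSpace (𝓡 d)) p).basisAt
    ((coordBasis p).map ((trivializationAt (EuclideanSpace ℝ (Fin d))
      (TangentSpace (𝓡 d)) p).linearEquivAt ℝ p (FiberBundle.mem_baseSet_trivializationAt' p))) hq

theorem frameBasis_apply (p : M) {q : M}
    (hq : q ∈ (trivializationAt (EuclideanSpace ℝ (Fin d)) (TangentSpace (𝓡 d)) p).baseSet)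
    (i : Fin d) : frameBasis p hq i = coordField p i q := by
  simp [frameBasis, Bundle.Trivialization.basisAt, coordField, FiberBundle.extend]

theorem frame_baseSet_mem_nhds (p : M) :
    (trivializationAt (EuclideanSpace ℝ (Fin d)) (TangentSpace (𝓡 d)) p).baseSet ∈ 𝓝 p :=
  (trivializationAt (EuclideanSpace ℝ (Fin d)) (TangentSpace (𝓡 d)) p).open_baseSet.mem_nhds
    (FiberBundle.mem_baseSet_trivializationAt' p)

theorem frameBasis_self (p : M) :
    frameBasis p (FiberBundle.mem_baseSet_trivializationAt' p) = coordBasis (d := d) p := by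
  ext1 i
  rw [frameBasis_apply, coordField_self]

/-- The coefficients are taken in the frame `coordField p`, which is a frame on a whole
neighbourhood and restricts to `coordBasis p` at `p`; this is what lets pointwise definitions be
compared at nearby points. -/
theorem SmoothVFieldNear.exists_coeff {X : VField d M} (hX : SmoothVFieldNear X p) :
    ∃ c : Fin d → M → ℝ, (∀ i, SmoothFunNear d (c i) p) ∧
      (∀ i, c i p = (coordBasis p).repr (X p) i) ∧
      ∀ᶠ q in 𝓝 p, X q = ∑ i, c i q • BoundaryCalculus.coordField p i q := by
  set t := trivializationAt (EuclideanSpace ℝ (Fin d)) (TangentSpace (𝓡 d)) p with ht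
  set b := (coordBasis p).map (t.linearEquivAt ℝ p (FiberBundle.mem_baseSet_trivializationAt' p))
    with hb
  refine ⟨fun i q => t.localFrameCoeff (𝓡 d) b i q (X q), fun i => ?_, fun i => ?_, ?_⟩
  · filter_upwards [hX, frame_baseSet_mem_nhds (d := d) p] with q h1 h2
    exact contMDiffAt_localFrameCoeff (I := 𝓡 d) b h2 h1 i
  · refine (t.localFrameCoeff_apply_of_mem_baseSet (I := 𝓡 d) b
      (FiberBundle.mem_baseSet_trivializationAt' p) X i).trans ?_
    exact congrArg (fun b : Module.Basis (Fin d) ℝ (Tan d p) => b.repr (X p) i) (frameBasis_self p)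
  · filter_upwards [frame_baseSet_mem_nhds (d := d) p] with q hq
    have := t.eq_sum_localFrameCoeff_smul (I := 𝓡 d) (b := b) (s := X) hq
    refine this.trans (Finset.sum_congr rfl fun i _ => ?_)
    rw [← frameBasis_apply p hq, t.localFrame_apply_of_mem_baseSet b hq]
    rfl

end Calculus

/-! ### Operations linear over smooth functions depend on values at a point only. -/

section Tensoriality

variable {d : ℕ} {M : Type*} [TopologicalSpace M] [ChartedSpace (EuclideanSpace ℝ (Fin d)) M]
variable {V : M → Type*} [∀ q, AddCommGroup (V q)] [∀ q, Module ℝ (V q)]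
variable {A : Type*} [AddCommGroup A] [Module ℝ A]

/-- A module of germs of smooth sections at `p` having a smooth local frame. -/
structure FramedGerms (d : ℕ) {M : Type*} [TopologicalSpace M]
    [ChartedSpace (EuclideanSpace ℝ (Fin d)) M] (V : M → Type*) [∀ q, AddCommGroup (V q)]
    [∀ q, Module ℝ (V q)] (ι : Type*) [Fintype ι] (p : M) where
  /-- the smooth germs -/
  IsSmooth : (∀ q, V q) → Prop
  add_mem : ∀ {X Y}, IsSmooth X → IsSmooth Y → IsSmooth fun q => X q + Y q
  smul_mem : ∀ {a : M → ℝ} {X}, SmoothFunNear d a p → IsSmooth X → IsSmooth fun q => a q • X q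
  zero_mem : IsSmooth fun _ => 0
  /-- the frame -/
  frame : ι → ∀ q, V q
  frame_mem : ∀ i, IsSmooth (frame i)
  /-- the components at `p` -/
  coeff : ι → V p →ₗ[ℝ] ℝ
  expand : ∀ X, IsSmooth X → ∃ c : ι → M → ℝ, (∀ i, SmoothFunNear d (c i) p) ∧
    (∀ i, c i p = coeff i (X p)) ∧ ∀ᶠ q in 𝓝 p, X q = ∑ i, c i q • frame i q

/-- Operations on germs of sections that are linear over the smooth functions. -/
structure TensorialNear {ι : Type*} [Fintype ι] {p : M} (G : FramedGerms d V ι p)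
    (Φ : (∀ q, V q) → A) : Prop where
  add : ∀ {X Y}, G.IsSmooth X → G.IsSmooth Y → Φ (fun q => X q + Y q) = Φ X + Φ Y
  smul : ∀ {a : M → ℝ} {X}, SmoothFunNear d a p → G.IsSmooth X → Φ (fun q => a q • X q) = a p • Φ X

namespace TensorialNear

variable {ι : Type*} [Fintype ι] {p : M} {G : FramedGerms d V ι p} {Φ : (∀ q, V q) → A}

theorem zero (h : TensorialNear G Φ) : Φ (fun _ => 0) = 0 := by
  have := h.smul (a := fun _ => 0) (.const 0) G.zero_mem
  simpa using this

/-- Multiplying by the indicator function `ψ` of the set where `X = Y` makes the two fields globally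
equal. Since `ψ` is locally `1`, it is smooth near `p`, so linearity applies and no bump function is
needed. -/
theorem germ_eq (h : TensorialNear G Φ) {X Y : ∀ q, V q} (hX : G.IsSmooth X) (hY : G.IsSmooth Y)
    (hXY : ∀ᶠ q in 𝓝 p, X q = Y q) : Φ X = Φ Y := by
  classical
  let ψ : M → ℝ := fun q => if X q = Y q then 1 else 0
  have h1 : SmoothFunNear d ψ p :=
    (SmoothFunNear.const 1).congr (hXY.mono fun q hq => by simp [ψ, hq])
  have h2 : (fun q => ψ q • X q) = fun q => ψ q • Y q := by
    funext q
    by_cases hq : X q = Y q <;> simp [ψ, hq]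
  have h3 : ψ p = 1 := by simp [ψ, hXY.self_of_nhds]
  have := h.smul h1 hX
  rw [h2, h.smul h1 hY, h3, one_smul, one_smul] at this
  exact this.symm

theorem sum_aux (h : TensorialNear G Φ) {κ : Type*} (S : Finset κ) {X : κ → ∀ q, V q}
    (hX : ∀ i ∈ S, G.IsSmooth (X i)) :
    G.IsSmooth (fun q => ∑ i ∈ S, X i q) ∧
      Φ (fun q => ∑ i ∈ S, X i q) = ∑ i ∈ S, Φ (X i) := by
  classical
  induction S using Finset.induction_on with
  | empty => simpa using ⟨G.zero_mem, h.zero⟩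
  | insert i S hi ih =>
    simp only [Finset.sum_insert hi]
    obtain ⟨h1, h2⟩ := ih fun j hj => hX j (by simp [hj])
    exact ⟨G.add_mem (hX i (by simp)) h1, by rw [h.add (hX i (by simp)) h1, h2]⟩

theorem eq_sum (h : TensorialNear G Φ) {X : ∀ q, V q} (hX : G.IsSmooth X) :
    Φ X = ∑ i, G.coeff i (X p) • Φ (G.frame i) := by
  obtain ⟨c, hc, hcp, hXc⟩ := G.expand X hX
  have hs : ∀ i ∈ Finset.univ, G.IsSmooth fun q => c i q • G.frame i q :=
    fun i _ => G.smul_mem (hc i) (G.frame_mem i)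
  obtain ⟨h1, h2⟩ := h.sum_aux Finset.univ hs
  rw [h.germ_eq hX h1 hXc, h2]
  exact Finset.sum_congr rfl fun i _ => by rw [h.smul (hc i) (G.frame_mem i), hcp]

theorem eq_of_eq (h : TensorialNear G Φ) {X Y : ∀ q, V q} (hX : G.IsSmooth X) (hY : G.IsSmooth Y)
    (hXY : X p = Y p) : Φ X = Φ Y := by
  rw [h.eq_sum hX, h.eq_sum hY, hXY]

/-- The linear map on the fibre induced by a tensorial operation. -/
def toLinear (G : FramedGerms d V ι p) (Φ : (∀ q, V q) → A) : V p →ₗ[ℝ] A :=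
  ∑ i, (G.coeff i).smulRight (Φ (G.frame i))

theorem toLinear_apply (h : TensorialNear G Φ) {X : ∀ q, V q} (hX : G.IsSmooth X) :
    toLinear G Φ (X p) = Φ X := by
  simp [toLinear, h.eq_sum hX]

end TensorialNear

/-- Multi-argument operations on germs of sections that are tensorial in each argument depend on
the values of the arguments only. -/
theorem eq_of_tensorialNear_update {ι κ : Type*} [Fintype ι] [Fintype κ] [DecidableEq κ] {p : M}
    {G : FramedGerms d V ι p} {Φ : (κ → ∀ q, V q) → A}
    (h : ∀ (i : κ) (T : κ → ∀ q, V q), (∀ j, G.IsSmooth (T j)) →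
      TensorialNear G fun X => Φ (Function.update T i X))
    {T T' : κ → ∀ q, V q} (hT : ∀ j, G.IsSmooth (T j)) (hT' : ∀ j, G.IsSmooth (T' j))
    (hTT' : ∀ j, T j p = T' j p) : Φ T = Φ T' := by
  -- The arguments are exchanged one at a time, `S` being the set of slots already exchanged.
  have key : ∀ S : Finset κ, Φ (fun j => if j ∈ S then T' j else T j) = Φ T := by
    intro S
    induction S using Finset.induction_on with
    | empty => simp
    | insert i S hi ih =>
      rw [← ih]
      set R : κ → ∀ q, V q := fun j => if j ∈ S then T' j else T j with hR
      have hRs : ∀ j, G.IsSmooth (R j) := fun j => by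
        by_cases hj : j ∈ S <;> simp [hR, hj, hT, hT']
      have e1 : (fun j => if j ∈ insert i S then T' j else T j) = Function.update R i (T' i) := by
        funext j
        by_cases hj : j = i
        · subst hj; simp
        · simp [hj, hR]
      have e2 : R = Function.update R i (T i) := by
        funext j
        by_cases hj : j = i
        · subst hj; simp [hR, hi]
        · simp [hj]
      rw [e1]
      conv_rhs => rw [e2]
      exact (h i R hRs).eq_of_eq (hT' i) (hT i) (hTT' i).symm
  have := key Finset.univ
  simpa using this.symm

variable [IsManifold (𝓡 d) ∞ M]

/-- Germs of smooth vector fields. -/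
def vfieldGerms (p : M) : FramedGerms d (fun q : M => Tan d q) (Fin d) p where
  IsSmooth X := SmoothVFieldNear X p
  add_mem hX hY := hX.add hY
  smul_mem ha hX := hX.smul ha
  zero_mem := by
    have := (SmoothVFieldNear.sum (d := d) (p := p) (∅ : Finset ℕ) (X := fun _ _ => 0) (by simp))
    simpa using this
  frame := coordField p
  frame_mem := SmoothVFieldNear.coordField p
  coeff i := (coordBasis p).coord i
  expand X hX := hX.exists_coeff

end Tensoriality

/-! ### Smoothness of determinants and inverses. -/

section Determinant

variable {d : ℕ} {M : Type*} [TopologicalSpace M] [ChartedSpace (EuclideanSpace ℝ (Fin d)) M] {p : M}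

theorem smoothFunNear_det {n : Type*} [Fintype n] [DecidableEq n] {A : M → Matrix n n ℝ}
    (hA : ∀ i j, SmoothFunNear d (fun q => A q i j) p) : SmoothFunNear d (fun q => (A q).det) p := by
  simp only [Matrix.det_apply']
  refine .sum _ fun σ _ => .mul (.const _) ?_
  have : ∀ S : Finset n, SmoothFunNear d (fun q => ∏ i ∈ S, A q (σ i) i) p := by
    intro S
    induction S using Finset.induction_on with
    | empty => simpa using .const 1
    | insert i S hi ih =>
      simp only [Finset.prod_insert hi]
      exact (hA _ _).mul ih
  exact this _

theorem SmoothFunNear.inv {𝕜 : Type*} [RCLike 𝕜] {u : M → 𝕜} (hu : SmoothFunNear d u p)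
    (h0 : u p ≠ 0) : SmoothFunNear d (fun q => (u q)⁻¹) p := by
  filter_upwards [hu, hu.contMDiffAt.continuousAt.eventually_ne h0] with q h1 h2
  exact ((contDiffAt_inv ℝ h2).contMDiffAt).comp q h1

end Determinant

/-! ### Gram matrices, raising of indices and metric traces. -/

section Metric

variable {d : ℕ} {M : Type*} [TopologicalSpace M] [ChartedSpace (EuclideanSpace ℝ (Fin d)) M]
  [IsManifold (𝓡 d) ∞ M] (g : PseudoMetric d M) {p : M}
variable {F : Type*} [NormedAddCommGroup F] [NormedSpace ℝ F]

theorem SmoothVFieldNear.exists_open {X : VField d M} (hX : SmoothVFieldNear X p) :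
    ∃ U, IsOpen U ∧ p ∈ U ∧ SmoothVFieldOn U X := by
  obtain ⟨U, hU, hUo, hp⟩ := eventually_nhds_iff.1 hX
  exact ⟨U, hUo, hp, fun q hq => (hU q hq).contMDiffWithinAt⟩

theorem SmoothVFieldOn.mono {X : VField d M} {U V : Set M} (h : SmoothVFieldOn U X) (hV : V ⊆ U) :
    SmoothVFieldOn V X :=
  ContMDiffOn.mono h hV

theorem PseudoMetric.smoothNear {X Y : VField d M} (hX : SmoothVFieldNear X p)
    (hY : SmoothVFieldNear Y p) : SmoothFunNear d (fun q => g.val q (X q) (Y q)) p := by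
  obtain ⟨U, hU, hpU, h1⟩ := hX.exists_open
  obtain ⟨V, hV, hpV, h2⟩ := hY.exists_open
  exact .of_contMDiffOn (hU.inter hV) ⟨hpU, hpV⟩ (g.smooth _ (hU.inter hV) X Y
    (h1.mono inter_subset_left) (h2.mono inter_subset_right))

/-- The inverse of the Gram matrix of the metric at `p` in a family of vectors. -/
def gramInv (p : M) (b : Fin d → Tan d p) : Matrix (Fin d) (Fin d) ℝ :=
  (Matrix.of fun i j => g.val p (b i) (b j))⁻¹

/-- A kernel vector of the Gram matrix gives a linear combination of the basis orthogonal to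
everything, which nondegeneracy excludes. -/
theorem gram_det_ne_zero (b : Module.Basis (Fin d) ℝ (Tan d p)) :
    (Matrix.of fun i j => g.val p (b i) (b j)).det ≠ 0 := by
  intro h
  obtain ⟨x, hx, hx0⟩ := Matrix.exists_mulVec_eq_zero_iff.2 h
  apply hx
  have hv : ∑ j, x j • b j = 0 := by
    apply g.nondegenerate p
    intro w
    have : g.val p (∑ j, x j • b j) = 0 := b.ext fun i => by
      have := congrFun hx0 i
      simp only [Matrix.mulVec, dotProduct, Matrix.of_apply, Pi.zero_apply] at this
      simpa [g.symm p _ (b i), mul_comm] using this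
    rw [this, LinearMap.zero_apply]
  funext j
  exact (Fintype.linearIndependent_iff.1 b.linearIndependent x hv j)

theorem gramInv_symm (b : Fin d → Tan d p) (i j : Fin d) :
    gramInv g p b i j = gramInv g p b j i := by
  have : (gramInv g p b).transpose = gramInv g p b := by
    rw [gramInv, Matrix.transpose_nonsing_inv]
    congr 1
    ext i j
    exact g.symm p _ _
  exact congrFun (congrFun this j) i |>.symm ▸ rfl

theorem sum_gramInv (b : Module.Basis (Fin d) ℝ (Tan d p)) (v : Tan d p) :
    ∑ i, ∑ j, (gramInv g p b i j * g.val p v (b i)) • b j = v := by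
  conv_rhs => rw [← b.sum_repr v]
  rw [Finset.sum_comm]
  refine Finset.sum_congr rfl fun j _ => ?_
  rw [← Finset.sum_smul]
  congr 1
  set A : Matrix (Fin d) (Fin d) ℝ := Matrix.of fun i j => g.val p (b i) (b j) with hA
  have h1 : A * A⁻¹ = 1 := Matrix.mul_nonsing_inv _ (isUnit_iff_ne_zero.2 (gram_det_ne_zero g b))
  have h2 : ∀ i, g.val p v (b i) = ∑ k, b.repr v k * A k i := fun i => by
    conv_lhs => rw [← b.sum_repr v]
    simp only [map_sum, map_smul, LinearMap.sum_apply, LinearMap.smul_apply, smul_eq_mul, hA,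
      Matrix.of_apply]
  have h3 : ∀ k, ∑ i, A k i * A⁻¹ i j = if k = j then 1 else 0 := fun k => by
    rw [← Matrix.mul_apply, h1, Matrix.one_apply]
  calc ∑ i, gramInv g p b i j * g.val p v (b i)
      = ∑ i, ∑ k, b.repr v k * (A k i * A⁻¹ i j) := by
        refine Finset.sum_congr rfl fun i _ => ?_
        rw [h2, Finset.mul_sum]
        exact Finset.sum_congr rfl fun k _ => by simp only [gramInv, ← hA]; ring
    _ = ∑ k, b.repr v k * ∑ i, A k i * A⁻¹ i j := by
        rw [Finset.sum_comm]; simp only [Finset.mul_sum]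
    _ = b.repr v j := by simp [h3]

theorem val_sharp (φ : Tan d p →ₗ[ℝ] ℝ) (w : Tan d p) :
    g.val p (sharp g p fun j => φ (coordBasis p j)) w = φ w := by
  conv_rhs => rw [← sum_gramInv g (coordBasis p) w]
  simp only [sharp, map_sum, map_smul, LinearMap.sum_apply, LinearMap.smul_apply, smul_eq_mul]
  refine Finset.sum_congr rfl fun i _ => Finset.sum_congr rfl fun j _ => ?_
  rw [g.symm p w]
  simp only [invGram, gramInv]
  ring

theorem PseudoMetric.eq_of_val_eq {v w : Tan d p} (h : ∀ z, g.val p v z = g.val p w z) : v = w := by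
  rw [← sub_eq_zero]
  apply g.nondegenerate p
  intro z
  simp [h]

/-- The trace does not depend on the basis: each basis is expanded in the other by `sum_gramInv`,
and both sides become the same double contraction. -/
theorem metricTrace_eq {A : Type*} [AddCommGroup A] [Module ℝ A]
    (β : Tan d p →ₗ[ℝ] Tan d p →ₗ[ℝ] A) (b : Module.Basis (Fin d) ℝ (Tan d p)) :
    metricTrace g p (fun i j => β (coordBasis p i) (coordBasis p j)) =
      ∑ i, ∑ j, gramInv g p b i j • β (b i) (b j) := by
  set c := coordBasis (d := d) p
  have h1 : ∀ i j, β (c i) (c j) =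
      ∑ k, ∑ l, (gramInv g p b k l * g.val p (c j) (b k)) • β (c i) (b l) := fun i j => by
    conv_lhs => rw [← sum_gramInv g b (c j)]
    simp only [map_sum, map_smul]
  have h2 : ∀ k l, β (b k) (b l) =
      ∑ i, ∑ j, (gramInv g p c i j * g.val p (b k) (c i)) • β (c j) (b l) := fun k l => by
    conv_lhs => rw [← sum_gramInv g c (b k)]
    simp only [map_sum, map_smul, LinearMap.sum_apply, LinearMap.smul_apply]
  unfold metricTrace
  simp only [h1, h2, Finset.smul_sum, smul_smul]
  calc _ = ∑ i, ∑ k, ∑ j, ∑ l, (invGram g p i j * (gramInv g p b k l * g.val p (c j) (b k))) • β (c i) (b l) :=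
        Finset.sum_congr rfl fun i _ => Finset.sum_comm
    _ = ∑ k, ∑ i, ∑ j, ∑ l, (invGram g p i j * (gramInv g p b k l * g.val p (c j) (b k))) • β (c i) (b l) :=
        Finset.sum_comm
    _ = ∑ k, ∑ i, ∑ l, ∑ j, (invGram g p i j * (gramInv g p b k l * g.val p (c j) (b k))) • β (c i) (b l) :=
        Finset.sum_congr rfl fun k _ => Finset.sum_congr rfl fun i _ => Finset.sum_comm
    _ = ∑ k, ∑ l, ∑ i, ∑ j, (invGram g p i j * (gramInv g p b k l * g.val p (c j) (b k))) • β (c i) (b l) :=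
        Finset.sum_congr rfl fun k _ => Finset.sum_comm
    _ = _ := by
        refine Finset.sum_congr rfl fun k _ => Finset.sum_congr rfl fun l _ => ?_
        rw [Finset.sum_comm]
        refine Finset.sum_congr rfl fun i _ => Finset.sum_congr rfl fun j _ => ?_
        congr 1
        rw [g.symm p (b k), gramInv_symm g c]
        show gramInv g p c j i * _ = _
        ring

/-- Operations on pairs of vector fields that are tensorial at `q` in both arguments. -/
structure BiTensorialNear {A : Type*} [AddCommGroup A] [Module ℝ A] (q : M)
    (Φ : VField d M → VField d M → A) : Prop where
  left : ∀ Y, SmoothVFieldNear Y q → TensorialNear (vfieldGerms q) fun X => Φ X Y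
  right : ∀ X, SmoothVFieldNear X q → TensorialNear (vfieldGerms q) fun Y => Φ X Y

/-- The bilinear map induced by a bitensorial operation. -/
def BiTensorialNear.toBilin {A : Type*} [AddCommGroup A] [Module ℝ A] (q : M)
    (Φ : VField d M → VField d M → A) : Tan d q →ₗ[ℝ] Tan d q →ₗ[ℝ] A :=
  TensorialNear.toLinear (vfieldGerms q) fun X => TensorialNear.toLinear (vfieldGerms q) fun Y => Φ X Y

theorem BiTensorialNear.toBilin_apply {A : Type*} [AddCommGroup A] [Module ℝ A] {q : M}
    {Φ : VField d M → VField d M → A} (h : BiTensorialNear q Φ) {X Y : VField d M}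
    (hX : SmoothVFieldNear X q) (hY : SmoothVFieldNear Y q) :
    toBilin q Φ (X q) (Y q) = Φ X Y := by
  have : ∀ X, SmoothVFieldNear X q →
      TensorialNear.toLinear (vfieldGerms q) (fun Y => Φ X Y) (Y q) = Φ X Y := fun X hX =>
    (h.right X hX).toLinear_apply hY
  rw [← this X hX]
  have h2 : TensorialNear (vfieldGerms q)
      fun X => TensorialNear.toLinear (vfieldGerms q) (fun Y => Φ X Y) (Y q) := by
    constructor
    · intro X X' hX hX'
      rw [this _ hX, this _ hX', this _ ((vfieldGerms q).add_mem hX hX')]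
      exact (h.left Y hY).add hX hX'
    · intro a X ha hX
      rw [this _ hX, this _ ((vfieldGerms q).smul_mem ha hX)]
      exact (h.left Y hY).smul ha hX
  rw [← h2.toLinear_apply hX]
  simp [toBilin, TensorialNear.toLinear]

theorem BiTensorialNear.metricTrace_eq {A : Type*} [AddCommGroup A] [Module ℝ A] {q : M}
    {Φ : VField d M → VField d M → A} (h : BiTensorialNear q Φ) {b : Fin d → VField d M}
    (hb : ∀ i, SmoothVFieldNear (b i) q) (b' : Module.Basis (Fin d) ℝ (Tan d q))
    (hbb : ∀ i, b' i = b i q) :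
    metricTrace g q (fun i j => Φ (coordField q i) (coordField q j)) =
      ∑ i, ∑ j, gramInv g q (fun i => b i q) i j • Φ (b i) (b j) := by
  have h1 := BoundaryCalculus.metricTrace_eq g (toBilin q Φ) b'
  have h2 : (fun i => b i q) = b' := by funext i; rw [hbb]
  rw [h2]
  convert h1 using 1
  · congr 1
    funext i j
    rw [← coordField_self q i, ← coordField_self q j, h.toBilin_apply (.coordField q i) (.coordField q j)]
  · refine Finset.sum_congr rfl fun i _ => Finset.sum_congr rfl fun j _ => ?_
    rw [hbb, hbb, h.toBilin_apply (hb i) (hb j)]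

theorem smoothFunNear_gramInv (i j : Fin d) :
    SmoothFunNear d (fun q => gramInv g q (fun i => coordField p i q) i j) p := by
  have hA : ∀ i j, SmoothFunNear d (fun q => (Matrix.of fun i j =>
      g.val q (coordField p i q) (coordField p j q)) i j) p := fun i j =>
    g.smoothNear (.coordField p i) (.coordField p j)
  simp only [gramInv, Matrix.inv_def, Matrix.smul_apply, Ring.inverse_eq_inv', smul_eq_mul,
    Matrix.adjugate_apply]
  refine SmoothFunNear.mul (.inv (smoothFunNear_det hA) ?_) (smoothFunNear_det fun k l => ?_)
  · simpa using gram_det_ne_zero g (coordBasis (d := d) p)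
  · by_cases h : k = j
    · subst h
      simpa using .const _
    · simpa [Matrix.updateRow_ne h] using hA k l

/-- At each `q` the trace is written in the frame centred at `q`, which need not vary smoothly with
`q`. Bitensoriality allows it to be rewritten in the fixed frame centred at `p`, where smoothness is
visible. -/
theorem smoothFunNear_metricTrace {Φ : VField d M → VField d M → M → F}
    (h : ∀ᶠ q in 𝓝 p, BiTensorialNear q fun X Y => Φ X Y q)
    (hs : ∀ i j, SmoothFunNear d (Φ (coordField p i) (coordField p j)) p) :
    SmoothFunNear d (fun q => metricTrace g q fun i j => Φ (coordField q i) (coordField q j) q) p := by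
  have h1 : SmoothFunNear d (fun q => ∑ i, ∑ j, gramInv g q (fun i => coordField p i q) i j •
      Φ (coordField p i) (coordField p j) q) p :=
    .sum _ fun i _ => .sum _ fun j _ => .smul (smoothFunNear_gramInv g i j) (hs i j)
  refine h1.congr ?_
  have h2 : ∀ᶠ q in 𝓝 p, ∀ i, SmoothVFieldNear (coordField (d := d) p i) q :=
    Filter.eventually_all.2 fun i => (SmoothVFieldNear.coordField (d := d) p i).eventually
  filter_upwards [h, h2, frame_baseSet_mem_nhds (d := d) p] with q hq hq2 hq3
  exact (hq.metricTrace_eq g hq2 (frameBasis p hq3) fun i => frameBasis_apply p hq3 i).symm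

end Metric

/-! ### Lie brackets and the Levi-Civita connection. -/

section Bracket

variable {d : ℕ} {M : Type*} [TopologicalSpace M] [ChartedSpace (EuclideanSpace ℝ (Fin d)) M]
  {p : M} {X X' Y Y' : VField d M}

theorem bracket_congr (hX : VFieldEqNear X X' p) (hY : VFieldEqNear Y Y' p) :
    VectorField.mlieBracket (𝓡 d) X Y p = VectorField.mlieBracket (𝓡 d) X' Y' p :=
  Filter.EventuallyEq.mlieBracket_vectorField_eq hX hY

end Bracket

section Connection

variable {d : ℕ} {M : Type*} [TopologicalSpace M] [ChartedSpace (EuclideanSpace ℝ (Fin d)) M]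
  [IsManifold (𝓡 d) ∞ M] (g : PseudoMetric d M) {p : M}
variable {X X' Y Y' Z Z' : VField d M} {a : M → ℝ}

theorem bracket_add_left (hX : SmoothVFieldNear X p) (hX' : SmoothVFieldNear X' p) :
    VectorField.mlieBracket (𝓡 d) (fun q => X q + X' q) Y p =
      VectorField.mlieBracket (𝓡 d) X Y p + VectorField.mlieBracket (𝓡 d) X' Y p :=
  VectorField.mlieBracket_add_left hX.mdifferentiableAt hX'.mdifferentiableAt

theorem bracket_add_right (hY : SmoothVFieldNear Y p) (hY' : SmoothVFieldNear Y' p) :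
    VectorField.mlieBracket (𝓡 d) X (fun q => Y q + Y' q) p =
      VectorField.mlieBracket (𝓡 d) X Y p + VectorField.mlieBracket (𝓡 d) X Y' p :=
  VectorField.mlieBracket_add_right hY.mdifferentiableAt hY'.mdifferentiableAt

theorem bracket_smul_left (ha : SmoothFunNear d a p) (hX : SmoothVFieldNear X p) :
    VectorField.mlieBracket (𝓡 d) (fun q => a q • X q) Y p =
      a p • VectorField.mlieBracket (𝓡 d) X Y p - dirDeriv a p (Y p) • X p := by
  have := VectorField.mlieBracket_smul_left (W := Y) ha.mdifferentiableAt hX.mdifferentiableAt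
  refine this.trans ?_
  rw [dirDeriv, neg_smul, neg_add_eq_sub]

theorem bracket_smul_right (ha : SmoothFunNear d a p) (hY : SmoothVFieldNear Y p) :
    VectorField.mlieBracket (𝓡 d) X (fun q => a q • Y q) p =
      a p • VectorField.mlieBracket (𝓡 d) X Y p + dirDeriv a p (X p) • Y p := by
  have := VectorField.mlieBracket_smul_right (V := X) ha.mdifferentiableAt hY.mdifferentiableAt
  refine this.trans ?_
  rw [dirDeriv, add_comm]

/-- The action of the Lie bracket on functions. -/
theorem dirDeriv_bracket (hX : SmoothVFieldNear X p) (hY : SmoothVFieldNear Y p)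
    (ha : SmoothFunNear d a p) :
    dirDeriv a p (VectorField.mlieBracket (𝓡 d) X Y p) =
      dirDeriv (fun q => dirDeriv a q (Y q)) p (X p) -
        dirDeriv (fun q => dirDeriv a q (X q)) p (Y p) := by
  rcases Nat.eq_zero_or_pos d with rfl | hd
  · have h0 : ∀ v : Tan 0 p, v = 0 := fun v =>
      (coordBasis p).ext_elem (fun i => i.elim0)
    rw [h0 (VectorField.mlieBracket (𝓡 0) X Y p), h0 (X p), h0 (Y p)]
    simp [dirDeriv]
  have : IsManifold (𝓡 d) (minSmoothness ℝ 3) M := by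
    rw [minSmoothness_of_isRCLikeNormedField]; exact .of_le (n := ∞) (by norm_cast)
  set Z := coordField (d := d) p ⟨0, hd⟩ with hZdef
  have hZ : SmoothVFieldNear Z p := .coordField p _
  have hZ0 : Z p ≠ 0 := by
    rw [hZdef, coordField_self]; exact (coordBasis p).ne_zero _
  have hle : ∀ {W : VField d M}, SmoothVFieldNear W p →
      ContMDiffAt (𝓡 d) ((𝓡 d).prod 𝓘(ℝ, EuclideanSpace ℝ (Fin d))) (minSmoothness ℝ 2)
        (fun p => (⟨p, W p⟩ : TangentBundle (𝓡 d) M)) p := fun hW => by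
    rw [minSmoothness_of_isRCLikeNormedField]
    exact hW.contMDiffAt.of_le (by norm_cast)
  -- The Jacobi identity for `X, Y, aZ`, compared with `a` times that for `X, Y, Z`, leaves the
  -- desired identity for `a` multiplied by `Z p`. A field `Z` with `Z p ≠ 0` exists because `d >
  -- 0`.
  have j1 := VectorField.leibniz_identity_mlieBracket_apply (I := 𝓡 d) (hle hX) (hle hY)
    (hle (hZ.smul ha))
  have j2 := VectorField.leibniz_identity_mlieBracket_apply (I := 𝓡 d) (hle hX) (hle hY) (hle hZ)
  have e : ∀ {W : VField d M}, VFieldEqNear (VectorField.mlieBracket (𝓡 d) W (fun q => a q • Z q))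
      (fun q => a q • VectorField.mlieBracket (𝓡 d) W Z q + dirDeriv a q (W q) • Z q) p := by
    intro W
    filter_upwards [ha.eventually, hZ.eventually] with q h1 h2
    exact bracket_smul_right h1 h2
  rw [bracket_congr (.refl _ _) e, bracket_congr (.refl _ _) e, bracket_smul_right ha hZ,
    bracket_add_right ((hY.bracket hZ).smul ha) (hZ.smul (hY.dirDeriv ha)),
    bracket_add_right ((hX.bracket hZ).smul ha) (hZ.smul (hX.dirDeriv ha)),
    bracket_smul_right ha (hY.bracket hZ), bracket_smul_right ha (hX.bracket hZ),
    bracket_smul_right (hY.dirDeriv ha) hZ, bracket_smul_right (hX.dirDeriv ha) hZ, j2] at j1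
  have : (dirDeriv a p (VectorField.mlieBracket (𝓡 d) X Y p) -
      (dirDeriv (fun q => dirDeriv a q (Y q)) p (X p) -
        dirDeriv (fun q => dirDeriv a q (X q)) p (Y p))) • Z p = 0 := by
    rw [sub_smul, sub_smul]
    refine Eq.trans ?_ (neg_eq_zero.2 (sub_eq_zero.2 j1))
    module
  rw [smul_eq_zero, or_iff_left hZ0, sub_eq_zero] at this
  exact this

theorem koszul_congr (hX : VFieldEqNear X X' p) (hY : VFieldEqNear Y Y' p) (hZ : VFieldEqNear Z Z' p) :
    koszul g X Y Z p = koszul g X' Y' Z' p := by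
  have h : ∀ {A A' B B' : VField d M}, VFieldEqNear A A' p → VFieldEqNear B B' p →
      (fun q => g.val q (A q) (B q)) =ᶠ[𝓝 p] fun q => g.val q (A' q) (B' q) := by
    intro A A' B B' h1 h2
    filter_upwards [h1, h2] with q h1 h2
    rw [h1, h2]
  unfold koszul
  rw [dirDeriv_congr (h hY hZ), dirDeriv_congr (h hX hZ), dirDeriv_congr (h hX hY),
    bracket_congr hX hY, bracket_congr hX hZ, bracket_congr hY hZ, hX.self_of_nhds, hY.self_of_nhds,
    hZ.self_of_nhds]

/-- The derivatives of `a` along `X` and `Y` coming from the product rule cancel against those in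
the brackets `[X, aZ]` and `[Y, aZ]`. -/
theorem koszul_tensorial (hX : SmoothVFieldNear X p) (hY : SmoothVFieldNear Y p) :
    TensorialNear (vfieldGerms p) fun Z => koszul g X Y Z p where
  add {Z Z'} hZ hZ' := by
    change SmoothVFieldNear _ _ at hZ hZ'
    simp only [koszul, map_add]
    rw [dirDeriv_add (g.smoothNear hY hZ) (g.smoothNear hY hZ'),
      dirDeriv_add (g.smoothNear hX hZ) (g.smoothNear hX hZ'), dirDeriv_add_right,
      bracket_add_right hZ hZ', bracket_add_right hZ hZ']
    simp only [map_add, LinearMap.add_apply]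
    ring
  smul {a Z} ha hZ := by
    change SmoothVFieldNear _ _ at hZ
    simp only [koszul, map_smul, smul_eq_mul]
    rw [dirDeriv_mul ha (g.smoothNear hY hZ), dirDeriv_mul ha (g.smoothNear hX hZ),
      dirDeriv_smul_right, bracket_smul_right ha hZ, bracket_smul_right ha hZ]
    simp only [map_smul, map_add, LinearMap.add_apply, LinearMap.smul_apply, smul_eq_mul]
    rw [g.symm p (Z p), g.symm p (Z p)]
    ring

theorem koszul_tensorial_left (hY : SmoothVFieldNear Y p) (hZ : SmoothVFieldNear Z p) :
    TensorialNear (vfieldGerms p) fun X => koszul g X Y Z p where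
  add {X X'} hX hX' := by
    change SmoothVFieldNear _ _ at hX hX'
    simp only [koszul, map_add, LinearMap.add_apply]
    rw [dirDeriv_add (g.smoothNear hX hZ) (g.smoothNear hX' hZ),
      dirDeriv_add (g.smoothNear hX hY) (g.smoothNear hX' hY), dirDeriv_add_right,
      bracket_add_left hX hX', bracket_add_left hX hX']
    simp only [map_add, LinearMap.add_apply]
    ring
  smul {a X} ha hX := by
    change SmoothVFieldNear _ _ at hX
    simp only [koszul, map_smul, LinearMap.smul_apply, smul_eq_mul]
    rw [dirDeriv_mul ha (g.smoothNear hX hZ), dirDeriv_mul ha (g.smoothNear hX hY),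
      dirDeriv_smul_right, bracket_smul_left ha hX, bracket_smul_left ha hX]
    simp only [map_smul, map_sub, LinearMap.sub_apply, LinearMap.smul_apply, smul_eq_mul]
    ring

theorem koszul_add_right (hX : SmoothVFieldNear X p) (hY : SmoothVFieldNear Y p)
    (hY' : SmoothVFieldNear Y' p) (hZ : SmoothVFieldNear Z p) :
    koszul g X (fun q => Y q + Y' q) Z p = koszul g X Y Z p + koszul g X Y' Z p := by
  simp only [koszul, map_add, LinearMap.add_apply]
  rw [dirDeriv_add (g.smoothNear hY hZ) (g.smoothNear hY' hZ),
    dirDeriv_add (g.smoothNear hX hY) (g.smoothNear hX hY'), dirDeriv_add_right,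
    bracket_add_left hY hY', bracket_add_right hY hY']
  simp only [map_add, LinearMap.add_apply]
  ring

theorem koszul_smul_right (ha : SmoothFunNear d a p) (hX : SmoothVFieldNear X p)
    (hY : SmoothVFieldNear Y p) (hZ : SmoothVFieldNear Z p) :
    koszul g X (fun q => a q • Y q) Z p =
      a p * koszul g X Y Z p + dirDeriv a p (X p) * g.val p (Y p) (Z p) := by
  simp only [koszul, map_smul, LinearMap.smul_apply, smul_eq_mul]
  rw [dirDeriv_mul ha (g.smoothNear hY hZ), dirDeriv_mul ha (g.smoothNear hX hY),
    dirDeriv_smul_right, bracket_smul_left ha hY, bracket_smul_right ha hY]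
  simp only [map_smul, map_sub, map_add, LinearMap.sub_apply, LinearMap.add_apply,
    LinearMap.smul_apply, smul_eq_mul]
  rw [g.symm p (Y p) (X p)]
  ring

theorem koszul_smooth (hX : SmoothVFieldNear X p) (hY : SmoothVFieldNear Y p)
    (hZ : SmoothVFieldNear Z p) : SmoothFunNear d (koszul g X Y Z) p := by
  have h := (((((hX.dirDeriv (g.smoothNear hY hZ)).add (hY.dirDeriv (g.smoothNear hX hZ))).sub
    (hZ.dirDeriv (g.smoothNear hX hY))).add (g.smoothNear (hX.bracket hY) hZ)).sub
    (g.smoothNear (hX.bracket hZ) hY)).sub (g.smoothNear (hY.bracket hZ) hX)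
  have h2 := h.mul (.const (2⁻¹ : ℝ))
  exact h2.congr (.of_forall fun q => by simp only [koszul]; ring)

/-- The definition of `lc` only tests against the frame at `p`; tensoriality of the Koszul
expression in `Z` extends this to all smooth `Z`. -/
theorem val_lc (hX : SmoothVFieldNear X p) (hY : SmoothVFieldNear Y p)
    (hZ : SmoothVFieldNear Z p) : g.val p (lc g X Y p) (Z p) = koszul g X Y Z p := by
  have h := koszul_tensorial g hX hY
  rw [← h.toLinear_apply hZ, ← val_sharp g (TensorialNear.toLinear (vfieldGerms p) fun Z => koszul g X Y Z p) (Z p), lc]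
  congr 3
  funext j
  rw [← coordField_self, h.toLinear_apply (.coordField p j)]

theorem exists_smooth_extension (v : Tan d p) : ∃ Z : VField d M, SmoothVFieldNear Z p ∧ Z p = v := by
  refine ⟨fun q => ∑ i, (coordBasis p).repr v i • coordField p i q,
    .sum _ fun i _ => (SmoothVFieldNear.coordField p i).smul (.const _), ?_⟩
  simp only [coordField_self]
  exact (coordBasis p).sum_repr v

/-- Nondegeneracy turns the Koszul identity into a characterisation; all rules for `lc` are derived
through it. -/
theorem eq_lc {v : Tan d p} (hX : SmoothVFieldNear X p) (hY : SmoothVFieldNear Y p)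
    (h : ∀ Z, SmoothVFieldNear Z p → g.val p v (Z p) = koszul g X Y Z p) : lc g X Y p = v := by
  refine g.eq_of_val_eq fun z => ?_
  obtain ⟨Z, hZ, rfl⟩ := exists_smooth_extension z
  rw [val_lc g hX hY hZ, h Z hZ]

theorem lc_tensorial (hY : SmoothVFieldNear Y p) :
    TensorialNear (vfieldGerms p) fun X => lc g X Y p where
  add hX hX' := eq_lc g (hX.add hX') hY fun Z hZ => by
    rw [map_add, LinearMap.add_apply, val_lc g hX hY hZ, val_lc g hX' hY hZ]
    exact ((koszul_tensorial_left g hY hZ).add hX hX').symm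
  smul ha hX := eq_lc g (hX.smul ha) hY fun Z hZ => by
    rw [map_smul, LinearMap.smul_apply, val_lc g hX hY hZ]
    exact ((koszul_tensorial_left g hY hZ).smul ha hX).symm

theorem lc_add_right (hX : SmoothVFieldNear X p) (hY : SmoothVFieldNear Y p)
    (hY' : SmoothVFieldNear Y' p) :
    lc g X (fun q => Y q + Y' q) p = lc g X Y p + lc g X Y' p :=
  eq_lc g hX (hY.add hY') fun Z hZ => by
    rw [map_add, LinearMap.add_apply, val_lc g hX hY hZ, val_lc g hX hY' hZ,
      koszul_add_right g hX hY hY' hZ]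

theorem lc_smul_right (ha : SmoothFunNear d a p) (hX : SmoothVFieldNear X p)
    (hY : SmoothVFieldNear Y p) :
    lc g X (fun q => a q • Y q) p = a p • lc g X Y p + dirDeriv a p (X p) • Y p :=
  eq_lc g hX (hY.smul ha) fun Z hZ => by
    rw [map_add, map_smul, map_smul, LinearMap.add_apply, LinearMap.smul_apply,
      LinearMap.smul_apply, val_lc g hX hY hZ, koszul_smul_right g ha hX hY hZ]
    rfl

theorem lc_congr (hX : VFieldEqNear X X' p) (hY : VFieldEqNear Y Y' p) : lc g X Y p = lc g X' Y' p := by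
  unfold lc
  congr 1
  funext j
  exact koszul_congr g hX hY (.refl _ _)

/-- The field is recovered from its pairings with the frame by means of the inverse Gram matrix,
whose entries are smooth. -/
theorem smoothVFieldNear_of_val
    (h : ∀ i, SmoothFunNear d (fun q => g.val q (X q) (coordField p i q)) p) :
    SmoothVFieldNear X p := by
  have h1 : SmoothVFieldNear (fun q => ∑ i, ∑ j, (gramInv g q (fun i => coordField p i q) i j *
      g.val q (X q) (coordField p i q)) • coordField p j q) p :=
    .sum _ fun i _ => .sum _ fun j _ =>
      (SmoothVFieldNear.coordField p j).smul ((smoothFunNear_gramInv g i j).mul (h i))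
  refine h1.congr ?_
  filter_upwards [frame_baseSet_mem_nhds (d := d) p] with q hq
  have h2 := sum_gramInv g (frameBasis p hq) (X q)
  have h3 : ⇑(frameBasis p hq) = fun i => coordField p i q := by
    funext i; exact frameBasis_apply p hq i
  rwa [h3] at h2

theorem SmoothVFieldNear.lc (hX : SmoothVFieldNear X p) (hY : SmoothVFieldNear Y p) :
    SmoothVFieldNear (BoundaryCalculus.lc g X Y) p := by
  refine smoothVFieldNear_of_val g fun i => (koszul_smooth g hX hY (.coordField p i)).congr ?_
  filter_upwards [hX.eventually, hY.eventually, (SmoothVFieldNear.coordField p i).eventually]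
    with q h1 h2 h3
  exact (val_lc g h1 h2 h3).symm

end Connection

/-! ### Curvature, Schouten tensor, gradient and Hessian. -/

section Curvature

variable {d : ℕ} {M : Type*} [TopologicalSpace M] [ChartedSpace (EuclideanSpace ℝ (Fin d)) M]
  [IsManifold (𝓡 d) ∞ M] (g : PseudoMetric d M) {p : M}
variable {X X' Y Y' Z Z' : VField d M} {a : M → ℝ}

theorem SmoothVFieldNear.riem (hX : SmoothVFieldNear X p) (hY : SmoothVFieldNear Y p)
    (hZ : SmoothVFieldNear Z p) : SmoothVFieldNear (BoundaryCalculus.riem g X Y Z) p :=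
  ((hX.lc g (hY.lc g hZ)).sub (hY.lc g (hX.lc g hZ))).sub ((hX.bracket hY).lc g hZ)

theorem riem_swap (hX : SmoothVFieldNear X p) (hY : SmoothVFieldNear Y p)
    (hZ : SmoothVFieldNear Z p) : riem g X Y Z p = - riem g Y X Z p := by
  have h1 : lc g (VectorField.mlieBracket (𝓡 d) X Y) Z p =
      - lc g (VectorField.mlieBracket (𝓡 d) Y X) Z p := by
    have := (lc_tensorial g hZ).smul (a := fun _ => -1) (.const _) (hY.bracket hX)
    simp only [neg_smul, one_smul] at this
    rw [← this]
    refine lc_congr g (.of_forall fun q => ?_) (.refl _ _)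
    exact VectorField.mlieBracket_swap_apply
  simp only [riem, h1]
  abel

theorem riem_tensorial_left (hY : SmoothVFieldNear Y p) (hZ : SmoothVFieldNear Z p) :
    TensorialNear (vfieldGerms p) fun X => riem g X Y Z p where
  add {X X'} hX hX' := by
    change SmoothVFieldNear _ _ at hX hX'
    have e1 : VFieldEqNear (lc g (fun q => X q + X' q) Z) (fun q => lc g X Z q + lc g X' Z q) p := by
      filter_upwards [hX.eventually, hX'.eventually, hZ.eventually] with q h1 h2 h3
      exact (lc_tensorial g h3).add h1 h2
    have e2 : VFieldEqNear (VectorField.mlieBracket (𝓡 d) (fun q => X q + X' q) Y)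
        (fun q => VectorField.mlieBracket (𝓡 d) X Y q + VectorField.mlieBracket (𝓡 d) X' Y q) p := by
      filter_upwards [hX.eventually, hX'.eventually] with q h1 h2
      exact bracket_add_left h1 h2
    simp only [riem]
    rw [lc_congr g (.refl _ _) e1, lc_congr g e2 (.refl _ _), lc_add_right g hY (hX.lc g hZ) (hX'.lc g hZ),
      (lc_tensorial g (hY.lc g hZ)).add hX hX',
      (lc_tensorial g hZ).add (hX.bracket hY) (hX'.bracket hY)]
    abel
  smul {a X} ha hX := by
    change SmoothVFieldNear _ _ at hX
    have e1 : VFieldEqNear (lc g (fun q => a q • X q) Z) (fun q => a q • lc g X Z q) p := by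
      filter_upwards [hX.eventually, ha.eventually, hZ.eventually] with q h1 h2 h3
      exact (lc_tensorial g h3).smul h2 h1
    have e2 : VFieldEqNear (VectorField.mlieBracket (𝓡 d) (fun q => a q • X q) Y)
        (fun q => a q • VectorField.mlieBracket (𝓡 d) X Y q + (-dirDeriv a q (Y q)) • X q) p := by
      filter_upwards [hX.eventually, ha.eventually] with q h1 h2
      rw [bracket_smul_left h2 h1, neg_smul, sub_eq_add_neg]
    have h4 := (hY.dirDeriv ha).neg
    simp only [riem]
    rw [lc_congr g (.refl _ _) e1, lc_congr g e2 (.refl _ _), lc_smul_right g ha hY (hX.lc g hZ),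
      (lc_tensorial g (hY.lc g hZ)).smul ha hX,
      (lc_tensorial g hZ).add ((hX.bracket hY).smul ha) (hX.smul h4),
      (lc_tensorial g hZ).smul ha (hX.bracket hY), (lc_tensorial g hZ).smul h4 hX]
    module

theorem riem_tensorial_mid (hX : SmoothVFieldNear X p) (hZ : SmoothVFieldNear Z p) :
    TensorialNear (vfieldGerms p) fun Y => riem g X Y Z p where
  add hY hY' := by
    have := (riem_tensorial_left g hX hZ).add hY hY'
    rw [riem_swap g hX (.add hY hY') hZ, riem_swap g hX hY hZ, riem_swap g hX hY' hZ, this, neg_add]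
  smul ha hY := by
    have := (riem_tensorial_left g hX hZ).smul ha hY
    rw [riem_swap g hX (.smul hY ha) hZ, riem_swap g hX hY hZ, this, smul_neg]

/-- The first derivatives of `a` cancel in pairs; the second derivatives cancel because the bracket
acts on functions as a commutator (`dirDeriv_bracket`). -/
theorem riem_tensorial_right (hX : SmoothVFieldNear X p) (hY : SmoothVFieldNear Y p) :
    TensorialNear (vfieldGerms p) fun Z => riem g X Y Z p where
  add {Z Z'} hZ hZ' := by
    change SmoothVFieldNear _ _ at hZ hZ'
    have e : ∀ {W : VField d M}, SmoothVFieldNear W p →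
        VFieldEqNear (lc g W (fun q => Z q + Z' q)) (fun q => lc g W Z q + lc g W Z' q) p := by
      intro W hW
      filter_upwards [hW.eventually, hZ.eventually, hZ'.eventually] with q h1 h2 h3
      exact lc_add_right g h1 h2 h3
    simp only [riem]
    rw [lc_congr g (.refl _ _) (e hY), lc_congr g (.refl _ _) (e hX), lc_add_right g (hX.bracket hY) hZ hZ',
      lc_add_right g hX (hY.lc g hZ) (hY.lc g hZ'), lc_add_right g hY (hX.lc g hZ) (hX.lc g hZ')]
    abel
  smul {a Z} ha hZ := by
    change SmoothVFieldNear _ _ at hZ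
    have e : ∀ {W : VField d M}, SmoothVFieldNear W p →
        VFieldEqNear (lc g W (fun q => a q • Z q))
          (fun q => a q • lc g W Z q + dirDeriv a q (W q) • Z q) p := by
      intro W hW
      filter_upwards [hW.eventually, ha.eventually, hZ.eventually] with q h1 h2 h3
      exact lc_smul_right g h2 h1 h3
    simp only [riem]
    rw [lc_congr g (.refl _ _) (e hY), lc_congr g (.refl _ _) (e hX), lc_smul_right g ha (hX.bracket hY) hZ,
      lc_add_right g hX ((hY.lc g hZ).smul ha) (hZ.smul (hY.dirDeriv ha)),
      lc_add_right g hY ((hX.lc g hZ).smul ha) (hZ.smul (hX.dirDeriv ha)),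
      lc_smul_right g ha hX (hY.lc g hZ), lc_smul_right g ha hY (hX.lc g hZ),
      lc_smul_right g (hY.dirDeriv ha) hX hZ, lc_smul_right g (hX.dirDeriv ha) hY hZ,
      dirDeriv_bracket hX hY ha]
    module

theorem ric_bitensorial (p : M) : BiTensorialNear p fun Y Z => ric g Y Z p where
  left Z hZ :=
    { add := fun hY hY' => by
        simp only [ric]
        rw [← Finset.sum_add_distrib]
        refine Finset.sum_congr rfl fun i _ => ?_
        rw [(riem_tensorial_mid g (.coordField p i) hZ).add hY hY', map_add, Finsupp.add_apply]
      smul := fun ha hY => by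
        simp only [ric]
        rw [Finset.smul_sum]
        refine Finset.sum_congr rfl fun i _ => ?_
        rw [(riem_tensorial_mid g (.coordField p i) hZ).smul ha hY, map_smul, Finsupp.smul_apply] }
  right Y hY :=
    { add := fun hZ hZ' => by
        simp only [ric]
        rw [← Finset.sum_add_distrib]
        refine Finset.sum_congr rfl fun i _ => ?_
        rw [(riem_tensorial_right g (.coordField p i) hY).add hZ hZ', map_add, Finsupp.add_apply]
      smul := fun ha hZ => by
        simp only [ric]
        rw [Finset.smul_sum]
        refine Finset.sum_congr rfl fun i _ => ?_
        rw [(riem_tensorial_right g (.coordField p i) hY).smul ha hZ, map_smul,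
          Finsupp.smul_apply] }

/-- At each `q` the Ricci tensor is the trace of an endomorphism of the tangent space. The trace is
independent of the basis, so it may be computed in the frame centred at `p`, with smooth components.
-/
theorem ric_smooth (hY : SmoothVFieldNear Y p) (hZ : SmoothVFieldNear Z p) :
    SmoothFunNear d (ric g Y Z) p := by
  have hW : ∀ i, SmoothVFieldNear (riem g (coordField p i) Y Z) p := fun i =>
    (SmoothVFieldNear.coordField p i).riem g hY hZ
  choose c hc _ hcW using fun i => (hW i).exists_coeff
  have h1 : SmoothFunNear d (fun q => ∑ i, c i i q) p := .sum _ fun i _ => hc i i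
  refine h1.congr ?_
  have hf : ∀ᶠ q in 𝓝 p, ∀ i, SmoothVFieldNear (coordField (d := d) p i) q :=
    Filter.eventually_all.2 fun i => (SmoothVFieldNear.coordField (d := d) p i).eventually
  filter_upwards [Filter.eventually_all.2 hcW, hf, frame_baseSet_mem_nhds (d := d) p,
    hY.eventually, hZ.eventually] with q h2 h3 h4 h5 h6
  have ht := riem_tensorial_left g h5 h6
  set L : Tan d q →ₗ[ℝ] Tan d q :=
    TensorialNear.toLinear (vfieldGerms q) fun X => riem g X Y Z q with hL
  have e1 : ric g Y Z q = LinearMap.trace ℝ _ L := by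
    rw [LinearMap.trace_eq_matrix_trace ℝ (coordBasis q), Matrix.trace, ric]
    refine Finset.sum_congr rfl fun i _ => ?_
    rw [Matrix.diag_apply, LinearMap.toMatrix_apply, ← coordField_self q i,
      ht.toLinear_apply (.coordField q i)]
  rw [e1, LinearMap.trace_eq_matrix_trace ℝ (frameBasis p h4), Matrix.trace]
  refine Finset.sum_congr rfl fun i _ => ?_
  rw [Matrix.diag_apply, LinearMap.toMatrix_apply, frameBasis_apply, ht.toLinear_apply (h3 i), h2 i]
  simp only [← frameBasis_apply p h4]
  simp [Finsupp.single_apply]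

theorem schoutenJ_smooth (p : M) : SmoothFunNear d (schoutenJ g) p := by
  have h := smoothFunNear_metricTrace g (p := p) (Φ := fun X Y q => ric g X Y q)
    (.of_forall fun q => ric_bitensorial g q) fun i j => ric_smooth g (.coordField p i) (.coordField p j)
  exact (h.mul (.const (2 * ((d : ℝ) - 1))⁻¹)).congr (.of_forall fun _ => rfl)

theorem schouten_bitensorial (p : M) : BiTensorialNear p fun Y Z => schouten g Y Z p where
  left Z hZ :=
    { add := fun hY hY' => by
        simp only [schouten, ((ric_bitensorial g p).left Z hZ).add hY hY', map_add,
          LinearMap.add_apply]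
        ring
      smul := fun ha hY => by
        simp only [schouten, ((ric_bitensorial g p).left Z hZ).smul ha hY, map_smul,
          LinearMap.smul_apply, smul_eq_mul]
        ring }
  right Y hY :=
    { add := fun hZ hZ' => by
        simp only [schouten, ((ric_bitensorial g p).right Y hY).add hZ hZ', map_add]
        ring
      smul := fun ha hZ => by
        simp only [schouten, ((ric_bitensorial g p).right Y hY).smul ha hZ, map_smul, smul_eq_mul]
        ring }

theorem schouten_smooth (hY : SmoothVFieldNear Y p) (hZ : SmoothVFieldNear Z p) :
    SmoothFunNear d (schouten g Y Z) p :=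
  ((((ric_smooth g hY hZ).sub ((schoutenJ_smooth g p).mul (g.smoothNear hY hZ))).mul
    (.const ((d : ℝ) - 2)⁻¹))).congr (.of_forall fun _ => rfl)

theorem val_grad (s : M → ℝ) (v : Tan d p) : g.val p (grad g s p) v = dirDeriv s p v :=
  val_sharp g (mvfderiv (𝓡 d) s p).toLinearMap v

theorem grad_smooth {s : M → ℝ} (hs : SmoothFunNear d s p) : SmoothVFieldNear (grad g s) p :=
  smoothVFieldNear_of_val g fun i => ((SmoothVFieldNear.coordField p i).dirDeriv hs).congr
    (.of_forall fun _ => (val_grad g s _).symm)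

theorem hessian_bitensorial {s : M → ℝ} (hs : SmoothFunNear d s p) :
    BiTensorialNear p fun X Y =>
      dirDeriv (fun q => dirDeriv s q (Y q)) p (X p) - dirDeriv s p (lc g X Y p) where
  left Y hY :=
    { add := fun hX hX' => by
        rw [(lc_tensorial g hY).add hX hX', dirDeriv_add_right, dirDeriv_add_right]
        abel
      smul := fun ha hX => by
        rw [(lc_tensorial g hY).smul ha hX, dirDeriv_smul_right, dirDeriv_smul_right]
        module }
  right X hX :=
    { add := fun {Y Y'} hY hY' => by
        change SmoothVFieldNear _ _ at hY hY'
        simp only [dirDeriv_add_right]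
        rw [dirDeriv_add (hY.dirDeriv hs) (hY'.dirDeriv hs), lc_add_right g hX hY hY',
          dirDeriv_add_right]
        abel
      smul := fun {a Y} ha hY => by
        change SmoothVFieldNear _ _ at hY
        simp only [dirDeriv_smul_right, smul_eq_mul]
        rw [dirDeriv_mul ha (hY.dirDeriv hs), lc_smul_right g ha hX hY, dirDeriv_add_right,
          dirDeriv_smul_right, dirDeriv_smul_right]
        simp only [smul_eq_mul]
        ring }

theorem laplacianFun_smooth {s : M → ℝ} (hs : SmoothFunNear d s p) :
    SmoothFunNear d (laplacianFun g s) p := by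
  refine smoothFunNear_metricTrace g (Φ := fun X Y p =>
      dirDeriv (fun q => dirDeriv s q (Y q)) p (X p) - dirDeriv s p (lc g X Y p))
    (hs.eventually.mono fun q hq => hessian_bitensorial g hq) fun i j => ?_
  have hi := SmoothVFieldNear.coordField p i
  have hj := SmoothVFieldNear.coordField p j
  exact (hi.dirDeriv (hj.dirDeriv hs)).sub ((hi.lc g hj).dirDeriv hs)

end Curvature

/-! ### Standard tractors and their connection. -/

section Tractors

variable {d : ℕ} {M : Type*} [TopologicalSpace M] [ChartedSpace (EuclideanSpace ℝ (Fin d)) M]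
  [IsManifold (𝓡 d) ∞ M] (g : PseudoMetric d M) {p : M}
variable {X X' Y Y' Z Z' : VField d M} {a : M → ℝ} {T T' : TractorField d M}

/-- The tractor field `T` is smooth in a neighbourhood of `p`. -/
structure SmoothTractorNear (T : TractorField d M) (p : M) : Prop where
  top : SmoothFunNear d (fun q => (T q).1) p
  mid : SmoothVFieldNear (fun q => (T q).2.1) p
  bot : SmoothFunNear d (fun q => (T q).2.2) p

namespace SmoothTractorNear

theorem eventually (h : SmoothTractorNear T p) : ∀ᶠ q in 𝓝 p, SmoothTractorNear T q := by
  filter_upwards [h.top.eventually, h.mid.eventually, h.bot.eventually] with q h1 h2 h3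
  exact ⟨h1, h2, h3⟩

theorem add (h : SmoothTractorNear T p) (h' : SmoothTractorNear T' p) :
    SmoothTractorNear (fun q => T q + T' q) p :=
  ⟨h.top.add h'.top, h.mid.add h'.mid, h.bot.add h'.bot⟩

theorem smul (h : SmoothTractorNear T p) (ha : SmoothFunNear d a p) :
    SmoothTractorNear (fun q => a q • T q) p :=
  ⟨ha.smul h.top, h.mid.smul ha, ha.smul h.bot⟩

theorem of_on {U : Set M} (hU : IsOpen U) (hp : p ∈ U) (h : SmoothTractorOn U T) :
    SmoothTractorNear T p :=
  ⟨.of_contMDiffOn hU hp h.1, .of_on hU hp h.2.1, .of_contMDiffOn hU hp h.2.2⟩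

theorem exists_open (h : SmoothTractorNear T p) :
    ∃ U, IsOpen U ∧ p ∈ U ∧ SmoothTractorOn U T := by
  obtain ⟨U, hU, hUo, hp⟩ := eventually_nhds_iff.1 h.eventually
  exact ⟨U, hUo, hp, fun q hq => (hU q hq).top.contMDiffAt.contMDiffWithinAt,
    fun q hq => (hU q hq).mid.contMDiffAt.contMDiffWithinAt,
    fun q hq => (hU q hq).bot.contMDiffAt.contMDiffWithinAt⟩

end SmoothTractorNear

theorem smoothVFieldNear_zero (p : M) : SmoothVFieldNear (fun q => (0 : Tan d q)) p :=
  (vfieldGerms p).zero_mem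

/-- The local frame of the tractor bundle induced by `coordField p`. -/
def tractorFrame (p : M) : Unit ⊕ Fin d ⊕ Unit → TractorField d M
  | .inl _, _ => (1, 0, 0)
  | .inr (.inl i), q => (0, coordField p i q, 0)
  | .inr (.inr _), _ => (0, 0, 1)

/-- Germs of smooth tractor fields. -/
def tractorGerms (p : M) :
    FramedGerms d (fun q : M => TractorFibre d q) (Unit ⊕ Fin d ⊕ Unit) p where
  IsSmooth T := SmoothTractorNear T p
  add_mem h h' := h.add h'
  smul_mem ha h := h.smul ha
  zero_mem := ⟨.const 0, smoothVFieldNear_zero p, .const 0⟩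
  frame := tractorFrame p
  frame_mem
    | .inl _ => ⟨.const 1, smoothVFieldNear_zero p, .const 0⟩
    | .inr (.inl i) => ⟨.const 0, .coordField p i, .const 0⟩
    | .inr (.inr _) => ⟨.const 0, smoothVFieldNear_zero p, .const 1⟩
  coeff
    | .inl _ => LinearMap.fst ℝ _ _
    | .inr (.inl i) => (coordBasis p).coord i ∘ₗ LinearMap.fst ℝ _ _ ∘ₗ LinearMap.snd ℝ _ _
    | .inr (.inr _) => LinearMap.snd ℝ _ _ ∘ₗ LinearMap.snd ℝ _ _
  expand T hT := by
    obtain ⟨c, hc, hcp, hcT⟩ := hT.mid.exists_coeff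
    refine ⟨fun | .inl _ => fun q => (T q).1 | .inr (.inl i) => c i | .inr (.inr _) => fun q => (T q).2.2,
      ?_, ?_, ?_⟩
    · rintro (_ | _ | _)
      exacts [hT.top, hc _, hT.bot]
    · rintro (_ | i | _)
      exacts [rfl, hcp i, rfl]
    · filter_upwards [hcT] with q hq
      simp only [Fintype.sum_sum_type, Finset.univ_unique, Finset.sum_const, Finset.card_singleton,
        one_smul, tractorFrame]
      refine Prod.ext ?_ (Prod.ext ?_ ?_)
      · simp [Prod.fst_sum]
      · simpa [Prod.fst_sum, Prod.snd_sum] using hq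
      · simp [Prod.snd_sum]

/-- The extension of a tractor at `p` with constant components. -/
def tractorExtend (v : TractorFibre d p) : TractorField d M := fun q =>
  (v.1, ∑ i, (coordBasis p).repr v.2.1 i • coordField p i q, v.2.2)

@[simp] theorem tractorExtend_self (v : TractorFibre d p) : tractorExtend v p = v := by
  simp only [tractorExtend, coordField_self]
  exact Prod.ext rfl (Prod.ext ((coordBasis p).sum_repr v.2.1) rfl)

theorem smoothTractorNear_tractorExtend (v : TractorFibre d p) :
    SmoothTractorNear (tractorExtend v) p :=
  ⟨.const _, SmoothVFieldNear.sum Finset.univ (X := fun i q =>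
    (coordBasis p).repr v.2.1 i • coordField p i q)
    fun i _ => (SmoothVFieldNear.coordField p i).smul (.const _), .const _⟩

/-- The Schouten tensor as an endomorphism of the tangent bundle. -/
def schoutenSharp (X : VField d M) : VField d M := fun p =>
  sharp g p fun j => schouten g X (coordField p j) p

theorem val_schoutenSharp (hX : SmoothVFieldNear X p) (hZ : SmoothVFieldNear Z p) :
    g.val p (schoutenSharp g X p) (Z p) = schouten g X Z p := by
  have h := (schouten_bitensorial g p).right X hX
  rw [← h.toLinear_apply hZ, ← val_sharp g (TensorialNear.toLinear (vfieldGerms p)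
    fun Z => schouten g X Z p) (Z p), schoutenSharp]
  congr 3
  funext j
  rw [← coordField_self, h.toLinear_apply (.coordField p j)]

theorem schoutenSharp_tensorial (p : M) :
    TensorialNear (vfieldGerms p) fun X => schoutenSharp g X p where
  add {X X'} hX hX' := by
    refine g.eq_of_val_eq fun z => ?_
    obtain ⟨Z, hZ, rfl⟩ := exists_smooth_extension z
    rw [map_add, LinearMap.add_apply, val_schoutenSharp g hX hZ, val_schoutenSharp g hX' hZ,
      val_schoutenSharp g (.add hX hX') hZ]
    exact ((schouten_bitensorial g p).left Z hZ).add hX hX'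
  smul {a X} ha hX := by
    refine g.eq_of_val_eq fun z => ?_
    obtain ⟨Z, hZ, rfl⟩ := exists_smooth_extension z
    rw [map_smul, LinearMap.smul_apply, val_schoutenSharp g hX hZ,
      val_schoutenSharp g (.smul hX ha) hZ]
    exact ((schouten_bitensorial g p).left Z hZ).smul ha hX

theorem schoutenSharp_smooth (hX : SmoothVFieldNear X p) :
    SmoothVFieldNear (schoutenSharp g X) p := by
  refine smoothVFieldNear_of_val g fun i => (schouten_smooth g hX (.coordField p i)).congr ?_
  filter_upwards [hX.eventually, (SmoothVFieldNear.coordField p i).eventually] with q h1 h2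
  exact (val_schoutenSharp g h1 h2).symm

theorem tractorConn_apply (X : VField d M) (T : TractorField d M) (p : M) :
    tractorConn g X T p =
      (dirDeriv (fun q => (T q).1) p (X p) - g.val p (X p) (T p).2.1,
        lc g X (fun q => (T q).2.1) p + (T p).2.2 • X p + (T p).1 • schoutenSharp g X p,
        dirDeriv (fun q => (T q).2.2) p (X p) - schouten g X (fun q => (T q).2.1) p) :=
  rfl

theorem tractorConn_tensorial (hT : SmoothTractorNear T p) :
    TensorialNear (vfieldGerms p) fun X => tractorConn g X T p where
  add {X X'} hX hX' := by
    simp only [tractorConn_apply, Prod.mk_add_mk, (lc_tensorial g hT.mid).add hX hX',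
      ((schouten_bitensorial g p).left _ hT.mid).add hX hX', dirDeriv_add_right, map_add,
      LinearMap.add_apply, (schoutenSharp_tensorial g p).add hX hX']
    refine Prod.ext ?_ (Prod.ext ?_ ?_)
    · simp only; ring
    · simp only; module
    · simp only; ring
  smul {a X} ha hX := by
    simp only [tractorConn_apply, Prod.smul_mk, (lc_tensorial g hT.mid).smul ha hX,
      ((schouten_bitensorial g p).left _ hT.mid).smul ha hX, dirDeriv_smul_right, map_smul,
      LinearMap.smul_apply, (schoutenSharp_tensorial g p).smul ha hX, smul_eq_mul]
    refine Prod.ext ?_ (Prod.ext ?_ ?_)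
    · simp only; ring
    · simp only; module
    · simp only; ring

theorem tractorConn_add (hX : SmoothVFieldNear X p) (hT : SmoothTractorNear T p)
    (hT' : SmoothTractorNear T' p) :
    tractorConn g X (fun q => T q + T' q) p = tractorConn g X T p + tractorConn g X T' p := by
  simp only [tractorConn_apply, Prod.mk_add_mk, Prod.fst_add, Prod.snd_add, map_add]
  rw [dirDeriv_add hT.top hT'.top, dirDeriv_add hT.bot hT'.bot, lc_add_right g hX hT.mid hT'.mid,
    ((schouten_bitensorial g p).right X hX).add hT.mid hT'.mid]
  refine Prod.ext ?_ (Prod.ext ?_ ?_)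
  · simp only; ring
  · simp only; module
  · simp only; ring

theorem tractorConn_smul (ha : SmoothFunNear d a p) (hX : SmoothVFieldNear X p)
    (hT : SmoothTractorNear T p) :
    tractorConn g X (fun q => a q • T q) p =
      a p • tractorConn g X T p + dirDeriv a p (X p) • T p := by
  simp only [tractorConn_apply, Prod.smul_fst, Prod.smul_snd, map_smul]
  rw [dirDeriv_smul ha hT.top, dirDeriv_smul ha hT.bot, lc_smul_right g ha hX hT.mid,
    ((schouten_bitensorial g p).right X hX).smul ha hT.mid]
  refine Prod.ext ?_ (Prod.ext ?_ ?_)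
  · simp only [Prod.fst_add, Prod.smul_fst, smul_eq_mul]; ring
  · simp only [Prod.fst_add, Prod.smul_fst, Prod.snd_add, Prod.smul_snd, smul_eq_mul]; module
  · simp only [Prod.snd_add, Prod.smul_snd, smul_eq_mul]; ring

theorem SmoothTractorNear.tractorConn (hX : SmoothVFieldNear X p) (hT : SmoothTractorNear T p) :
    SmoothTractorNear (tractorConn g X T) p where
  top := (hX.dirDeriv hT.top).sub (g.smoothNear hX hT.mid)
  mid := ((hX.lc g hT.mid).add (hX.smul hT.bot)).add ((schoutenSharp_smooth g hX).smul hT.top)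
  bot := (hX.dirDeriv hT.bot).sub (schouten_smooth g hX hT.mid)

end Tractors

/-! ### Covariant derivatives of tractor tensors. -/

section Update

variable {d : ℕ} {M : Type*} [TopologicalSpace M] [ChartedSpace (EuclideanSpace ℝ (Fin d)) M]
  {k : ℕ}

theorem update_apply_point (T : Fin k → TractorField d M) (j : Fin k) (S : TractorField d M)
    (q : M) : (fun i => Function.update T j S i q) =
      Function.update (fun i => T i q) j (S q) := by
  funext i
  by_cases h : i = j
  · subst h; simp
  · simp [h]

end Update

section CovDeriv

variable {d : ℕ} {M : Type*} [TopologicalSpace M] [ChartedSpace (EuclideanSpace ℝ (Fin d)) M]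
  [IsManifold (𝓡 d) ∞ M] (g : PseudoMetric d M) {p : M} {k : ℕ}
variable {X X' : VField d M} {f f' : TensorField d M k} {T : Fin k → TractorField d M}

/-- The tensor field `f` is smooth in a neighbourhood of `p`. -/
def SmoothTensorNear (f : TensorField d M k) (p : M) : Prop :=
  ∀ᶠ q in 𝓝 p, ∀ T : Fin k → TractorField d M, (∀ i, SmoothTractorNear (T i) q) →
    ContMDiffAt (𝓡 d) 𝓘(ℝ, ℂ) ∞ (fun r => f r (fun i => T i r)) q

namespace SmoothTensorNear

theorem eventually (h : SmoothTensorNear f p) : ∀ᶠ q in 𝓝 p, SmoothTensorNear f q :=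
  eventually_eventually_nhds.2 h

theorem eval (h : SmoothTensorNear f p) (hT : ∀ i, SmoothTractorNear (T i) p) :
    SmoothFunNear d (fun q => f q (fun i => T i q)) p := by
  filter_upwards [h, Filter.eventually_all.2 fun i => (hT i).eventually] with q h1 h2
  exact h1 T h2

theorem of_eval (h : ∀ᶠ q in 𝓝 p, ∀ T : Fin k → TractorField d M,
    (∀ i, SmoothTractorNear (T i) q) → SmoothFunNear d (fun r => f r (fun i => T i r)) q) :
    SmoothTensorNear f p :=
  h.mono fun _ hq T hT => (hq T hT).contMDiffAt

theorem of_on {U : Set M} (hU : IsOpen U) (hp : p ∈ U) (h : SmoothTensorOn U f) :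
    SmoothTensorNear f p := by
  filter_upwards [hU.mem_nhds hp] with q hq T hT
  choose V hV hqV hTV using fun i => (hT i).exists_open
  have hW : IsOpen (U ∩ ⋂ i, V i) := hU.inter (isOpen_iInter_of_finite hV)
  refine ContMDiffOn.contMDiffAt (h _ hW inter_subset_left T fun i => ?_)
    (hW.mem_nhds ⟨hq, mem_iInter.2 hqV⟩)
  have hs : U ∩ ⋂ i, V i ⊆ V i := inter_subset_right.trans (iInter_subset _ i)
  exact ⟨(hTV i).1.mono hs, (hTV i).2.1.mono hs, (hTV i).2.2.mono hs⟩

theorem on {U : Set M} (h : ∀ p ∈ U, SmoothTensorNear f p) : SmoothTensorOn U f := by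
  intro V hV hVU T hT p hp
  exact ((h p (hVU hp)).eval fun i => .of_on hV hp (hT i)).contMDiffAt.contMDiffWithinAt

theorem congr (h : SmoothTensorNear f p) (hff' : ∀ᶠ q in 𝓝 p, f q = f' q) :
    SmoothTensorNear f' p := by
  refine of_eval ?_
  filter_upwards [h.eventually, eventually_eventually_nhds.2 hff'] with q h1 h2 T hT
  exact (h1.eval hT).congr (h2.mono fun r hr => by simp only [hr])

theorem add (h : SmoothTensorNear f p) (h' : SmoothTensorNear f' p) :
    SmoothTensorNear (fun q => f q + f' q) p := by
  refine of_eval ?_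
  filter_upwards [h.eventually, h'.eventually] with q h1 h2 T hT
  exact (h1.eval hT).add (h2.eval hT)

theorem sub (h : SmoothTensorNear f p) (h' : SmoothTensorNear f' p) :
    SmoothTensorNear (fun q => f q - f' q) p := by
  refine of_eval ?_
  filter_upwards [h.eventually, h'.eventually] with q h1 h2 T hT
  exact (h1.eval hT).sub (h2.eval hT)

theorem smul {u : M → ℂ} (h : SmoothTensorNear f p) (hu : SmoothFunNear d u p) :
    SmoothTensorNear (fun q => u q • f q) p := by
  refine of_eval ?_
  filter_upwards [h.eventually, hu.eventually] with q h1 h2 T hT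
  exact h2.mul (h1.eval hT)

theorem zero (p : M) : SmoothTensorNear (fun q => (0 : TensorFibre d k q)) p :=
  of_eval (.of_forall fun _ _ _ => .const 0)

theorem sum {ι : Type*} (S : Finset ι) {f : ι → TensorField d M k}
    (h : ∀ i ∈ S, SmoothTensorNear (f i) p) : SmoothTensorNear (fun q => ∑ i ∈ S, f i q) p := by
  classical
  induction S using Finset.induction_on with
  | empty => simpa using zero p
  | insert i S hi ih =>
    simp only [Finset.sum_insert hi]
    exact (h i (by simp)).add (ih fun j hj => h j (by simp [hj]))

end SmoothTensorNear

/-- `X (f(T_1, …, T_k)) - ∑_i f(T_1, …, ∇_X T_i, …, T_k)` at `p`. -/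
def covDerivEval (X : VField d M) (f : TensorField d M k) (p : M) (T : Fin k → TractorField d M) :
    ℂ :=
  dirDeriv (fun q => f q (fun i => T i q)) p (X p)
    - ∑ i, f p (Function.update (fun j => T j p) i (tractorConn g X (T i) p))

/-- Isolates the dependence on the `j`-th argument, so that tensoriality in that slot can be read
off. -/
theorem covDerivEval_update (X : VField d M) (f : TensorField d M k) (j : Fin k)
    (S : TractorField d M) :
    covDerivEval g X f p (Function.update T j S) =
      dirDeriv (fun q => f q (Function.update (fun i => T i q) j (S q))) p (X p)
        - (f p (Function.update (fun i => T i p) j (tractorConn g X S p))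
          + ∑ i ∈ Finset.univ.erase j, f p (Function.update (Function.update (fun l => T l p) i
              (tractorConn g X (T i) p)) j (S p))) := by
  unfold covDerivEval
  simp only [update_apply_point]
  congr 1
  rw [← Finset.add_sum_erase _ _ (Finset.mem_univ j)]
  congr 1
  · simp
  · refine Finset.sum_congr rfl fun i hi => ?_
    have hij : i ≠ j := Finset.ne_of_mem_erase hi
    rw [Function.update_of_ne hij, Function.update_comm hij]

/-- The derivative of the coefficient produced by the product rule cancels the one produced by the
tractor connection in the same slot. -/
theorem covDerivEval_tensorial (hf : SmoothTensorNear f p) (hX : SmoothVFieldNear X p)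
    (j : Fin k) (hT : ∀ i, SmoothTractorNear (T i) p) :
    TensorialNear (tractorGerms p) fun S => covDerivEval g X f p (Function.update T j S) := by
  have hev : ∀ {S : TractorField d M}, SmoothTractorNear S p →
      SmoothFunNear d (fun q => f q (Function.update (fun i => T i q) j (S q))) p := fun {S} hS => by
    have := hf.eval (T := Function.update T j S) fun i => by
      by_cases h : i = j
      · subst h; simpa using hS
      · simpa [h] using hT i
    simpa only [update_apply_point] using this
  constructor
  · intro S S' hS hS'
    simp only [covDerivEval_update, MultilinearMap.map_update_add, tractorConn_add g hX hS hS']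
    rw [dirDeriv_add (hev hS) (hev hS'), Finset.sum_add_distrib]
    ring
  · intro a S ha hS
    simp only [covDerivEval_update, MultilinearMap.map_update_add, MultilinearMap.map_update_smul,
      tractorConn_smul g ha hX hS]
    rw [dirDeriv_smul ha (hev hS), ← Finset.smul_sum]
    module

theorem covDerivEval_eq (hf : SmoothTensorNear f p) (hX : SmoothVFieldNear X p)
    {T T' : Fin k → TractorField d M} (hT : ∀ i, SmoothTractorNear (T i) p)
    (hT' : ∀ i, SmoothTractorNear (T' i) p) (h : ∀ i, T i p = T' i p) :
    covDerivEval g X f p T = covDerivEval g X f p T' :=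
  eq_of_tensorialNear_update (G := tractorGerms p)
    (fun j _ hR => covDerivEval_tensorial g hf hX j hR) hT hT' h

/-- A tractor at `p` is extended with constant frame components; tensoriality makes the result
multilinear in the values at `p` and independent of the extension. -/
theorem exists_covDeriv (hf : SmoothTensorNear f p) (hX : SmoothVFieldNear X p) :
    ∃ φ : TensorFibre d k p, ∀ T : Fin k → TractorField d M, (∀ i, SmoothTractorNear (T i) p) →
      φ (fun i => T i p) = covDerivEval g X f p T := by
  have hext : ∀ m : Fin k → TractorFibre d p,
      ∀ i, SmoothTractorNear ((fun i => tractorExtend (m i)) i) p :=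
    fun m i => smoothTractorNear_tractorExtend _
  have hupd : ∀ (m : Fin k → TractorFibre d p) (i : Fin k) (S : TractorField d M),
      SmoothTractorNear S p →
      covDerivEval g X f p (fun j => tractorExtend (Function.update m i (S p) j)) =
        covDerivEval g X f p (Function.update (fun j => tractorExtend (m j)) i S) := by
    intro m i S hS
    refine covDerivEval_eq g hf hX (hext _) (fun j => ?_) fun j => ?_
    · by_cases h : j = i
      · subst h; simpa using hS
      · simpa [h] using hext m j
    · by_cases h : j = i
      · subst h; simp
      · simp [h]
  refine ⟨{ toFun := fun m => covDerivEval g X f p fun i => tractorExtend (m i)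
            map_update_add' := ?_
            map_update_smul' := ?_ }, fun T hT => ?_⟩
  · intro inst m i x y
    rw [Subsingleton.elim inst (instDecidableEqFin k)]
    have hx := smoothTractorNear_tractorExtend x
    have hy := smoothTractorNear_tractorExtend y
    have h1 := hupd m i _ (hx.add hy)
    have h2 := hupd m i _ hx
    have h3 := hupd m i _ hy
    simp only [tractorExtend_self] at h1 h2 h3
    rw [h1, h2, h3]
    exact (covDerivEval_tensorial g hf hX i (hext m)).add hx hy
  · intro inst m i c x
    rw [Subsingleton.elim inst (instDecidableEqFin k)]
    have hx := smoothTractorNear_tractorExtend x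
    have h1 := hupd m i _ (hx.smul (.const c))
    have h2 := hupd m i _ hx
    simp only [tractorExtend_self] at h1 h2
    rw [h1, h2]
    exact (covDerivEval_tensorial g hf hX i (hext m)).smul (.const c) hx
  · exact covDerivEval_eq g hf hX (hext _) hT fun i => tractorExtend_self _

/-- `covDeriv` is a choice, meaningful only once the defining condition is known to be satisfiable;
`exists_covDeriv` supplies this. All later computations with `covDeriv` go back to this formula. The
domains of the `T i` are intersected because the condition asks for a common open set. -/
theorem covDeriv_apply (hf : SmoothTensorNear f p) (hX : SmoothVFieldNear X p)
    (hT : ∀ i, SmoothTractorNear (T i) p) :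
    covDeriv g X f p (fun i => T i p) = covDerivEval g X f p T := by
  obtain ⟨φ, hφ⟩ := exists_covDeriv g hf hX
  have hspec : ∃ φ : TensorFibre d k p, ∀ V : Set M, IsOpen V → p ∈ V →
      ∀ T : Fin k → TractorField d M, (∀ i, SmoothTractorOn V (T i)) →
        φ (fun i => T i p) =
          dirDeriv (fun q => f q (fun i => T i q)) p (X p)
            - ∑ i, f p (Function.update (fun j => T j p) i (tractorConn g X (T i) p)) :=
    ⟨φ, fun V hV hp T hT => hφ T fun i => .of_on hV hp (hT i)⟩
  choose V hV hpV hTV using fun i => (hT i).exists_open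
  refine Classical.epsilon_spec hspec (⋂ i, V i) (isOpen_iInter_of_finite hV) (mem_iInter.2 hpV) T
    fun i => ?_
  have hs : ⋂ i, V i ⊆ V i := iInter_subset _ i
  exact ⟨(hTV i).1.mono hs, (hTV i).2.1.mono hs, (hTV i).2.2.mono hs⟩

theorem tensor_ext {φ ψ : TensorFibre d k p}
    (h : ∀ T : Fin k → TractorField d M, (∀ i, SmoothTractorNear (T i) p) →
      φ (fun i => T i p) = ψ (fun i => T i p)) : φ = ψ := by
  refine MultilinearMap.ext fun v => ?_
  simpa using h (fun i => tractorExtend (v i)) fun i => smoothTractorNear_tractorExtend _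

theorem covDeriv_smooth (hX : SmoothVFieldNear X p) (hf : SmoothTensorNear f p) :
    SmoothTensorNear (covDeriv g X f) p := by
  refine .of_eval ?_
  filter_upwards [hX.eventually, hf.eventually] with q hX hf T hT
  have h1 : SmoothFunNear d (fun q => covDerivEval g X f q T) q := by
    refine (hX.dirDeriv (hf.eval hT)).sub (.sum _ fun i _ => ?_)
    have := hf.eval (T := Function.update T i (tractorConn g X (T i))) fun j => by
      by_cases h : j = i
      · subst h; simpa using .tractorConn g hX (hT j)
      · simpa [h] using hT j
    simpa only [update_apply_point] using this
  refine h1.congr ?_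
  filter_upwards [hX.eventually, hf.eventually, Filter.eventually_all.2 fun i => (hT i).eventually]
    with r h1 h2 h3
  exact (covDeriv_apply g h2 h1 h3).symm

theorem covDeriv_congr (hX : SmoothVFieldNear X p) (hf : SmoothTensorNear f p)
    (hff' : ∀ᶠ q in 𝓝 p, f q = f' q) : covDeriv g X f p = covDeriv g X f' p := by
  refine tensor_ext fun T hT => ?_
  rw [covDeriv_apply g hf hX hT, covDeriv_apply g (hf.congr hff') hX hT, covDerivEval,
    covDerivEval, hff'.self_of_nhds, dirDeriv_congr (v := fun q => f' q fun i => T i q) (hff'.mono fun q hq => by simp only [hq])]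

theorem covDeriv_add (hX : SmoothVFieldNear X p) (hf : SmoothTensorNear f p)
    (hf' : SmoothTensorNear f' p) :
    covDeriv g X (fun q => f q + f' q) p = covDeriv g X f p + covDeriv g X f' p := by
  refine tensor_ext fun T hT => ?_
  rw [add_apply, covDeriv_apply g hf hX hT, covDeriv_apply g hf' hX hT,
    covDeriv_apply g (hf.add hf') hX hT]
  simp only [covDerivEval, add_apply]
  rw [dirDeriv_add (hf.eval hT) (hf'.eval hT), Finset.sum_add_distrib]
  ring

theorem covDeriv_smul {u : M → ℂ} (hu : SmoothFunNear d u p) (hX : SmoothVFieldNear X p)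
    (hf : SmoothTensorNear f p) :
    covDeriv g X (fun q => u q • f q) p =
      u p • covDeriv g X f p + dirDeriv u p (X p) • f p := by
  refine tensor_ext fun T hT => ?_
  rw [add_apply, smul_apply, smul_apply,
    covDeriv_apply g hf hX hT, covDeriv_apply g (hf.smul hu) hX hT]
  simp only [covDerivEval, smul_apply, smul_eq_mul]
  rw [dirDeriv_mul hu (hf.eval hT), ← Finset.mul_sum]
  ring

theorem covDeriv_tensorial (hf : SmoothTensorNear f p) :
    TensorialNear (vfieldGerms p) fun X => covDeriv g X f p where
  add {X X'} hX hX' := by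
    refine tensor_ext fun T hT => ?_
    rw [add_apply, covDeriv_apply g hf hX hT, covDeriv_apply g hf hX' hT,
      covDeriv_apply g hf (.add hX hX') hT]
    simp only [covDerivEval, (tractorConn_tensorial g (hT _)).add hX hX', dirDeriv_add_right,
      MultilinearMap.map_update_add, Finset.sum_add_distrib]
    ring
  smul {a X} ha hX := by
    refine tensor_ext fun T hT => ?_
    rw [smul_apply, covDeriv_apply g hf hX hT, covDeriv_apply g hf (.smul hX ha) hT]
    simp only [covDerivEval, (tractorConn_tensorial g (hT _)).smul ha hX, dirDeriv_smul_right,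
      MultilinearMap.map_update_smul, ← Finset.smul_sum]
    module

end CovDeriv

/-! ### The Laplacian on tractor tensors and its product rule. -/

section Laplacian

variable {d : ℕ} {M : Type*} [TopologicalSpace M] [ChartedSpace (EuclideanSpace ℝ (Fin d)) M]
  [IsManifold (𝓡 d) ∞ M] (g : PseudoMetric d M) {p : M} {k : ℕ}
variable {X Y : VField d M} {f f' : TensorField d M k} {s : M → ℝ} {w : ℂ}

theorem metricTrace_add {A : Type*} [AddCommGroup A] [Module ℝ A] (β γ : Fin d → Fin d → A) :
    metricTrace g p (fun i j => β i j + γ i j) = metricTrace g p β + metricTrace g p γ := by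
  simp [metricTrace, smul_add, Finset.sum_add_distrib]

theorem metricTrace_map {A A' : Type*} [AddCommGroup A] [Module ℝ A] [AddCommGroup A']
    [Module ℝ A'] (L : A →ₗ[ℝ] A') (β : Fin d → Fin d → A) :
    metricTrace g p (fun i j => L (β i j)) = L (metricTrace g p β) := by
  simp [metricTrace]

theorem metricTrace_swap {A : Type*} [AddCommGroup A] [Module ℝ A] (β : Fin d → Fin d → A) :
    metricTrace g p (fun i j => β j i) = metricTrace g p β := by
  unfold metricTrace
  rw [Finset.sum_comm]
  refine Finset.sum_congr rfl fun i _ => Finset.sum_congr rfl fun j _ => ?_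
  rw [show invGram g p j i = invGram g p i j from gramInv_symm g (coordBasis p) j i]

/-- Contracting `ds` with a tensorial operation inserts the gradient; this produces the cross terms
of the product rule. -/
theorem metricTrace_dirDeriv {A : Type*} [AddCommGroup A] [Module ℝ A] {Φ : VField d M → A}
    (hΦ : TensorialNear (vfieldGerms p) Φ) (hs : SmoothFunNear d s p) :
    metricTrace g p (fun i j => dirDeriv s p (coordField p j p) • Φ (coordField p i)) =
      Φ (grad g s) := by
  rw [← hΦ.toLinear_apply (grad_smooth g hs), grad, sharp, map_sum]
  refine Finset.sum_congr rfl fun i _ => ?_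
  rw [map_sum]
  refine Finset.sum_congr rfl fun j _ => ?_
  rw [map_smul, ← coordField_self, ← coordField_self, hΦ.toLinear_apply (.coordField p i), smul_smul]

theorem covDeriv_real_smul {a : M → ℝ} (ha : SmoothFunNear d a p) (hX : SmoothVFieldNear X p)
    (hf : SmoothTensorNear f p) :
    covDeriv g X (fun q => a q • f q) p =
      a p • covDeriv g X f p + dirDeriv a p (X p) • f p := by
  have h := covDeriv_smul g ha.ofReal hX hf
  rw [dirDeriv_ofReal ha] at h
  simpa only [Complex.coe_smul] using h

theorem covDeriv_value_congr (hf : SmoothTensorNear f p) (hX : SmoothVFieldNear X p)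
    (hY : SmoothVFieldNear Y p) (h : X p = Y p) : covDeriv g X f p = covDeriv g Y f p :=
  (covDeriv_tensorial g hf).eq_of_eq hX hY h

theorem hessian_tensor_bitensorial (hf : SmoothTensorNear f p) :
    BiTensorialNear p fun X Y =>
      covDeriv g X (covDeriv g Y f) p - covDeriv g (lc g X Y) f p where
  left Y hY :=
    { add := fun {X X'} hX hX' => by
        change SmoothVFieldNear _ _ at hX hX'
        rw [covDeriv_value_congr g hf (.lc g (hX.add hX') hY) ((hX.lc g hY).add (hX'.lc g hY))
            ((lc_tensorial g hY).add hX hX'),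
          (covDeriv_tensorial g hf).add (hX.lc g hY) (hX'.lc g hY),
          (covDeriv_tensorial g (covDeriv_smooth g hY hf)).add hX hX']
        abel
      smul := fun {a X} ha hX => by
        change SmoothVFieldNear _ _ at hX
        rw [covDeriv_value_congr g hf (.lc g (hX.smul ha) hY) ((hX.lc g hY).smul ha)
            ((lc_tensorial g hY).smul ha hX),
          (covDeriv_tensorial g hf).smul ha (hX.lc g hY),
          (covDeriv_tensorial g (covDeriv_smooth g hY hf)).smul ha hX, smul_sub] }
  right X hX :=
    { add := fun {Y Y'} hY hY' => by
        change SmoothVFieldNear _ _ at hY hY'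
        have e : ∀ᶠ q in 𝓝 p, covDeriv g (fun q => Y q + Y' q) f q =
            covDeriv g Y f q + covDeriv g Y' f q := by
          filter_upwards [hY.eventually, hY'.eventually, hf.eventually] with q h1 h2 h3
          exact (covDeriv_tensorial g h3).add h1 h2
        rw [covDeriv_congr g hX (covDeriv_smooth g (hY.add hY') hf) e,
          covDeriv_add g hX (covDeriv_smooth g hY hf) (covDeriv_smooth g hY' hf),
          covDeriv_value_congr g hf (hX.lc g (hY.add hY')) ((hX.lc g hY).add (hX.lc g hY'))
            (lc_add_right g hX hY hY'),
          (covDeriv_tensorial g hf).add (hX.lc g hY) (hX.lc g hY')]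
        abel
      smul := fun {a Y} ha hY => by
        change SmoothVFieldNear _ _ at hY
        have e : ∀ᶠ q in 𝓝 p, covDeriv g (fun q => a q • Y q) f q = a q • covDeriv g Y f q := by
          filter_upwards [hY.eventually, ha.eventually, hf.eventually] with q h1 h2 h3
          exact (covDeriv_tensorial g h3).smul h2 h1
        rw [covDeriv_congr g hX (covDeriv_smooth g (hY.smul ha) hf) e,
          covDeriv_real_smul g ha hX (covDeriv_smooth g hY hf),
          covDeriv_value_congr g hf (hX.lc g (hY.smul ha))
            (((hX.lc g hY).smul ha).add (hY.smul (hX.dirDeriv ha))) (lc_smul_right g ha hX hY),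
          (covDeriv_tensorial g hf).add ((hX.lc g hY).smul ha) (hY.smul (hX.dirDeriv ha)),
          (covDeriv_tensorial g hf).smul ha (hX.lc g hY),
          (covDeriv_tensorial g hf).smul (hX.dirDeriv ha) hY]
        module }

/-- Evaluation of tensors. -/
def tensorEval {q : M} (v : Fin k → TractorFibre d q) : TensorFibre d k q →ₗ[ℝ] ℂ where
  toFun φ := φ v
  map_add' _ _ := rfl
  map_smul' _ _ := rfl

theorem BiTensorialNear.map {A A' : Type*} [AddCommGroup A] [Module ℝ A] [AddCommGroup A']
    [Module ℝ A'] {Φ : VField d M → VField d M → A} (h : BiTensorialNear p Φ) (L : A →ₗ[ℝ] A') :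
    BiTensorialNear p fun X Y => L (Φ X Y) where
  left Y hY :=
    { add := fun hX hX' => by rw [(h.left Y hY).add hX hX', map_add]
      smul := fun ha hX => by rw [(h.left Y hY).smul ha hX, map_smul] }
  right X hX :=
    { add := fun hY hY' => by rw [(h.right X hX).add hY hY', map_add]
      smul := fun ha hY => by rw [(h.right X hX).smul ha hY, map_smul] }

theorem laplacian_smooth (hf : SmoothTensorNear f p) : SmoothTensorNear (laplacian g f) p := by
  refine .of_eval ?_
  filter_upwards [hf.eventually] with q hf T hT
  have h : SmoothFunNear d (fun r => metricTrace g r fun i j =>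
      tensorEval (fun l => T l r) (covDeriv g (coordField r i) (covDeriv g (coordField r j) f) r
        - covDeriv g (lc g (coordField r i) (coordField r j)) f r)) q := by
    refine smoothFunNear_metricTrace g (Φ := fun X Y r => tensorEval (fun l => T l r)
      (covDeriv g X (covDeriv g Y f) r - covDeriv g (lc g X Y) f r)) ?_ fun i j => ?_
    · filter_upwards [hf.eventually] with r hr
      exact (hessian_tensor_bitensorial g hr).map (tensorEval fun l => T l r)
    · have hi := SmoothVFieldNear.coordField q i
      have hj := SmoothVFieldNear.coordField q j
      exact ((covDeriv_smooth g hi (covDeriv_smooth g hj hf)).sub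
        (covDeriv_smooth g (hi.lc g hj) hf)).eval hT
  refine h.congr (.of_forall fun r => ?_)
  exact metricTrace_map g (tensorEval fun l => T l r) _

theorem laplacian_congr (hf : SmoothTensorNear f p) (hff' : ∀ᶠ q in 𝓝 p, f q = f' q) :
    laplacian g f p = laplacian g f' p := by
  unfold laplacian
  congr 1
  funext i j
  have hi := SmoothVFieldNear.coordField p i
  have hj := SmoothVFieldNear.coordField p j
  rw [covDeriv_congr g (hi.lc g hj) hf hff', covDeriv_congr g hi (covDeriv_smooth g hj hf)]
  filter_upwards [hj.eventually, hf.eventually, eventually_eventually_nhds.2 hff'] with q h1 h2 h3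
  exact covDeriv_congr g h1 h2 h3

theorem laplacian_add (hf : SmoothTensorNear f p) (hf' : SmoothTensorNear f' p) :
    laplacian g (fun q => f q + f' q) p = laplacian g f p + laplacian g f' p := by
  unfold laplacian
  rw [← metricTrace_add]
  congr 1
  funext i j
  have hi := SmoothVFieldNear.coordField p i
  have hj := SmoothVFieldNear.coordField p j
  have e : ∀ᶠ q in 𝓝 p, covDeriv g (coordField p j) (fun q => f q + f' q) q =
      covDeriv g (coordField p j) f q + covDeriv g (coordField p j) f' q := by
    filter_upwards [hj.eventually, hf.eventually, hf'.eventually] with q h1 h2 h3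
    exact covDeriv_add g h1 h2 h3
  rw [covDeriv_add g (hi.lc g hj) hf hf', covDeriv_congr g hi (covDeriv_smooth g hj (hf.add hf')) e,
    covDeriv_add g hi (covDeriv_smooth g hj hf) (covDeriv_smooth g hj hf')]
  abel

/-- Two applications of the product rule. The functions `u'` and `u''` enter only through `du = u'
ds` and `du' = u'' ds`, which suits powers of `s`. -/
theorem hessian_tensor_smul {u u' u'' : M → ℂ} (hs : SmoothFunNear d s p)
    (hf : SmoothTensorNear f p) (hu : SmoothFunNear d u p) (hu' : SmoothFunNear d u' p)
    (h1 : ∀ᶠ q in 𝓝 p, ∀ v : Tan d q, dirDeriv u q v = u' q * (dirDeriv s q v : ℝ))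
    (h2 : ∀ v : Tan d p, dirDeriv u' p v = u'' p * (dirDeriv s p v : ℝ))
    (hX : SmoothVFieldNear X p) (hY : SmoothVFieldNear Y p) :
    covDeriv g X (covDeriv g Y fun q => u q • f q) p
        - covDeriv g (lc g X Y) (fun q => u q • f q) p =
      u p • (covDeriv g X (covDeriv g Y f) p - covDeriv g (lc g X Y) f p)
        + (u' p • (dirDeriv s p (X p) • covDeriv g Y f p)
          + (u' p • (dirDeriv s p (Y p) • covDeriv g X f p)
            + (u'' p • (dirDeriv s p (Y p) • dirDeriv s p (X p) • f p)
            + u' p • ((dirDeriv (fun q => dirDeriv s q (Y q)) p (X p)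
              - dirDeriv s p (lc g X Y p)) • f p)))) := by
  have hjs : SmoothFunNear d (fun q => u' q * (dirDeriv s q (Y q) : ℝ)) p :=
    hu'.mul (hY.dirDeriv hs).ofReal
  have e : ∀ᶠ q in 𝓝 p, covDeriv g Y (fun q => u q • f q) q =
      u q • covDeriv g Y f q + (u' q * (dirDeriv s q (Y q) : ℝ)) • f q := by
    filter_upwards [hY.eventually, hf.eventually, hu.eventually, h1] with q h3 h4 h5 h6
    rw [covDeriv_smul g h5 h3 h4, h6]
  rw [covDeriv_congr g hX (covDeriv_smooth g hY (hf.smul hu)) e,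
    covDeriv_add g hX ((covDeriv_smooth g hY hf).smul hu) (hf.smul hjs),
    covDeriv_smul g hu hX (covDeriv_smooth g hY hf), covDeriv_smul g hjs hX hf,
    covDeriv_smul g hu (hX.lc g hY) hf, dirDeriv_mul hu' (hY.dirDeriv hs).ofReal,
    dirDeriv_ofReal (hY.dirDeriv hs), h1.self_of_nhds, h1.self_of_nhds, h2]
  simp only [← Complex.coe_smul, smul_smul]
  push_cast
  module

theorem metricTrace_complex_smul (c : ℂ) (β : Fin d → Fin d → TensorFibre d k p) :
    metricTrace g p (fun i j => c • β i j) = c • metricTrace g p β := by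
  simp only [metricTrace, Finset.smul_sum, smul_comm c]

/-- The Laplacian of `u f` for a function `u` of `s` with derivatives `u'` and `u''`. -/
theorem laplacian_smul {u u' u'' : M → ℂ} (hs : SmoothFunNear d s p) (hf : SmoothTensorNear f p)
    (hu : SmoothFunNear d u p) (hu' : SmoothFunNear d u' p)
    (h1 : ∀ᶠ q in 𝓝 p, ∀ v : Tan d q, dirDeriv u q v = u' q * (dirDeriv s q v : ℝ))
    (h2 : ∀ v : Tan d p, dirDeriv u' p v = u'' p * (dirDeriv s p v : ℝ)) :
    laplacian g (fun q => u q • f q) p =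
      u p • laplacian g f p + (2 * u' p) • covDeriv g (grad g s) f p
        + (u'' p * (dirDeriv s p (grad g s p) : ℝ) + u' p * (laplacianFun g s p : ℝ)) • f p := by
  have hD : metricTrace g p (fun i j => dirDeriv s p (coordField p j p) •
      covDeriv g (coordField p i) f p) = covDeriv g (grad g s) f p :=
    metricTrace_dirDeriv g (Φ := fun X => covDeriv g X f p) (covDeriv_tensorial g hf) hs
  have hD' : metricTrace g p (fun i j => dirDeriv s p (coordField p i p) •
      covDeriv g (coordField p j) f p) = covDeriv g (grad g s) f p := by
    rw [← hD]
    exact metricTrace_swap g fun i j => dirDeriv s p (coordField p j p) •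
      covDeriv g (coordField p i) f p
  have hds : TensorialNear (vfieldGerms p) fun X : VField d M => dirDeriv s p (X p) • f p :=
    ⟨fun _ _ => by rw [dirDeriv_add_right, add_smul],
      fun _ _ => by rw [dirDeriv_smul_right, smul_assoc]⟩
  have hN : metricTrace g p (fun i j => dirDeriv s p (coordField p j p) •
      dirDeriv s p (coordField p i p) • f p) = dirDeriv s p (grad g s p) • f p :=
    metricTrace_dirDeriv g (Φ := fun X => dirDeriv s p (X p) • f p) hds hs
  have hlap : metricTrace g p (fun i j =>
      (dirDeriv (fun q => dirDeriv s q (coordField p j q)) p (coordField p i p)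
        - dirDeriv s p (lc g (coordField p i) (coordField p j) p)) • f p) =
      laplacianFun g s p • f p :=
    metricTrace_map g ((LinearMap.id : ℝ →ₗ[ℝ] ℝ).smulRight (f p)) _
  have key := congrArg (metricTrace g p) (funext fun i => funext fun j =>
    hessian_tensor_smul g hs hf hu hu' h1 h2 (.coordField p i) (.coordField p j))
  refine Eq.trans key ?_
  simp only [metricTrace_add, metricTrace_complex_smul]
  rw [hD, hD', hN, hlap]
  simp only [← Complex.coe_smul]
  unfold laplacian
  module

end Laplacian

/-! ### The degenerate Laplacian and its commutator with functions of `s`. -/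

section DegenerateLaplacian

variable {d : ℕ} {M : Type*} [TopologicalSpace M] [ChartedSpace (EuclideanSpace ℝ (Fin d)) M]
  [IsManifold (𝓡 d) ∞ M] (g : PseudoMetric d M) {p : M} {k : ℕ}
variable {f f' : TensorField d M k} {s : M → ℝ} {w : ℂ}

/-- The bottom slot of the scale tractor. -/
def scaleRho (s : M → ℝ) (p : M) : ℝ :=
  -(laplacianFun g s p + schoutenJ g p * s p) / d

theorem iDotD_apply (s : M → ℝ) (w : ℂ) (f : TensorField d M k) (p : M) :
    iDotD g s w f p = (s p : ℂ) • -(laplacian g f p + ((schoutenJ g p : ℂ) * w) • f p)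
      + ((d : ℂ) + 2 * w - 2) • covDeriv g (grad g s) f p
      + (scaleRho g s p : ℂ) • ((((d : ℂ) + 2 * w - 2) * w) • f p) :=
  rfl

theorem scaleTractorSq_apply (s : M → ℝ) (p : M) :
    scaleTractorSq g s p = dirDeriv s p (grad g s p) + 2 * (s p * scaleRho g s p) := by
  rw [← val_grad g]
  simp only [scaleTractorSq, tractorMetric, scaleTractor, scaleRho]
  ring

theorem scaleRho_smooth (hs : SmoothFunNear d s p) : SmoothFunNear d (scaleRho g s) p :=
  (((laplacianFun_smooth g hs).add ((schoutenJ_smooth g p).mul hs)).neg.mul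
    (.const (d : ℝ)⁻¹)).congr (.of_forall fun _ => rfl)

theorem scaleTractorSq_smooth (hs : SmoothFunNear d s p) :
    SmoothFunNear d (scaleTractorSq g s) p :=
  (((grad_smooth g hs).dirDeriv hs).add
    ((SmoothFunNear.const 2).mul (hs.mul (scaleRho_smooth g hs)))).congr
    (.of_forall fun _ => (scaleTractorSq_apply g s _).symm)

theorem iDotD_smooth (hs : SmoothFunNear d s p) (hf : SmoothTensorNear f p) :
    SmoothTensorNear (iDotD g s w f) p := by
  have h1 := ((laplacian_smooth g hf).add
    (hf.smul ((schoutenJ_smooth g p).ofReal.mul (.const w)))).smul hs.neg.ofReal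
  have h2 := (covDeriv_smooth g (grad_smooth g hs) hf).smul (.const ((d : ℂ) + 2 * w - 2))
  have h3 := (hf.smul (.const (((d : ℂ) + 2 * w - 2) * w))).smul (scaleRho_smooth g hs).ofReal
  refine ((h1.add h2).add h3).congr (.of_forall fun q => ?_)
  rw [iDotD_apply]
  push_cast
  rw [smul_neg, neg_smul]

theorem iDotD_congr (hs : SmoothFunNear d s p) (hf : SmoothTensorNear f p)
    (hff' : ∀ᶠ q in 𝓝 p, f q = f' q) : iDotD g s w f p = iDotD g s w f' p := by
  rw [iDotD_apply, iDotD_apply, laplacian_congr g hf hff',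
    covDeriv_congr g (grad_smooth g hs) hf hff', hff'.self_of_nhds]

theorem iDotD_add (hs : SmoothFunNear d s p) (hf : SmoothTensorNear f p)
    (hf' : SmoothTensorNear f' p) :
    iDotD g s w (fun q => f q + f' q) p = iDotD g s w f p + iDotD g s w f' p := by
  rw [iDotD_apply, iDotD_apply, iDotD_apply, laplacian_add g hf hf',
    covDeriv_add g (grad_smooth g hs) hf hf']
  module

/-- The commutator of the degenerate Laplacian with a function `u` of `s`, in the case that the
derivatives `u'` and `u''` of `u` satisfy the relations for `u = s ^ α`. -/
theorem iDotD_smul {u u' u'' : M → ℂ} {α : ℂ} (hd : d ≠ 0)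
    (hs : SmoothFunNear d s p) (hf : SmoothTensorNear f p)
    (hu : SmoothFunNear d u p) (hu' : SmoothFunNear d u' p)
    (h1 : ∀ᶠ q in 𝓝 p, ∀ v : Tan d q, dirDeriv u q v = u' q * (dirDeriv s q v : ℝ))
    (h2 : ∀ v : Tan d p, dirDeriv u' p v = u'' p * (dirDeriv s p v : ℝ))
    (h3 : s p * u' p = α * u p) (h4 : s p * u'' p = (α - 1) * u' p) :
    iDotD g s (w + α) (fun q => u q • f q) p =
      u p • iDotD g s w f p
        + ((d + 2 * w + α - 1) * u' p * (scaleTractorSq g s p : ℝ)) • f p := by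
  rw [iDotD_apply, iDotD_apply, laplacian_smul g hs hf hu hu' h1 h2,
    covDeriv_smul g hu (grad_smooth g hs) hf, h1.self_of_nhds, scaleTractorSq_apply]
  -- The Laplacian of `s` is eliminated in favour of the bottom slot of the scale tractor, so that
  -- the result can be expressed by `I²`.
  have hΔ : (laplacianFun g s p : ℂ) = -(d * scaleRho g s p) - schoutenJ g p * s p := by
    have : (d : ℝ) ≠ 0 := by exact_mod_cast hd
    rw [scaleRho]
    push_cast
    field_simp
    ring
  rw [hΔ]
  push_cast
  set N : ℂ := ((dirDeriv s p (grad g s p) : ℝ) : ℂ)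
  set S : ℂ := (s p : ℂ)
  set R : ℂ := (scaleRho g s p : ℂ)
  set J : ℂ := (schoutenJ g p : ℂ)
  set L := laplacian g f p
  set D := covDeriv g (grad g s) f p
  -- The coefficients of `Δf`, of the gradient derivative of `f` and of `f` itself are compared;
  -- `h3` and `h4` absorb every factor `s` in front of a derivative of `u`.
  match_scalars
  · ring
  · linear_combination (-2 : ℂ) * h3
  · linear_combination -N * h4 + (J * S + R * (d - 2 * (d + 2 * w + α - 1))) * h3

end DegenerateLaplacian

/-! ### Sections of a tractor bundle and their stability under the operators. -/

section Sections

variable {d : ℕ} {M : Type*} [TopologicalSpace M] [ChartedSpace (EuclideanSpace ℝ (Fin d)) M]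
  [IsManifold (𝓡 d) ∞ M] {g : PseudoMetric d M} {p : M} {k : ℕ} {B : TractorBundle g k}
variable {X Y : VField d M} {f f' : TensorField d M k} {s : M → ℝ} {w : ℂ}

theorem SmoothTensorNear.exists_open (h : SmoothTensorNear f p) :
    ∃ U, IsOpen U ∧ p ∈ U ∧ SmoothTensorOn U f := by
  obtain ⟨U, hU, hUo, hp⟩ := eventually_nhds_iff.1 h.eventually
  exact ⟨U, hUo, hp, SmoothTensorNear.on hU⟩

/-- `f` is a smooth section of `B` in a neighbourhood of `p`. -/
structure TractorBundle.SectionNear (B : TractorBundle g k) (f : TensorField d M k) (p : M) :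
    Prop where
  smooth : SmoothTensorNear f p
  fixed : ∀ᶠ q in 𝓝 p, B.proj q (f q) = f q

namespace TractorBundle

theorem isSection_iff : B.IsSection f ↔ ∀ p, B.SectionNear f p := by
  constructor
  · intro h p
    exact ⟨.of_on isOpen_univ (mem_univ p) h.1, .of_forall fun q => h.2 q (mem_univ q)⟩
  · intro h
    exact ⟨SmoothTensorNear.on fun p _ => (h p).smooth, fun p _ => (h p).fixed.self_of_nhds⟩

theorem IsSection.near (h : B.IsSection f) (p : M) : B.SectionNear f p :=
  isSection_iff.1 h p

theorem IsSectionOn.near {U : Set M} (h : B.IsSectionOn U f) (hU : IsOpen U) (hp : p ∈ U) :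
    B.SectionNear f p :=
  ⟨.of_on hU hp h.1, by filter_upwards [hU.mem_nhds hp] with q hq using h.2 q hq⟩

namespace SectionNear

theorem eventually (h : B.SectionNear f p) : ∀ᶠ q in 𝓝 p, B.SectionNear f q := by
  filter_upwards [h.smooth.eventually, eventually_eventually_nhds.2 h.fixed] with q h1 h2
  exact ⟨h1, h2⟩

theorem congr (h : B.SectionNear f p) (hff' : ∀ᶠ q in 𝓝 p, f q = f' q) : B.SectionNear f' p :=
  ⟨h.smooth.congr hff', by
    filter_upwards [h.fixed, hff'] with q h1 h2
    rwa [← h2]⟩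

theorem zero (p : M) : B.SectionNear (fun _ => 0) p :=
  ⟨.zero p, .of_forall fun _ => map_zero _⟩

theorem add (h : B.SectionNear f p) (h' : B.SectionNear f' p) :
    B.SectionNear (fun q => f q + f' q) p :=
  ⟨h.smooth.add h'.smooth, by
    filter_upwards [h.fixed, h'.fixed] with q h1 h2
    rw [map_add, h1, h2]⟩

theorem smul {u : M → ℂ} (h : B.SectionNear f p) (hu : SmoothFunNear d u p) :
    B.SectionNear (fun q => u q • f q) p :=
  ⟨h.smooth.smul hu, by
    filter_upwards [h.fixed] with q h1
    rw [map_smul, h1]⟩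

/-- The projection defining the bundle is parallel. Parallelism is assumed for data smooth on a
given open set, hence the passage to a common domain. -/
theorem covDeriv (h : B.SectionNear f p) (hX : SmoothVFieldNear X p) :
    B.SectionNear (covDeriv g X f) p where
  smooth := covDeriv_smooth g hX h.smooth
  fixed := by
    filter_upwards [h.eventually, hX.eventually] with q h hX
    obtain ⟨U, hU, hqU, hfU⟩ := h.smooth.exists_open
    obtain ⟨V, hV, hqV, hXV⟩ := hX.exists_open
    have hf' : SmoothTensorOn (U ∩ V) f := fun W hW hWU => hfU W hW (hWU.trans inter_subset_left)
    rw [← B.parallel (U ∩ V) (hU.inter hV) f hf' X (hXV.mono inter_subset_right) q ⟨hqU, hqV⟩]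
    refine (covDeriv_congr g hX h.smooth ?_).symm
    filter_upwards [h.fixed] with r hr using hr.symm

theorem laplacian (h : B.SectionNear f p) : B.SectionNear (laplacian g f) p where
  smooth := laplacian_smooth g h.smooth
  fixed := by
    filter_upwards [h.eventually] with q h
    have hmap := metricTrace_map g (p := q) ((B.proj q).restrictScalars ℝ) fun i j : Fin d =>
      BoundaryCalculus.covDeriv g (coordField q i) (BoundaryCalculus.covDeriv g (coordField q j) f) q
        - BoundaryCalculus.covDeriv g (lc g (coordField q i) (coordField q j)) f q
    refine hmap.symm.trans ?_
    unfold BoundaryCalculus.laplacian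
    congr 1
    funext i j
    have hi := SmoothVFieldNear.coordField q i
    have hj := SmoothVFieldNear.coordField q j
    rw [LinearMap.coe_restrictScalars, map_sub, ((h.covDeriv hj).covDeriv hi).fixed.self_of_nhds,
      (h.covDeriv (hi.lc g hj)).fixed.self_of_nhds]

theorem iDotD (h : B.SectionNear f p) (hs : SmoothFunNear d s p) :
    B.SectionNear (iDotD g s w f) p where
  smooth := iDotD_smooth g hs h.smooth
  fixed := by
    filter_upwards [h.eventually, hs.eventually] with q h hs
    rw [iDotD_apply]
    simp only [map_add, map_smul, map_neg]
    rw [h.laplacian.fixed.self_of_nhds, (h.covDeriv (grad_smooth g hs)).fixed.self_of_nhds,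
      h.fixed.self_of_nhds]

end SectionNear

variable (B) in
theorem isSection_zero : B.IsSection (fun _ => 0) :=
  isSection_iff.2 fun p => .zero p

namespace IsSection

theorem add (h : B.IsSection f) (h' : B.IsSection f') : B.IsSection (fun q => f q + f' q) :=
  isSection_iff.2 fun p => (h.near p).add (h'.near p)

theorem smul {u : M → ℂ} (h : B.IsSection f) (hu : ∀ p, SmoothFunNear d u p) :
    B.IsSection (fun q => u q • f q) :=
  isSection_iff.2 fun p => (h.near p).smul (hu p)

theorem const_smul (c : ℂ) (h : B.IsSection f) : B.IsSection (fun q => c • f q) :=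
  h.smul fun _ => .const c

theorem sub (h : B.IsSection f) (h' : B.IsSection f') : B.IsSection (fun q => f q - f' q) := by
  simpa only [neg_one_smul, ← sub_eq_add_neg] using h.add (h'.const_smul (-1))

theorem sum {ι : Type*} (S : Finset ι) {f : ι → TensorField d M k} (h : ∀ i ∈ S, B.IsSection (f i)) :
    B.IsSection (fun q => ∑ i ∈ S, f i q) := by
  classical
  induction S using Finset.induction_on with
  | empty => simpa using B.isSection_zero
  | insert i S hi ih =>
    simp only [Finset.sum_insert hi]
    exact (h i (by simp)).add (ih fun j hj => h j (by simp [hj]))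

theorem iDotD (h : B.IsSection f) (hs : ∀ p, SmoothFunNear d s p) :
    B.IsSection (iDotD g s w f) :=
  isSection_iff.2 fun p => (h.near p).iDotD (hs p)

theorem yOp (h : B.IsSection f) (hs : ∀ p, SmoothFunNear d s p)
    (hI : ∀ p, scaleTractorSq g s p ≠ 0) : B.IsSection (yOp g s w f) := by
  refine (h.iDotD (w := w) hs).smul fun p => ?_
  have := ((scaleTractorSq_smooth g (hs p)).inv (hI p)).neg.ofReal
  exact this.congr (.of_forall fun q => by push_cast; simp)

theorem yPow (h : B.IsSection f) (hs : ∀ p, SmoothFunNear d s p)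
    (hI : ∀ p, scaleTractorSq g s p ≠ 0) (m : ℕ) : B.IsSection (yPow g s w m f) := by
  induction m with
  | zero => exact h
  | succ m ih => exact ih.yOp hs hI

theorem normalOrdered (h : B.IsSection f) (hs : ∀ p, SmoothFunNear d s p)
    (hI : ∀ p, scaleTractorSq g s p ≠ 0) (K : PowerSeries ℂ) (m : ℕ) :
    B.IsSection (normalOrdered g s w K f m) :=
  (h.yPow hs hI m).const_smul _

end IsSection

end TractorBundle

end Sections

/-! ### Complex powers of `s` where `s > 0`. -/

section Powers

variable {d : ℕ} {M : Type*} [TopologicalSpace M] [ChartedSpace (EuclideanSpace ℝ (Fin d)) M]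
  {p : M} {s : M → ℝ}

theorem smoothFunNear_pow (hs : SmoothFunNear d s p) (n : ℕ) :
    SmoothFunNear d (fun q => (s q : ℂ) ^ n) p := by
  induction n with
  | zero => simpa using .const 1
  | succ n ih =>
    simp only [pow_succ]
    exact ih.mul hs.ofReal

theorem hasDerivAt_ofReal_cpow {x : ℝ} (hx : 0 < x) (β : ℂ) :
    HasDerivAt (fun t : ℝ => (t : ℂ) ^ β) (β * (x : ℂ) ^ (β - 1)) x := by
  have h1 : HasDerivAt (fun z : ℂ => z ^ β) (β * (x : ℂ) ^ (β - 1)) (x : ℂ) := by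
    simpa using (hasDerivAt_id (x : ℂ)).cpow_const (c := β) (Or.inl hx)
  exact h1.comp_ofReal

theorem eventually_pos (hs : SmoothFunNear d s p) (hp : 0 < s p) : ∀ᶠ q in 𝓝 p, 0 < s q :=
  hs.contMDiffAt.continuousAt.eventually (lt_mem_nhds hp)

theorem smoothFunNear_cpow (hs : SmoothFunNear d s p) (hp : 0 < s p) (β : ℂ) :
    SmoothFunNear d (fun q => (s q : ℂ) ^ β) p := by
  filter_upwards [hs, eventually_pos hs hp] with q h1 h2
  have h3 : ContDiffAt ℝ ∞ (fun t : ℝ => (t : ℂ) ^ β) (s q) := by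
    have h4 : ContDiffAt ℝ ∞ (fun z : ℂ => Complex.exp (Complex.log z * β)) (s q : ℂ) :=
      (((Complex.contDiffAt_log (Or.inl h2)).restrict_scalars ℝ).mul contDiffAt_const).cexp
    have h5 := h4.comp (s q) (Complex.ofRealCLM.contDiff.contDiffAt (x := s q))
    refine h5.congr_of_eventuallyEq ?_
    filter_upwards [lt_mem_nhds h2] with t ht
    have : (t : ℂ) ≠ 0 := by exact_mod_cast ht.ne'
    simp [Complex.cpow_def_of_ne_zero this]
  exact h3.contMDiffAt.comp q h1

theorem dirDeriv_comp {F : Type*} [NormedAddCommGroup F] [NormedSpace ℝ F] {ψ : ℝ → F} {ψ' : F}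
    (hs : SmoothFunNear d s p) (hψ : HasDerivAt ψ ψ' (s p)) (v : Tan d p) :
    dirDeriv (fun q => ψ (s q)) p v = dirDeriv s p v • ψ' := by
  have h1 : HasMFDerivAt 𝓘(ℝ, ℝ) 𝓘(ℝ, F) ψ (s p) (ContinuousLinearMap.toSpanSingleton ℝ ψ') :=
    hψ.hasFDerivAt.hasMFDerivAt
  have h2 := h1.comp p hs.mdifferentiableAt.hasMFDerivAt
  unfold dirDeriv mvfderiv
  simp only [ContinuousLinearMap.comp_apply]
  rw [show (fun q => ψ (s q)) = ψ ∘ s from rfl, h2.mfderiv]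
  rfl

theorem dirDeriv_cpow (hs : SmoothFunNear d s p) (hp : 0 < s p) (β : ℂ) (v : Tan d p) :
    dirDeriv (fun q => (s q : ℂ) ^ β) p v = β * (s p : ℂ) ^ (β - 1) * (dirDeriv s p v : ℝ) := by
  rw [dirDeriv_comp hs (hasDerivAt_ofReal_cpow hp β) v, Complex.real_smul, mul_comm]

theorem partialSum_succ {k : ℕ} (s : M → ℝ) (α : ℂ) (f : ℕ → TensorField d M k) (N : ℕ) :
    partialSum s α f (N + 1) =
      fun p => partialSum s α f N p + (s p : ℂ) ^ (α + (N + 1 : ℕ)) • f (N + 1) p := by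
  funext p
  rw [partialSum, Finset.sum_range_succ]
  rfl

end Powers

/-! ### The commutator with powers and the telescoping of the series `K^h`. -/

section PowerIdentity

variable {d : ℕ} {M : Type*} [TopologicalSpace M] [ChartedSpace (EuclideanSpace ℝ (Fin d)) M]
  [IsManifold (𝓡 d) ∞ M] {g : PseudoMetric d M} {p : M} {k : ℕ} {B : TractorBundle g k}
variable {f f' : TensorField d M k} {s : M → ℝ} {w : ℂ}

/-- The commutator of the degenerate Laplacian with powers of `s`. -/
theorem iDotD_cpow_smul (hd : d ≠ 0) (hs : SmoothFunNear d s p) (hp : 0 < s p)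
    (hf : SmoothTensorNear f p) (w α : ℂ) :
    iDotD g s w (fun q => (s q : ℂ) ^ α • f q) p =
      (s p : ℂ) ^ α • iDotD g s (w - α) f p
        + (α * (d + 2 * w - α - 1) * (s p : ℂ) ^ (α - 1) * (scaleTractorSq g s p : ℝ)) • f p := by
  have hp0 : (s p : ℂ) ≠ 0 := by exact_mod_cast hp.ne'
  have hmul : ∀ β : ℂ, (s p : ℂ) * (s p : ℂ) ^ (β - 1) = (s p : ℂ) ^ β := fun β => by
    rw [Complex.cpow_sub _ _ hp0, Complex.cpow_one]
    field_simp
  have h := iDotD_smul g (u := fun q => (s q : ℂ) ^ α) (u' := fun q => α * (s q : ℂ) ^ (α - 1))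
    (u'' := fun q => α * ((α - 1) * (s q : ℂ) ^ (α - 1 - 1))) (α := α) (w := w - α) hd hs hf
    (smoothFunNear_cpow hs hp α) ((SmoothFunNear.const α).mul (smoothFunNear_cpow hs hp (α - 1)))
    ?_ ?_ ?_ ?_
  · rw [sub_add_cancel] at h
    rw [h]
    module
  · filter_upwards [hs.eventually, eventually_pos hs hp] with q h1 h2 v
    exact dirDeriv_cpow h1 h2 α v
  · intro v
    rw [dirDeriv_mul (.const α) (smoothFunNear_cpow hs hp (α - 1)), dirDeriv_const,
      dirDeriv_cpow hs hp]
    ring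
  · rw [← hmul α]; ring
  · rw [← hmul (α - 1)]; ring

theorem iDotD_const_smul (hs : SmoothFunNear d s p) (hf : SmoothTensorNear f p) (c : ℂ) :
    iDotD g s w (fun q => c • f q) p = c • iDotD g s w f p := by
  have e1 : ∀ {X : VField d M} {f : TensorField d M k} {p : M}, SmoothVFieldNear X p →
      SmoothTensorNear f p →
      covDeriv g X (fun q => c • f q) p = c • covDeriv g X f p := fun {X f p} hX hf => by
    have := covDeriv_smul g (u := fun _ => c) (.const c) hX hf
    rwa [dirDeriv_const, zero_smul, add_zero] at this
  have e2 : laplacian g (fun q => c • f q) p = c • laplacian g f p := by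
    unfold laplacian
    rw [← metricTrace_complex_smul]
    congr 1
    funext i j
    have hi := SmoothVFieldNear.coordField p i
    have hj := SmoothVFieldNear.coordField p j
    rw [e1 (hi.lc g hj) hf, covDeriv_congr g hi (covDeriv_smooth g hj (hf.smul (.const c)))
      (f' := fun q => c • covDeriv g (coordField p j) f q), e1 hi (covDeriv_smooth g hj hf), smul_sub]
    filter_upwards [hj.eventually, hf.eventually] with q h1 h2
    exact e1 h1 h2
  rw [iDotD_apply, iDotD_apply, e2, e1 (grad_smooth g hs) hf]
  module

theorem iDotD_zero (hs : SmoothFunNear d s p) :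
    iDotD g s w (fun q => (0 : TensorFibre d k q)) p = 0 := by
  have := iDotD_const_smul (g := g) (w := w) hs (SmoothTensorNear.zero (k := k) p) 0
  simpa using this

theorem iDotD_sum (hs : SmoothFunNear d s p) {ι : Type*} (S : Finset ι)
    {f : ι → TensorField d M k} (hf : ∀ i ∈ S, SmoothTensorNear (f i) p) :
    iDotD g s w (fun q => ∑ i ∈ S, f i q) p = ∑ i ∈ S, iDotD g s w (f i) p := by
  classical
  induction S using Finset.induction_on with
  | empty => simpa using iDotD_zero hs
  | insert i S hi ih =>
    simp only [Finset.sum_insert hi]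
    rw [iDotD_add g hs (hf i (by simp)) (.sum S fun j hj => hf j (by simp [hj])),
      ih fun j hj => hf j (by simp [hj])]

theorem iDotD_eq_yPow_succ (hI : ∀ p, scaleTractorSq g s p ≠ 0) (w : ℂ) (m : ℕ)
    (f : TensorField d M k) (p : M) :
    iDotD g s (w - m) (yPow g s w m f) p =
      (-(scaleTractorSq g s p : ℂ)) • yPow g s w (m + 1) f p := by
  have : (scaleTractorSq g s p : ℂ) ≠ 0 := by exact_mod_cast hI p
  change _ = (-(scaleTractorSq g s p : ℂ)) •
    ((-(1 / (scaleTractorSq g s p : ℂ))) • iDotD g s (w - m) (yPow g s w m f) p)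
  rw [smul_smul]
  field_simp
  simp

/-- Follows from `(m+2-h)_{m+1} = (m+2-h) (m+1-h)_m`. If `(m+1-h)_m` vanishes, both coefficients are
`0` by the convention for division by zero, so only the new factor has to be nonzero. -/
theorem besselK_coeff_succ {h : ℂ} {m : ℕ} (hm : (m : ℂ) + 2 - h ≠ 0) :
    ((m : ℂ) + 1) * (h - 2 - m) * PowerSeries.coeff (m + 1) (besselK h) =
      PowerSeries.coeff m (besselK h) := by
  have hm1 : (m : ℂ) + 1 ≠ 0 := by exact_mod_cast Nat.succ_ne_zero m
  simp only [besselK, PowerSeries.coeff_mk, descPochhammer_succ_left, Polynomial.eval_mul,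
    Polynomial.eval_X, Polynomial.eval_comp, Polynomial.eval_sub, Polynomial.eval_one,
    Nat.factorial_succ, pow_succ]
  push_cast
  rw [show (m : ℂ) + 1 + 1 - h - 1 = m + 1 - h by ring,
    show (m : ℂ) + 1 + 1 - h = m + 2 - h by ring]
  have hf : (m.factorial : ℂ) ≠ 0 := by exact_mod_cast m.factorial_ne_zero
  by_cases hP : Polynomial.eval ((m : ℂ) + 1 - h) (descPochhammer ℂ m) = 0
  · simp [hP]
  · field_simp
    ring

theorem partialSum_smoothNear (hs : SmoothFunNear d s p) (hp : 0 < s p) {α : ℂ}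
    {f : ℕ → TensorField d M k} (hf : ∀ i, SmoothTensorNear (f i) p) (N : ℕ) :
    SmoothTensorNear (partialSum s α f N) p :=
  .sum _ fun i _ => (hf i).smul (smoothFunNear_cpow hs hp _)

/-- The telescoping sum behind the solution operators. -/
theorem iDotD_partialSum_normalOrdered (hd : d ≠ 0) (hs : ∀ p, SmoothFunNear d s p)
    (hI : ∀ p, scaleTractorSq g s p ≠ 0) (hp : 0 < s p) {f : TensorField d M k}
    (hf : B.IsSection f) {w β h : ℂ} (hβ : β * (d + 2 * w - β - 1) = 0)
    (hrec : ∀ m : ℕ, (β + (m + 1)) * (d + 2 * w - (β + (m + 1)) - 1) = (m + 1) * (h - 2 - m))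
    (hh : ∀ m : ℕ, (m : ℂ) + 2 - h ≠ 0) (N : ℕ) :
    iDotD g s w (partialSum s β (normalOrdered g s (w - β) (besselK h) f)  N) p =
      (s p : ℂ) ^ (β + N) • iDotD g s (w - β - N) (normalOrdered g s (w - β) (besselK h) f N) p := by
  have hF : ∀ m q, SmoothTensorNear (normalOrdered g s (w - β) (besselK h) f m) q := fun m q =>
    ((hf.normalOrdered hs hI _ m).near q).smooth
  induction N with
  | zero =>
    have e : partialSum s β (normalOrdered g s (w - β) (besselK h) f) 0 =
        fun q => (s q : ℂ) ^ β • normalOrdered g s (w - β) (besselK h) f 0 q := by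
      funext q; simp [partialSum]
    -- Since `β` is an indicial root, no term in `s^(β-1)` appears.
    rw [e, iDotD_cpow_smul hd (hs p) hp (hF 0 p), hβ]
    simp
  | succ N ih =>
    rw [partialSum_succ, iDotD_add g (hs p) (partialSum_smoothNear (hs p) hp (fun m => hF m p) N)
      ((hF (N + 1) p).smul (smoothFunNear_cpow (hs p) hp _)), ih,
      iDotD_cpow_smul hd (hs p) hp (hF (N + 1) p)]
    -- The term left over at order `N` is `-K_N s^(β+N) I² y^(N+1) f`. The commutator of `s^(β+N+1)`
    -- with the next coefficient contributes the same expression with `-K_N` replaced by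
    -- `(N+1)(h-2-N) K_{N+1}`, and the recursion makes the two cancel.
    have e1 : iDotD g s (w - β - N) (normalOrdered g s (w - β) (besselK h) f N) p =
        PowerSeries.coeff N (besselK h) •
          ((-(scaleTractorSq g s p : ℂ)) • yPow g s (w - β) (N + 1) f p) := by
      rw [← iDotD_eq_yPow_succ hI]
      exact iDotD_const_smul (hs p) ((hf.yPow hs hI N).near p).smooth _
    have e2 : normalOrdered g s (w - β) (besselK h) f (N + 1) p =
        PowerSeries.coeff (N + 1) (besselK h) • yPow g s (w - β) (N + 1) f p := rfl
    have e3 := hrec N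
    have e4 := besselK_coeff_succ (hh N)
    rw [e1, e2, sub_sub w β, show β + ((N + 1 : ℕ) : ℂ) - 1 = β + N by push_cast; ring, ← e4]
    push_cast
    rw [e3]
    module

end PowerIdentity

/-! ### Hadamard's lemma in vector spaces. -/

section Hadamard

variable {E F : Type*} [NormedAddCommGroup E] [NormedSpace ℝ E] [NormedAddCommGroup F]
  [NormedSpace ℝ F]

/-- The integral is the value at `0` of the convolution of the indicator of `(0, 1]` with `t ↦ K x
(-t)`, cut off to compact support; smoothness in a parameter is known for such convolutions. The
cutoff equals `1` on the range of integration. -/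
theorem contDiff_intervalIntegral_param {K : E → ℝ → F}
    (hK : ContDiff ℝ ∞ fun z : E × ℝ => K z.1 z.2) :
    ContDiff ℝ ∞ fun x => ∫ t in (0 : ℝ)..1, K x t := by
  let χ : ContDiffBump (0 : ℝ) := ⟨1, 2, one_pos, one_lt_two⟩
  have hχ : ∀ t ∈ Icc (0 : ℝ) 1, χ (-t) = 1 := fun t ht => χ.one_of_mem_closedBall (by
    simpa [abs_of_nonneg ht.1] using ht.2)
  let G : E → ℝ → F := fun x t => χ t • K x (-t)
  have hG : ContDiff ℝ ∞ fun z : E × ℝ => G z.1 z.2 :=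
    (χ.contDiff.comp contDiff_snd).smul (hK.comp (contDiff_fst.prodMk contDiff_snd.neg))
  have hint : MeasureTheory.LocallyIntegrable ((Ioc (0 : ℝ) 1).indicator fun _ => (1 : ℝ)) :=
    (MeasureTheory.integrable_indicator_iff measurableSet_Ioc).2
      (by simp) |>.locallyIntegrable
  have key := MeasureTheory.contDiffOn_convolution_right_with_param (n := ⊤) (μ := MeasureTheory.volume)
    (ContinuousLinearMap.lsmul ℝ ℝ (E := F)) (g := G) (s := univ)
    (k := Metric.closedBall (0 : ℝ) 2) isOpen_univ (isCompact_closedBall _ _) (fun x t _ ht => by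
      have : χ t = 0 := χ.zero_of_le_dist (by
        simp only [Metric.mem_closedBall, not_le] at ht
        exact ht.le)
      simp [G, this]) hint hG.contDiffOn
  rw [univ_prod_univ, contDiffOn_univ] at key
  have h2 := key.comp (contDiff_id.prodMk (contDiff_const (c := (0 : ℝ))))
  refine (congrArg (ContDiff ℝ ∞) (funext fun x => ?_)).mp h2
  simp only [Function.comp_apply, MeasureTheory.convolution, G, id]
  rw [intervalIntegral.integral_of_le zero_le_one, ← MeasureTheory.integral_indicator measurableSet_Ioc]
  congr 1
  funext t
  by_cases ht : t ∈ Ioc (0 : ℝ) 1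
  · simp [ht, hχ t (Ioc_subset_Icc_self ht)]
  · simp [ht]

theorem exists_contDiff_eventuallyEq [FiniteDimensional ℝ E] {u : E → F} {x : E} (hu : ∀ᶠ y in 𝓝 x, ContDiffAt ℝ ∞ u y) :
    ∃ v : E → F, ContDiff ℝ ∞ v ∧ ∀ᶠ y in 𝓝 x, v y = u y := by
  obtain ⟨r, hr, h⟩ := Metric.eventually_nhds_iff_ball.1 hu
  let χ : ContDiffBump x := ⟨r / 4, r / 2, by positivity, by linarith⟩
  refine ⟨fun y => χ y • u y, contDiff_iff_contDiffAt.2 fun y => ?_, ?_⟩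
  · by_cases hy : y ∈ Metric.ball x r
    · exact χ.contDiffAt.smul (h y hy)
    · refine contDiffAt_const (c := (0 : F)) |>.congr_of_eventuallyEq ?_
      have : (Metric.closedBall x (r / 2))ᶜ ∈ 𝓝 y :=
        Metric.isClosed_closedBall.isOpen_compl.mem_nhds (by
          simp only [Metric.mem_ball, not_lt] at hy
          simp only [mem_compl_iff, Metric.mem_closedBall, not_le]
          linarith)
      filter_upwards [this] with z hz
      have : χ z = 0 := χ.zero_of_le_dist (by
        simp only [mem_compl_iff, Metric.mem_closedBall, not_le] at hz
        exact hz.le)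
      simp [this]
  · filter_upwards [χ.eventuallyEq_one] with y hy
    simp [hy]

/-- A smooth function vanishing along the hyperplane `l = 0` is divisible by `l`. -/
theorem exists_eq_smul_of_vanishing_linear [CompleteSpace F] {u : E → F} (hu : ContDiff ℝ ∞ u) (l : E →L[ℝ] ℝ) (e : E) :
    ∃ H : E → F, ContDiff ℝ ∞ H ∧ ∀ x, u (x - l x • e) = 0 → u x = l x • H x := by
  have hD : ContDiff ℝ ∞ fun x => fderiv ℝ u x e :=
    (hu.fderiv_right (m := ∞) (by simp)).clm_apply contDiff_const
  -- The fundamental theorem of calculus along the segment from `x - l x • e` to `x`, whose velocity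
  -- `l x • e` supplies the factor `l x`.
  refine ⟨fun x => ∫ t in (0 : ℝ)..1, fderiv ℝ u (x - l x • e + t • (l x • e)) e,
    contDiff_intervalIntegral_param (hD.comp ?_), fun x hx => ?_⟩
  · fun_prop
  · have hderiv : ∀ t ∈ uIcc (0 : ℝ) 1, HasDerivAt (fun t : ℝ => u (x - l x • e + t • (l x • e)))
        (l x • fderiv ℝ u (x - l x • e + t • (l x • e)) e) t := fun t _ => by
      have h1 : HasDerivAt (fun t : ℝ => x - l x • e + t • (l x • e)) (l x • e) t := by
        simpa using ((hasDerivAt_id t).smul_const (l x • e)).const_add (x - l x • e)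
      have h2 := ((hu.differentiable (by simp)) (x - l x • e + t • (l x • e))).hasFDerivAt.comp_hasDerivAt t h1
      rw [map_smul] at h2
      exact h2
    have hcont : Continuous fun t : ℝ => l x • fderiv ℝ u (x - l x • e + t • (l x • e)) e :=
      (hD.continuous.comp (by fun_prop)).const_smul _
    have := intervalIntegral.integral_eq_sub_of_hasDerivAt hderiv (hcont.intervalIntegrable _ _)
    rw [intervalIntegral.integral_smul] at this
    rw [this]
    simp [hx]

end Hadamard

section HadamardLocal

variable {E F : Type*} [NormedAddCommGroup E] [NormedSpace ℝ E] [FiniteDimensional ℝ E]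
  [NormedAddCommGroup F] [NormedSpace ℝ F] [CompleteSpace F]

/-- Hadamard's lemma: a smooth function vanishing on a regular hypersurface is divisible by a
defining function. -/
theorem exists_eq_smul_of_vanishing {u : E → F} {s : E → ℝ} {x : E} (hu : ∀ᶠ y in 𝓝 x, ContDiffAt ℝ ∞ u y)
    (hs : ∀ᶠ y in 𝓝 x, ContDiffAt ℝ ∞ s y) (hx : s x = 0) (hds : fderiv ℝ s x ≠ 0)
    (h0 : ∀ᶠ y in 𝓝 x, s y = 0 → u y = 0) :
    ∃ v : E → F, (∀ᶠ y in 𝓝 x, ContDiffAt ℝ ∞ v y) ∧ ∀ᶠ y in 𝓝 x, u y = s y • v y := by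
  set l := fderiv ℝ s x with hl
  obtain ⟨e, he⟩ : ∃ e, l e = 1 := by
    obtain ⟨e, he⟩ : ∃ e, l e ≠ 0 := by
      by_contra! h
      exact hds (ContinuousLinearMap.ext h)
    exact ⟨(l e)⁻¹ • e, by simp [he]⟩
  -- `Φ` shifts along `e` so that `l (Φ y - x) = s y`, straightening the hypersurface. Its
  -- derivative at `x` is the identity because `l` is the derivative of `s` there, so the inverse
  -- function theorem applies.
  let Φ : E → E := fun y => y + (s y - l (y - x)) • e
  have hΦ : ∀ᶠ y in 𝓝 x, ContDiffAt ℝ ∞ Φ y := by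
    filter_upwards [hs] with y hy
    fun_prop
  have hΦx : Φ x = x := by simp [Φ, hx]
  have hlΦ : ∀ y, l (Φ y - x) = s y := fun y => by
    simp only [Φ, add_sub_right_comm, map_add, map_smul, he]
    simp
  have hΦ' : HasFDerivAt Φ ((ContinuousLinearEquiv.refl ℝ E : E ≃L[ℝ] E) : E →L[ℝ] E) x := by
    have h1 : HasFDerivAt s l x :=
      (hs.self_of_nhds.differentiableAt (by simp)).hasFDerivAt
    have h2 : HasFDerivAt (fun y => l (y - x)) l x := by
      exact l.hasFDerivAt.comp x ((hasFDerivAt_id x).sub_const x)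
    have h3 := (hasFDerivAt_id x).add ((h1.sub h2).smul_const e)
    refine h3.congr_fderiv ?_
    ext y; simp
  let Θ := hΦ.self_of_nhds.toOpenPartialHomeomorph Φ hΦ' (by simp)
  have hΘ : ∀ y, Θ y = Φ y := fun y => rfl
  have hxs : x ∈ Θ.source := hΦ.self_of_nhds.mem_toOpenPartialHomeomorph_source hΦ' (by simp)
  have hΘx : Θ.symm x = x := by
    conv_lhs => rw [← hΦx, ← hΘ]
    exact Θ.left_inv hxs
  have hxt : x ∈ Θ.target := by
    have := Θ.map_source hxs
    rwa [hΘ, hΦx] at this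
  have hsymm : ContDiffAt ℝ ∞ Θ.symm x := by
    have h4 := hΦ.self_of_nhds.to_localInverse hΦ' (by simp)
    rw [hΦx] at h4
    exact h4
  have hsymm' : ∀ᶠ z in 𝓝 x, ContDiffAt ℝ ∞ Θ.symm z := by
    have hc := (Θ.continuousAt_symm hxt)
    rw [ContinuousAt, hΘx] at hc
    -- Invertibility of the derivative is an open condition; this gives smoothness of the local
    -- inverse near `x` and not only at `x`.
    have hinv : ∀ᶠ y in 𝓝 x, ∃ L : E ≃L[ℝ] E, HasFDerivAt Φ (L : E →L[ℝ] E) y := by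
      have hc : ContinuousAt (fderiv ℝ Φ) x :=
        (hΦ.self_of_nhds.fderiv_right (m := ∞) (by simp)).continuousAt
      have := hc.eventually (p := fun A => A ∈ range ((↑) : (E ≃L[ℝ] E) → E →L[ℝ] E)) (by
        rw [hΦ'.fderiv]
        exact ContinuousLinearEquiv.nhds (ContinuousLinearEquiv.refl ℝ E))
      filter_upwards [this, hΦ] with y ⟨L, hL⟩ hy
      exact ⟨L, hL ▸ (hy.differentiableAt (by simp)).hasFDerivAt⟩
    filter_upwards [hc.eventually hinv, hc.eventually hΦ, Θ.open_target.mem_nhds hxt] with z ⟨L, hL⟩ h2 h3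
    exact Θ.contDiffAt_symm h3 hL h2
  have hcs : Filter.Tendsto Θ.symm (𝓝 x) (𝓝 x) := by
    have hc := (Θ.continuousAt_symm hxt)
    rwa [ContinuousAt, hΘx] at hc
  have hcΦ : Filter.Tendsto Φ (𝓝 x) (𝓝 x) := by
    have hc := hΦ.self_of_nhds.continuousAt
    rwa [ContinuousAt, hΦx] at hc
  -- The linear version needs a globally smooth function, so `u` in the straightened coordinates is
  -- replaced by one with the same germ.
  obtain ⟨U, hU, hUe⟩ := exists_contDiff_eventuallyEq (u := fun z => u (Θ.symm z)) (x := x) (by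
    filter_upwards [hsymm', hcs.eventually hu] with z h1 h2 using h2.comp z h1)
  obtain ⟨H, hH, hUH⟩ := exists_eq_smul_of_vanishing_linear
    (u := fun z => U (x + z)) (hU.comp (contDiff_const.add contDiff_id)) l e
  refine ⟨fun y => H (Φ y - x), ?_, ?_⟩
  · filter_upwards [hΦ] with y hy
    exact hH.contDiffAt.comp y (hy.sub contDiffAt_const)
  · have hproj : Filter.Tendsto (fun y => x + (Φ y - x - s y • e)) (𝓝 x) (𝓝 x) := by
      have h5 : ContinuousAt (fun y => x + (Φ y - x - s y • e)) x :=
        continuousAt_const.add ((hΦ.self_of_nhds.continuousAt.sub continuousAt_const).sub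
          (hs.self_of_nhds.continuousAt.smul continuousAt_const))
      simpa [ContinuousAt, hΦx, hx] using h5
    filter_upwards [hcΦ.eventually hUe, hproj.eventually hUe,
      (hcs.comp hproj).eventually h0, hproj.eventually (Θ.open_target.mem_nhds hxt),
      Θ.open_source.mem_nhds hxs] with y h1 h2 h3 h4 h5
    have h6 := hUH (Φ y - x)
    simp only [hlΦ, add_sub_cancel] at h6
    rw [h1, ← hΘ, Θ.left_inv h5, hΘ] at h6
    refine h6 ?_
    rw [h2]
    refine h3 ?_
    simp only [Function.comp_apply]
    rw [← hlΦ, ← hΘ, Θ.right_inv h4]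
    simp [hlΦ, he]

end HadamardLocal


/-! ### Transfer to the manifold through charts. -/

section Charts

variable {d : ℕ} {M : Type*} [TopologicalSpace M] [ChartedSpace (EuclideanSpace ℝ (Fin d)) M]

theorem tendsto_extChartAt_symm (p : M) :
    Filter.Tendsto (extChartAt (𝓡 d) p).symm (𝓝 (extChartAt (𝓡 d) p p)) (𝓝 p) := by
  simpa [ContinuousAt, extChartAt_to_inv] using continuousAt_extChartAt_symm (I := 𝓡 d) p

theorem eventually_chart_symm (p : M) :
    ∀ᶠ q in 𝓝 p, (extChartAt (𝓡 d) p).symm (extChartAt (𝓡 d) p q) = q := by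
  filter_upwards [extChartAt_source_mem_nhds (I := 𝓡 d) p] with q hq
  exact (extChartAt (𝓡 d) p).left_inv hq

end Charts

section ManifoldHadamard

variable {d : ℕ} {M : Type*} [TopologicalSpace M] [ChartedSpace (EuclideanSpace ℝ (Fin d)) M]
  [IsManifold (𝓡 d) ∞ M] {F : Type*} [NormedAddCommGroup F] [NormedSpace ℝ F] {p : M}
  {u : M → F} {s : M → ℝ}

theorem SmoothFunNear.chart (hu : SmoothFunNear d u p) :
    ∀ᶠ z in 𝓝 (extChartAt (𝓡 d) p p), ContDiffAt ℝ ∞ (u ∘ (extChartAt (𝓡 d) p).symm) z := by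
  filter_upwards [(tendsto_extChartAt_symm p).eventually hu,
    (isOpen_extChartAt_target (I := 𝓡 d) p).mem_nhds (mem_extChartAt_target p)] with z h1 h2
  exact (h1.comp z (((contMDiffOn_extChartAt_symm p).contMDiffAt
    ((isOpen_extChartAt_target (I := 𝓡 d) p).mem_nhds h2)))).contDiffAt

theorem SmoothFunNear.comp_chart {v : EuclideanSpace ℝ (Fin d) → F}
    (hv : ∀ᶠ z in 𝓝 (extChartAt (𝓡 d) p p), ContDiffAt ℝ ∞ v z) :
    SmoothFunNear d (fun q => v (extChartAt (𝓡 d) p q)) p := by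
  filter_upwards [(continuousAt_extChartAt (I := 𝓡 d) p).eventually hv,
    extChartAt_source_mem_nhds (I := 𝓡 d) p] with q h1 h2
  exact h1.contMDiffAt.comp q (contMDiffAt_extChartAt' (by simpa using h2))

theorem fderiv_chart_ne_zero (hu : SmoothFunNear d u p) {X : Tan d p} (hX : dirDeriv u p X ≠ 0) :
    fderiv ℝ (u ∘ (extChartAt (𝓡 d) p).symm) (extChartAt (𝓡 d) p p) ≠ 0 := by
  intro h0
  apply hX
  have h1 : HasMFDerivAt 𝓘(ℝ, EuclideanSpace ℝ (Fin d)) 𝓘(ℝ, F)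
      (u ∘ (extChartAt (𝓡 d) p).symm) (extChartAt (𝓡 d) p p) 0 := by
    have := (hu.chart.self_of_nhds.differentiableAt (by simp)).hasFDerivAt
    rw [h0] at this
    exact this.hasMFDerivAt
  have h2 := h1.comp p (mdifferentiableAt_extChartAt (I := 𝓡 d) (mem_chart_source _ p)).hasMFDerivAt
  have h3 : u =ᶠ[𝓝 p] (u ∘ (extChartAt (𝓡 d) p).symm) ∘ extChartAt (𝓡 d) p := by
    filter_upwards [eventually_chart_symm (d := d) p] with q hq
    simp only [Function.comp_apply, hq]
  rw [dirDeriv_congr h3]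
  unfold dirDeriv mvfderiv
  rw [h2.mfderiv]
  rfl

theorem SmoothFunNear.exists_eq_smul_of_vanishing [CompleteSpace F] (hu : SmoothFunNear d u p)
    (hs : SmoothFunNear d s p) (hp : s p = 0) {X : Tan d p} (hX : dirDeriv s p X ≠ 0)
    (h0 : ∀ᶠ q in 𝓝 p, s q = 0 → u q = 0) :
    ∃ v : M → F, SmoothFunNear d v p ∧ ∀ᶠ q in 𝓝 p, u q = s q • v q := by
  obtain ⟨v, hv, huv⟩ := BoundaryCalculus.exists_eq_smul_of_vanishing hu.chart hs.chart
    (by simpa [extChartAt_to_inv] using hp) (fderiv_chart_ne_zero hs hX)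
    ((tendsto_extChartAt_symm p).eventually h0)
  refine ⟨_, .comp_chart hv, ?_⟩
  filter_upwards [(continuousAt_extChartAt (I := 𝓡 d) p).eventually huv,
    eventually_chart_symm (d := d) p] with q h1 h2
  simpa only [Function.comp_apply, h2] using h1

/-- Otherwise `p` would be a local maximum of `s`, contradicting that `ds` is nonzero at `p`. -/
theorem frequently_pos (hs : SmoothFunNear d s p) (hp : s p = 0) {X : Tan d p}
    (hX : dirDeriv s p X ≠ 0) : ∃ᶠ q in 𝓝 p, 0 < s q := by
  intro h
  refine fderiv_chart_ne_zero hs hX (IsLocalMax.fderiv_eq_zero ?_)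
  filter_upwards [(tendsto_extChartAt_symm p).eventually h] with z hz
  simpa [extChartAt_to_inv, hp] using hz

end ManifoldHadamard

/-! ### Division of sections by `s` and extension from the zero locus. -/

section Division

variable {d : ℕ} {M : Type*} [TopologicalSpace M] [ChartedSpace (EuclideanSpace ℝ (Fin d)) M]
  [IsManifold (𝓡 d) ∞ M] {g : PseudoMetric d M} {p : M} {k : ℕ} {B : TractorBundle g k}
variable {f f' : TensorField d M k} {s : M → ℝ}

theorem dirDeriv_grad_of_eq_zero (hp : s p = 0) :
    dirDeriv s p (grad g s p) = scaleTractorSq g s p := by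
  rw [scaleTractorSq_apply, hp]; ring

variable (g) in
/-- The quotient `f / s` of a tensor field vanishing along the zero locus of `s`. -/
def quotientField (s : M → ℝ) (f : TensorField d M k) : TensorField d M k := fun p =>
  -- Differentiating `f = s f'` along `grad s` at a zero of `s` gives `∇f = I² f'`, which forces
  -- this value.
  if s p = 0 then (scaleTractorSq g s p : ℂ)⁻¹ • covDeriv g (grad g s) f p
  else (s p : ℂ)⁻¹ • f p

theorem smul_quotientField (h0 : ∀ p, s p = 0 → f p = 0) (p : M) :
    (s p : ℂ) • quotientField g s f p = f p := by
  unfold quotientField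
  split_ifs with h
  · simp [h, h0 p h]
  · have : (s p : ℂ) ≠ 0 := by exact_mod_cast h
    rw [smul_smul, mul_inv_cancel₀ this, one_smul]

/-- Components on smooth tractor fields are scalar functions, to which Hadamard's lemma applies
locally. The explicit formula agrees with the scalar quotient both on and off the zero locus, so the
local quotients need no gluing. -/
theorem quotientField_smooth (hs : ∀ p, SmoothFunNear d s p)
    (hI : ∀ p, scaleTractorSq g s p ≠ 0) (hf : ∀ p, SmoothTensorNear f p)
    (h0 : ∀ p, s p = 0 → f p = 0) (p : M) : SmoothTensorNear (quotientField g s f) p := by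
  refine .of_eval (.of_forall fun q T hT => ?_)
  have hu := (hf q).eval hT
  by_cases hq : s q = 0
  · obtain ⟨v, hv, huv⟩ := hu.exists_eq_smul_of_vanishing (hs q) hq (X := grad g s q)
      (by rw [dirDeriv_grad_of_eq_zero hq]; exact hI q) (.of_forall fun r hr => by simp [h0 r hr])
    refine hv.congr ?_
    filter_upwards [hv.eventually, huv.eventually_nhds,
      Filter.eventually_all.2 fun i => (hT i).eventually] with r hr hur hTr
    unfold quotientField
    split_ifs with h
    · rw [_root_.smul_apply, covDeriv_apply g (hf r) (grad_smooth g (hs r)) hTr, covDerivEval,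
        dirDeriv_congr hur, dirDeriv_smul (hs r) hr, dirDeriv_grad_of_eq_zero h, h, h0 r h]
      have : (scaleTractorSq g s r : ℂ) ≠ 0 := by exact_mod_cast hI r
      simp [this]
    · have : (s r : ℂ) ≠ 0 := by exact_mod_cast h
      rw [_root_.smul_apply, hur.self_of_nhds]
      simp [this]
  · have h1 := ((hs q).inv hq).ofReal.mul hu
    refine h1.congr ?_
    filter_upwards [(hs q).contMDiffAt.continuousAt.eventually_ne hq] with r hr
    simp [quotientField, hr]

theorem TractorBundle.IsSection.quotientField (hf : B.IsSection f)
    (hs : ∀ p, SmoothFunNear d s p) (hI : ∀ p, scaleTractorSq g s p ≠ 0)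
    (h0 : ∀ p, s p = 0 → f p = 0) : B.IsSection (quotientField g s f) := by
  refine isSection_iff.2 fun p => ⟨quotientField_smooth hs hI (fun p => (hf.near p).smooth) h0 p,
    .of_forall fun q => ?_⟩
  unfold BoundaryCalculus.quotientField
  split_ifs with h
  · rw [map_smul, ((hf.near q).covDeriv (grad_smooth g (hs q))).fixed.self_of_nhds]
  · rw [map_smul, (hf.near q).fixed.self_of_nhds]

theorem TractorBundle.IsSection.exists_eq_smul (hf : B.IsSection f)
    (hs : ∀ p, SmoothFunNear d s p) (hI : ∀ p, scaleTractorSq g s p ≠ 0)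
    (h0 : ∀ p, s p = 0 → f p = 0) : ∃ f', B.IsSection f' ∧ ∀ p, f p = (s p : ℂ) • f' p :=
  ⟨_, hf.quotientField hs hI h0, fun p => (smul_quotientField h0 p).symm⟩

theorem TractorBundle.SectionNear.sum {ι : Type*} (S : Finset ι) {f : ι → TensorField d M k}
    (h : ∀ i ∈ S, B.SectionNear (f i) p) : B.SectionNear (fun q => ∑ i ∈ S, f i q) p := by
  classical
  induction S using Finset.induction_on with
  | empty => simpa using .zero p
  | insert i S hi ih =>
    simp only [Finset.sum_insert hi]
    exact (h i (by simp)).add (ih fun j hj => h j (by simp [hj]))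

/-- Sections given locally can be glued by a partition of unity, so that sections along the zero
locus extend. -/
theorem TractorBundle.IsSectionAlong.exists_extension [T2Space M] [SecondCountableTopology M]
    {φ : TensorField d M k} (hs : ∀ p, SmoothFunNear d s p) (hφ : B.IsSectionAlong s φ) :
    ∃ f₀, B.IsSection f₀ ∧ ∀ p, s p = 0 → f₀ p = φ p := by
  have hsc : Continuous s := continuous_iff_continuousAt.2 fun p => (hs p).contMDiffAt.continuousAt
  have hloc : ∀ p, ∃ U : Set M, IsOpen U ∧ p ∈ U ∧ ∃ f, B.IsSectionOn U f ∧
      ∀ q ∈ U, s q = 0 → f q = φ q := fun p => by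
    -- Away from the zero locus there is nothing to match, and the zero section serves as local
    -- extension.
    by_cases hp : s p = 0
    · exact hφ p hp
    · refine ⟨{q | s q ≠ 0}, isOpen_ne.preimage hsc, hp, fun _ => 0,
        ⟨SmoothTensorNear.on fun p _ => .zero p, fun _ _ => map_zero _⟩, fun q hq hq0 => absurd hq0 hq⟩
  choose U hU hpU f hf hfφ using hloc
  have : LocallyCompactSpace M := ChartedSpace.locallyCompactSpace (EuclideanSpace ℝ (Fin d)) M
  obtain ⟨ρ, hρ⟩ := SmoothPartitionOfUnity.exists_isSubordinate (𝓡 d) isClosed_univ U hU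
    (fun p _ => mem_iUnion.2 ⟨p, hpU p⟩)
  have hfin : ∀ p, ∃ S : Finset M, ∀ᶠ q in 𝓝 p, ∀ i, i ∉ S → ρ i q = 0 := fun p => by
    obtain ⟨W, hW, hWf⟩ := ρ.locallyFinite p
    refine ⟨hWf.toFinset, ?_⟩
    filter_upwards [hW] with q hq i hi
    by_contra h
    exact hi (hWf.mem_toFinset.2 ⟨q, h, hq⟩)
  have hsum : ∀ p (S : Finset M), (∀ i, i ∉ S → ρ i p = 0) →
      ∑ᶠ i, (ρ i p : ℂ) • f i p = ∑ i ∈ S, (ρ i p : ℂ) • f i p := fun p S h =>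
    finsum_eq_sum_of_support_subset _ fun i hi => by
      by_contra hiS
      exact hi (by simp [h i hiS])
  refine ⟨fun p => ∑ᶠ i, (ρ i p : ℂ) • f i p, isSection_iff.2 fun p => ?_, fun p hp => ?_⟩
  · obtain ⟨S, hS⟩ := hfin p
    refine (SectionNear.sum S (f := fun i q => (ρ i q : ℂ) • f i q) fun i _ => ?_).congr
      (hS.mono fun q hq => (hsum q S hq).symm)
    by_cases hi : p ∈ tsupport (ρ i)
    · exact ((hf i).near (hU i) (hρ i hi)).smul
        (SmoothFunNear.ofReal (.of_forall fun q => (ρ i).contMDiff.contMDiffAt))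
    · refine (SectionNear.zero p).congr ?_
      filter_upwards [(isClosed_tsupport (ρ i)).isOpen_compl.mem_nhds hi] with q hq
      simp [image_eq_zero_of_notMem_tsupport hq]
  · obtain ⟨S, hS⟩ := hfin p
    have hS := hS.self_of_nhds
    have h1 : ∑ i ∈ S, ρ i p = 1 := by
      rw [← ρ.sum_eq_one (mem_univ p)]
      exact (finsum_eq_sum_of_support_subset _ fun i hi => by
        by_contra hiS
        exact hi (hS i hiS)).symm
    simp only [hsum p S hS]
    calc ∑ i ∈ S, (ρ i p : ℂ) • f i p = ∑ i ∈ S, (ρ i p : ℂ) • φ p := by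
          refine Finset.sum_congr rfl fun i _ => ?_
          by_cases hi : ρ i p = 0
          · simp [hi]
          · rw [hfφ i p (hρ i (subset_tsupport _ hi)) hp]
      _ = φ p := by
          rw [← Finset.sum_smul, ← Complex.ofReal_sum, h1, Complex.ofReal_one, one_smul]

end Division

/-! ### Boundary values are determined from the side `s > 0`. -/

section BoundaryValues

variable {d : ℕ} {M : Type*} [TopologicalSpace M] [ChartedSpace (EuclideanSpace ℝ (Fin d)) M]
  [IsManifold (𝓡 d) ∞ M] {g : PseudoMetric d M} {p : M} {k : ℕ} {B : TractorBundle g k}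
variable {f f' : TensorField d M k} {s : M → ℝ}

theorem frequently_pos_of_scaleTractorSq_ne_zero (hs : SmoothFunNear d s p)
    (hI : scaleTractorSq g s p ≠ 0) (hp : s p = 0) : ∃ᶠ q in 𝓝 p, 0 < s q :=
  frequently_pos hs hp (X := grad g s p) (by rwa [dirDeriv_grad_of_eq_zero hp])

theorem SmoothTensorNear.eq_zero_of_frequently (hf : SmoothTensorNear f p)
    (h : ∃ᶠ q in 𝓝 p, f q = 0) : f p = 0 := by
  refine MultilinearMap.ext fun v => ?_
  have hu := (hf.eval (T := fun i => tractorExtend (v i))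
    fun i => smoothTractorNear_tractorExtend (v i)).contMDiffAt.continuousAt
  by_contra hne
  have h1 := hu.eventually_ne (y := 0) (by simpa using hne)
  obtain ⟨q, h2, h3⟩ := (h.and_eventually h1).exists
  exact h3 (by simp [h2])

/-- The zero locus lies in the closure of `{s > 0}`. This carries identities of smooth sections
known only for `s > 0` to the boundary. -/
theorem TractorBundle.IsSection.eq_zero_of_pos (hf : B.IsSection f)
    (hs : ∀ p, SmoothFunNear d s p) (hI : ∀ p, scaleTractorSq g s p ≠ 0)
    (h : ∀ q, 0 < s q → f q = 0) (hp : s p = 0) : f p = 0 :=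
  (hf.near p).smooth.eq_zero_of_frequently
    ((frequently_pos_of_scaleTractorSq_ne_zero (hs p) (hI p) hp).mono h)

end BoundaryValues

/-! ### The indicial operator. -/

section Indicial

variable {d : ℕ} {M : Type*} [TopologicalSpace M] [ChartedSpace (EuclideanSpace ℝ (Fin d)) M]
  [IsManifold (𝓡 d) ∞ M] {g : PseudoMetric d M} {p : M} {k : ℕ} {B : TractorBundle g k}
variable {f f' r : TensorField d M k} {s : M → ℝ} {w β : ℂ}

variable (g) in
/-- The operator `f ↦ s^{1-β} I·D (s^β f)`. -/
def indicial (s : M → ℝ) (w β : ℂ) (f : TensorField d M k) : TensorField d M k := fun p =>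
  (β * (d + 2 * w - 1 - β) * (scaleTractorSq g s p : ℂ)) • f p
    + (s p : ℂ) • iDotD g s (w - β) f p

theorem indicial_of_eq_zero (hp : s p = 0) :
    indicial g s w β f p = (β * (d + 2 * w - 1 - β) * (scaleTractorSq g s p : ℂ)) • f p := by
  simp [indicial, hp]

theorem iDotD_cpow_smul_eq (hd : d ≠ 0) (hs : SmoothFunNear d s p) (hp : 0 < s p)
    (hf : SmoothTensorNear f p) (w β : ℂ) :
    iDotD g s w (fun q => (s q : ℂ) ^ β • f q) p = (s p : ℂ) ^ (β - 1) • indicial g s w β f p := by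
  have hp0 : (s p : ℂ) ≠ 0 := by exact_mod_cast hp.ne'
  have h : (s p : ℂ) ^ β = (s p : ℂ) ^ (β - 1) * s p := by
    rw [Complex.cpow_sub _ _ hp0, Complex.cpow_one]
    field_simp
  rw [iDotD_cpow_smul hd hs hp hf, indicial, h]
  module

theorem TractorBundle.IsSection.pow_smul (hf : B.IsSection f) (hs : ∀ p, SmoothFunNear d s p)
    (n : ℕ) : B.IsSection (fun q => (s q : ℂ) ^ n • f q) :=
  hf.smul fun p => smoothFunNear_pow (hs p) n

theorem TractorBundle.IsSection.indicial (hf : B.IsSection f) (hs : ∀ p, SmoothFunNear d s p) :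
    B.IsSection (indicial g s w β f) :=
  (hf.smul fun p => (SmoothFunNear.const _).mul (scaleTractorSq_smooth g (hs p)).ofReal).add
    ((hf.iDotD hs).smul fun p => (hs p).ofReal)

theorem indicial_sub (hs : SmoothFunNear d s p) (hf : SmoothTensorNear f p)
    (hf' : SmoothTensorNear f' p) :
    indicial g s w β (fun q => f q - f' q) p = indicial g s w β f p - indicial g s w β f' p := by
  have h := iDotD_add g (w := w - β) hs hf (hf'.smul (.const (-1)))
  rw [iDotD_const_smul hs hf'] at h
  simp only [neg_one_smul, ← sub_eq_add_neg] at h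
  simp only [indicial, h]
  module

/-- Both sides come from evaluating `I·D (s^(β+n) f)`, splitting the power as `s^β s^n` or not at
all, and cancelling `s^(β-1)`. -/
theorem indicial_pow_smul (hd : d ≠ 0) (hs : SmoothFunNear d s p) (hp : 0 < s p)
    (hf : SmoothTensorNear f p) (w β : ℂ) (n : ℕ) :
    indicial g s w β (fun q => (s q : ℂ) ^ n • f q) p =
      (s p : ℂ) ^ n • indicial g s w (β + n) f p := by
  have hp0 : (s p : ℂ) ≠ 0 := by exact_mod_cast hp.ne'
  have h1 := iDotD_cpow_smul_eq (g := g) hd hs hp (hf.smul (smoothFunNear_pow hs n)) w β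
  have h2 := iDotD_cpow_smul_eq (g := g) hd hs hp hf w (β + n)
  have h3 : iDotD g s w (fun q => (s q : ℂ) ^ β • (s q : ℂ) ^ n • f q) p =
      iDotD g s w (fun q => (s q : ℂ) ^ (β + n) • f q) p := by
    refine iDotD_congr g hs ((hf.smul (smoothFunNear_pow hs n)).smul (smoothFunNear_cpow hs hp β)) ?_
    filter_upwards [eventually_pos hs hp] with q hq
    have : (s q : ℂ) ≠ 0 := by exact_mod_cast hq.ne'
    rw [smul_smul, Complex.cpow_add _ _ this, Complex.cpow_natCast]
  rw [h1, h2] at h3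
  rw [show β + n - 1 = (β - 1) + n by ring, Complex.cpow_add _ _ hp0, Complex.cpow_natCast,
    mul_smul] at h3
  exact smul_right_injective _ (by simp [Complex.cpow_eq_zero_iff, hp0]) h3

/-- Away from the indicial roots, `f` vanishes as far as its image under the indicial operator
does. -/
theorem TractorBundle.IsSection.exists_eq_pow_smul (hd : d ≠ 0) (hs : ∀ p, SmoothFunNear d s p)
    (hI : ∀ p, scaleTractorSq g s p ≠ 0) (hf : B.IsSection f) (hr : B.IsSection r) {N j : ℕ}
    (hjN : j ≤ N) (h : ∀ p, 0 < s p → BoundaryCalculus.indicial g s w β f p = (s p : ℂ) ^ N • r p)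
    (hβ : ∀ i < j, (β + i) * (d + 2 * w - 1 - (β + i)) ≠ 0) :
    ∃ f', B.IsSection f' ∧ (∀ p, f p = (s p : ℂ) ^ j • f' p) ∧
      ∀ p, 0 < s p →
        BoundaryCalculus.indicial g s w (β + j) f' p = (s p : ℂ) ^ (N - j) • r p := by
  induction j with
  | zero => exact ⟨f, hf, by simp, by simpa using h⟩
  | succ j ih =>
    obtain ⟨f₁, hf₁, hff₁, hind⟩ := ih (by omega) fun i hi => hβ i (by omega)
    have hNj : N - j = (N - (j + 1)) + 1 := by omega
    -- At the boundary the right hand side still carries a factor `s`, since `j < N`, while the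
    -- operator is multiplication by a nonzero number times `I²`. Hence `f₁` vanishes there and can
    -- be divided once more.
    have h0 : ∀ p, s p = 0 → f₁ p = 0 := fun p hp => by
      have h1 := ((hf₁.indicial (w := w) (β := β + j) hs).sub
        (hr.pow_smul hs (N - j))).eq_zero_of_pos hs hI (fun q hq => sub_eq_zero.2 (hind q hq)) hp
      rw [indicial_of_eq_zero hp, hp, hNj] at h1
      simp only [Complex.ofReal_zero, zero_pow (Nat.succ_ne_zero _), zero_smul, sub_zero] at h1
      refine (smul_eq_zero.1 h1).resolve_left (mul_ne_zero (hβ j (by omega)) ?_)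
      exact_mod_cast hI p
    obtain ⟨f₂, hf₂, hff₂⟩ := hf₁.exists_eq_smul hs hI h0
    refine ⟨f₂, hf₂, fun p => by rw [hff₁, hff₂, smul_smul, pow_succ], fun p hp => ?_⟩
    have hp0 : (s p : ℂ) ≠ 0 := by exact_mod_cast hp.ne'
    have h2 := hind p hp
    have h3 : f₁ = fun q => (s q : ℂ) ^ 1 • f₂ q := funext fun q => by rw [hff₂, pow_one]
    rw [h3, indicial_pow_smul hd (hs p) hp (hf₂.near p).smooth, hNj, pow_succ' _ (N - (j + 1)),
      pow_one, mul_smul, Nat.cast_one, add_assoc] at h2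
    push_cast
    exact smul_right_injective _ hp0 h2

/-- A section vanishing along the zero locus whose image under the indicial operator is of order
`N + 1` is itself of order `N + 1`, provided that there are no later indicial roots. -/
theorem TractorBundle.IsSection.exists_eq_pow_succ_smul (hd : d ≠ 0)
    (hs : ∀ p, SmoothFunNear d s p)
    (hI : ∀ p, scaleTractorSq g s p ≠ 0) (hf : B.IsSection f) (hr : B.IsSection r) {N : ℕ}
    (h0 : ∀ p, s p = 0 → f p = 0)
    (h : ∀ p, 0 < s p → BoundaryCalculus.indicial g s w β f p = (s p : ℂ) ^ (N + 1) • r p)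
    (hβ : ∀ i : ℕ, (β + (i + 1)) * (d + 2 * w - 1 - (β + (i + 1))) ≠ 0) :
    ∃ f', B.IsSection f' ∧ ∀ p, f p = (s p : ℂ) ^ (N + 1) • f' p := by
  -- The first division uses the assumed vanishing, as `β` itself may be a root; from `β + 1` on no
  -- root occurs.
  obtain ⟨f₁, hf₁, hff₁⟩ := hf.exists_eq_smul hs hI h0
  obtain ⟨f₂, hf₂, hff₂, -⟩ := hf₁.exists_eq_pow_smul hd hs hI hr (w := w) (β := β + 1) le_rfl
    (N := N) (fun p hp => by
      have hp0 : (s p : ℂ) ≠ 0 := by exact_mod_cast hp.ne'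
      have h3 : f = fun q => (s q : ℂ) ^ 1 • f₁ q := funext fun q => by rw [hff₁, pow_one]
      have h2 := h p hp
      rw [h3, indicial_pow_smul hd (hs p) hp (hf₁.near p).smooth, pow_succ' _ N, pow_one, mul_smul,
        Nat.cast_one] at h2
      exact smul_right_injective _ hp0 h2)
    fun i _ => by
      have := hβ i
      rwa [add_assoc, add_comm (1 : ℂ)]
  exact ⟨f₂, hf₂, fun p => by rw [hff₁, hff₂, smul_smul, pow_succ']⟩

end Indicial

/-! ### Error terms. -/

section BigO

variable {d : ℕ} {M : Type*} [TopologicalSpace M] [ChartedSpace (EuclideanSpace ℝ (Fin d)) M]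
  [IsManifold (𝓡 d) ∞ M] {g : PseudoMetric d M} {p : M} {k : ℕ} {B : TractorBundle g k}
variable {u v r : TensorField d M k} {s : M → ℝ} {w β : ℂ} {S : Finset ℂ} {e : ℕ}

namespace TractorBundle

theorem IsBigO.of_eq (hβ : β ∈ S) (hr : B.IsSection r)
    (h : ∀ p, 0 < s p → u p = (s p : ℂ) ^ (β + e) • r p) : B.IsBigO s S e u := by
  classical
  refine ⟨fun α => if α = β then r else fun _ => 0, fun α _ => ?_, fun p hp => ?_⟩
  · dsimp only
    split_ifs
    · exact hr
    · exact B.isSection_zero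
  · rw [h p hp, Finset.sum_eq_single_of_mem β hβ fun α _ hα => by simp [hα]]
    simp

theorem IsBigO.add (hu : B.IsBigO s S e u) (hv : B.IsBigO s S e v) :
    B.IsBigO s S e (fun p => u p + v p) := by
  obtain ⟨r, hr, hur⟩ := hu
  obtain ⟨t, ht, hvt⟩ := hv
  refine ⟨fun α p => r α p + t α p, fun α hα => (hr α hα).add (ht α hα), fun p hp => ?_⟩
  simp only [hur p hp, hvt p hp, smul_add, Finset.sum_add_distrib]

theorem IsBigO.sum {ι : Type*} (A : Finset ι) {u : ι → TensorField d M k}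
    (h : ∀ i ∈ A, B.IsBigO s S e (u i)) : B.IsBigO s S e (fun p => ∑ i ∈ A, u i p) := by
  classical
  induction A using Finset.induction_on with
  | empty =>
    exact ⟨fun _ _ => 0, fun _ _ => B.isSection_zero, fun p _ => by simp⟩
  | insert i A hi ih =>
    simp only [Finset.sum_insert hi]
    exact (h i (by simp)).add (ih fun j hj => h j (by simp [hj]))

theorem IsBigO.congr (hu : B.IsBigO s S e u) (h : ∀ p, 0 < s p → v p = u p) :
    B.IsBigO s S e v := by
  obtain ⟨r, hr, hur⟩ := hu
  exact ⟨r, hr, fun p hp => (h p hp).trans (hur p hp)⟩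

end TractorBundle

end BigO

/-! ### Truncated expansions, indicial roots and uniqueness. -/

section Truncations

variable {d : ℕ} {M : Type*} [TopologicalSpace M] [ChartedSpace (EuclideanSpace ℝ (Fin d)) M]
  {k : ℕ} {f : ℕ → TensorField d M k} {s : M → ℝ} {p : M}

/-- The polynomial `f_0 + s f_1 + ⋯ + s^N f_N`. -/
def polySum (s : M → ℝ) (f : ℕ → TensorField d M k) (N : ℕ) : TensorField d M k := fun p =>
  ∑ i ∈ Finset.range (N + 1), (s p : ℂ) ^ i • f i p

/-- Separates the complex power, used only where `s > 0`, from a factor that is polynomial in `s`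
and therefore smooth across the zero locus. -/
theorem partialSum_eq (hp : 0 < s p) (α : ℂ) (N : ℕ) :
    partialSum s α f N p = (s p : ℂ) ^ α • polySum s f N p := by
  have : (s p : ℂ) ≠ 0 := by exact_mod_cast hp.ne'
  simp only [partialSum, polySum, Finset.smul_sum, smul_smul, Complex.cpow_add _ _ this,
    Complex.cpow_natCast]

theorem polySum_of_eq_zero (hp : s p = 0) (N : ℕ) : polySum s f N p = f 0 p := by
  simp [polySum, hp, Finset.sum_range_succ', pow_succ]

end Truncations

section Truncations

variable {d : ℕ} {M : Type*} [TopologicalSpace M] [ChartedSpace (EuclideanSpace ℝ (Fin d)) M]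
  [IsManifold (𝓡 d) ∞ M] {g : PseudoMetric d M} {p : M} {k : ℕ} {B : TractorBundle g k}
variable {f f' : ℕ → TensorField d M k} {s : M → ℝ} {w α : ℂ}

theorem isSection_polySum (hs : ∀ p, SmoothFunNear d s p) (hf : ∀ i, B.IsSection (f i)) (N : ℕ) :
    B.IsSection (polySum s f N) :=
  .sum _ fun i _ => (hf i).pow_smul hs i

/-- Truncations of the same expansion differ by terms of higher order. -/
theorem exists_polySum_sub (hs : ∀ p, SmoothFunNear d s p) (hf : ∀ i, B.IsSection (f i)) {N N' : ℕ}
    (h : N ≤ N') : ∃ r, B.IsSection r ∧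
      ∀ p, polySum s f N' p - polySum s f N p = (s p : ℂ) ^ (N + 1) • r p := by
  induction N', h using Nat.le_induction with
  | base => exact ⟨_, B.isSection_zero, by simp⟩
  | succ n hn ih =>
    obtain ⟨r, hr, h⟩ := ih
    refine ⟨fun p => r p + (s p : ℂ) ^ (n - N) • f (n + 1) p,
      hr.add ((hf _).pow_smul hs _), fun p => ?_⟩
    have e1 : polySum s f (n + 1) p = polySum s f n p + (s p : ℂ) ^ (n + 1) • f (n + 1) p :=
      Finset.sum_range_succ _ _
    rw [e1, smul_add, ← h p, smul_smul, ← pow_add, show N + 1 + (n - N) = n + 1 by omega]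
    abel

theorem iDotD_partialSum (hd : d ≠ 0) (hs : ∀ p, SmoothFunNear d s p)
    (hf : ∀ i, B.IsSection (f i)) (hp : 0 < s p) (w α : ℂ) (N : ℕ) :
    iDotD g s w (partialSum s α f N) p =
      (s p : ℂ) ^ (α - 1) • indicial g s w α (polySum s f N) p := by
  have hsm := ((isSection_polySum hs hf N).near p).smooth
  rw [← iDotD_cpow_smul_eq hd (hs p) hp hsm]
  refine (iDotD_congr g (hs p) (hsm.smul (smoothFunNear_cpow (hs p) hp α)) ?_).symm
  filter_upwards [eventually_pos (hs p) hp] with q hq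
  exact (partialSum_eq hq α N).symm

/-- Cancelling `s^(α-1)` turns an error `O(s^(α+ℓ))` for `I·D` into divisibility by `s^(ℓ+1)` for
the indicial operator. -/
theorem TractorBundle.SolvesToOrder.exists_indicial (hd : d ≠ 0) (hs : ∀ p, SmoothFunNear d s p)
    {ℓ : ℕ} (h : B.SolvesToOrder s w α f ℓ) : ∃ r, B.IsSection r ∧
      ∀ p, 0 < s p → indicial g s w α (polySum s f ℓ) p = (s p : ℂ) ^ (ℓ + 1) • r p := by
  obtain ⟨hf, r, hr, h⟩ := h
  refine ⟨r α, hr α (by simp), fun p hp => ?_⟩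
  have hp0 : (s p : ℂ) ≠ 0 := by exact_mod_cast hp.ne'
  have h1 := h p hp
  rw [iDotD_partialSum hd hs hf hp, Finset.sum_singleton,
    show α + ℓ = (α - 1) + (ℓ + 1 : ℕ) by push_cast; ring, Complex.cpow_add _ _ hp0,
    Complex.cpow_natCast, mul_smul] at h1
  exact smul_right_injective _ (by simp [Complex.cpow_eq_zero_iff, hp0]) h1

/-- Only the roots of the indicial polynomial are exponents of solutions. -/
theorem TractorBundle.SolvesToOrder.indicial_root (hd : d ≠ 0) (hs : ∀ p, SmoothFunNear d s p)
    (hI : ∀ p, scaleTractorSq g s p ≠ 0) {ℓ : ℕ} (h : B.SolvesToOrder s w α f ℓ)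
    (hp : s p = 0) (hfp : f 0 p ≠ 0) : α * (d + 2 * w - 1 - α) = 0 := by
  obtain ⟨r, hr, hind⟩ := h.exists_indicial hd hs
  have h1 := (((isSection_polySum hs h.1 ℓ).indicial (w := w) (β := α) hs).sub
    (hr.pow_smul hs (ℓ + 1))).eq_zero_of_pos hs hI (fun q hq => sub_eq_zero.2 (hind q hq)) hp
  rw [indicial_of_eq_zero hp, polySum_of_eq_zero hp, hp] at h1
  simp only [Complex.ofReal_zero, zero_pow (Nat.succ_ne_zero _), zero_smul, sub_zero] at h1
  refine (mul_eq_zero.1 ((smul_eq_zero.1 h1).resolve_right hfp)).resolve_right ?_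
  exact_mod_cast hI p

/-- An infinite order solution is determined by its leading coefficient along the zero locus, if
there are no later indicial roots. -/
theorem TractorBundle.formalEq_of_isInfiniteOrderSolution (hd : d ≠ 0)
    (hs : ∀ p, SmoothFunNear d s p) (hI : ∀ p, scaleTractorSq g s p ≠ 0)
    {f₀ f₀' : TensorField d M k} (h : B.IsInfiniteOrderSolution s w α f₀ f)
    (h' : B.IsInfiniteOrderSolution s w α f₀' f') (h0 : ∀ p, s p = 0 → f₀ p = f₀' p)
    (hα : ∀ i : ℕ, (α + (i + 1)) * (d + 2 * w - 1 - (α + (i + 1))) ≠ 0) :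
    B.FormalEq s {α} (partialSum s α f) (partialSum s α f') := by
  intro N
  obtain ⟨r, hr, hind⟩ := (h.2 N).exists_indicial hd hs
  obtain ⟨r', hr', hind'⟩ := (h'.2 N).exists_indicial hd hs
  have hf := isSection_polySum hs (h.2 0).1 N
  have hf' := isSection_polySum hs (h'.2 0).1 N
  obtain ⟨φ, hφ, hfφ⟩ := (hf.sub hf').exists_eq_pow_succ_smul hd hs hI (hr.sub hr')
    (w := w) (β := α) (N := N)
    (fun p hp => by
      rw [polySum_of_eq_zero hp, polySum_of_eq_zero hp, h.1, h'.1, h0 p hp, sub_self])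
    (fun p hp => by
      rw [indicial_sub (hs p) (hf.near p).smooth (hf'.near p).smooth, hind p hp, hind' p hp,
        smul_sub]) hα
  refine .of_eq (Finset.mem_singleton_self α) hφ fun p hp => ?_
  have hp0 : (s p : ℂ) ≠ 0 := by exact_mod_cast hp.ne'
  rw [Pi.sub_apply, partialSum_eq hp, partialSum_eq hp, ← smul_sub, hfφ, smul_smul,
    Complex.cpow_add _ _ hp0, Complex.cpow_natCast]

/-- After telescoping, the error at order `ℓ` is exactly `s^(β+ℓ)` times a smooth section. The
hypotheses say that `β` is a root and that the later values of the indicial polynomial match the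
recursion of `K^h`. -/
theorem TractorBundle.IsSection.isInfiniteOrderSolution_normalOrdered (hd : d ≠ 0)
    (hs : ∀ p, SmoothFunNear d s p) (hI : ∀ p, scaleTractorSq g s p ≠ 0) {f : TensorField d M k}
    (hf : B.IsSection f) {w β h : ℂ} (hβ : β * (d + 2 * w - β - 1) = 0)
    (hrec : ∀ m : ℕ, (β + (m + 1)) * (d + 2 * w - (β + (m + 1)) - 1) = (m + 1) * (h - 2 - m))
    (hh : ∀ m : ℕ, (m : ℂ) + 2 - h ≠ 0) :
    B.IsInfiniteOrderSolution s w β f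
      (BoundaryCalculus.normalOrdered g s (w - β) (besselK h) f) := by
  refine ⟨?_, fun ℓ => ⟨fun i => hf.normalOrdered hs hI _ i, .of_eq (Finset.mem_singleton_self β)
    ((hf.normalOrdered hs hI _ ℓ).iDotD hs) fun p hp =>
      iDotD_partialSum_normalOrdered hd hs hI hp hf hβ hrec hh ℓ⟩⟩
  funext p
  simp [BoundaryCalculus.normalOrdered, besselK, BoundaryCalculus.yPow]

end Truncations

/-! ### Independence of powers of `s` in distinct classes modulo `ℤ`. -/

section Independence

variable {d : ℕ} {M : Type*} [TopologicalSpace M] [ChartedSpace (EuclideanSpace ℝ (Fin d)) M]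
  {p : M} {s : M → ℝ} {X : VField d M}

/-- `∑ s^γ u_γ = 0` on the positive side of the zero locus of `s`, near `p`. -/
def PowerRelation (s : M → ℝ) (A : Finset ℂ) (u : ℂ → M → ℂ) (p : M) : Prop :=
  ∀ᶠ q in 𝓝 p, 0 < s q → ∑ γ ∈ A, (s q : ℂ) ^ γ * u γ q = 0

/-- The coefficients of `(s X - c) ∑ s^γ u_γ`, where `X s = 1`. -/
def eulerCoeff (s : M → ℝ) (X : VField d M) (c γ : ℂ) (u : M → ℂ) : M → ℂ := fun q =>
  (γ - c) * u q + s q * dirDeriv u q (X q)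

/-- The relation holds near each point with `s > 0` close to `p`, so it may be differentiated along
`X`; as `X s = 1`, the operator `s X` multiplies `s^γ` by `γ`. -/
theorem PowerRelation.eulerCoeff (hs : SmoothFunNear d s p)
    (hXs : ∀ᶠ q in 𝓝 p, dirDeriv s q (X q) = 1) {A : Finset ℂ} {u : ℂ → M → ℂ}
    (hu : ∀ γ ∈ A, SmoothFunNear d (u γ) p) (h : PowerRelation s A u p) (c : ℂ) :
    PowerRelation s A (fun γ => eulerCoeff s X c γ (u γ)) p := by
  have hu' := (Filter.eventually_all_finset A).2 fun γ hγ => (hu γ hγ).eventually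
  filter_upwards [hs.eventually, hu', hXs, h, eventually_eventually_nhds.2 h] with q hsq huq hX h0 h1 hq
  have hq0 : (s q : ℂ) ≠ 0 := by exact_mod_cast hq.ne'
  have h2 : dirDeriv (fun r => ∑ γ ∈ A, (s r : ℂ) ^ γ * u γ r) q (X q) = 0 := by
    rw [dirDeriv_congr (v := fun _ => 0), dirDeriv_const]
    filter_upwards [h1, eventually_pos hsq hq] with r hr hr' using hr hr'
  rw [dirDeriv_sum A fun γ hγ => (smoothFunNear_cpow hsq hq γ).mul (huq γ hγ)] at h2
  have h3 : ∀ γ ∈ A, (s q : ℂ) ^ γ * BoundaryCalculus.eulerCoeff s X c γ (u γ) q =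
      s q * dirDeriv (fun r => (s r : ℂ) ^ γ * u γ r) q (X q) - c * ((s q : ℂ) ^ γ * u γ q) := by
    intro γ hγ
    have h4 : (s q : ℂ) ^ γ = (s q : ℂ) ^ (γ - 1) * s q := by
      rw [Complex.cpow_sub _ _ hq0, Complex.cpow_one]
      field_simp
    rw [dirDeriv_mul (smoothFunNear_cpow hsq hq γ) (huq γ hγ), dirDeriv_cpow hsq hq, hX,
      BoundaryCalculus.eulerCoeff, h4]
    push_cast
    ring
  rw [Finset.sum_congr rfl h3, Finset.sum_sub_distrib, ← Finset.mul_sum, ← Finset.mul_sum, h2, h0 hq]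
  ring

/-- `u` is divisible by `s^n` near `p`. -/
def PowDvdNear (d : ℕ) {M : Type*} [TopologicalSpace M] [ChartedSpace (EuclideanSpace ℝ (Fin d)) M]
    (s : M → ℝ) (n : ℕ) (u : M → ℂ) (p : M) : Prop :=
  ∃ v : M → ℂ, SmoothFunNear d v p ∧ ∀ᶠ q in 𝓝 p, u q = (s q : ℂ) ^ n * v q

variable [IsManifold (𝓡 d) ∞ M]

theorem eulerCoeff_smooth (hs : SmoothFunNear d s p) (hX : SmoothVFieldNear X p) {c γ : ℂ}
    {u : M → ℂ} (hu : SmoothFunNear d u p) : SmoothFunNear d (eulerCoeff s X c γ u) p :=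
  ((SmoothFunNear.const _).mul hu).add (hs.ofReal.mul (hX.dirDeriv hu))

/-- On `s^n v` the operator gives `s^n ((γ+n-c) v + s X v)`: divisibility is preserved for every `c`
and improves by one for `c = γ + n`. -/
theorem PowDvdNear.eulerCoeff (hs : SmoothFunNear d s p) (hX : SmoothVFieldNear X p)
    (hXs : ∀ᶠ q in 𝓝 p, dirDeriv s q (X q) = 1) {n : ℕ} {u : M → ℂ} (h : PowDvdNear d s n u p)
    (c γ : ℂ) : ∃ v v' : M → ℂ, SmoothFunNear d v p ∧ SmoothFunNear d v' p ∧
      ∀ᶠ q in 𝓝 p, BoundaryCalculus.eulerCoeff s X c γ u q =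
        (s q : ℂ) ^ n * ((γ + n - c) * v q + s q * v' q) := by
  obtain ⟨v, hv, huv⟩ := h
  refine ⟨v, _, hv, hX.dirDeriv hv, ?_⟩
  have hpow : ∀ᶠ q in 𝓝 p, ∀ m : ℕ, (s q : ℂ) * dirDeriv (fun r => (s r : ℂ) ^ m) q (X q) =
      m * (s q : ℂ) ^ m := by
    filter_upwards [hs.eventually, hXs] with q hsq hX m
    induction m with
    | zero => simp [dirDeriv_const]
    | succ m ih =>
      simp only [pow_succ]
      rw [dirDeriv_mul (smoothFunNear_pow hsq m) hsq.ofReal, dirDeriv_ofReal hsq, hX, mul_add,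
        mul_left_comm, ← mul_assoc _ _ (s q : ℂ), ih]
      push_cast
      ring
  filter_upwards [hs.eventually, hv.eventually, huv.eventually_nhds, hpow] with q hsq hvq huvq hp
  rw [BoundaryCalculus.eulerCoeff, huvq.self_of_nhds, dirDeriv_congr huvq,
    dirDeriv_mul (smoothFunNear_pow hsq n) hvq]
  linear_combination v q * hp n

theorem PowDvdNear.eulerCoeff_same (hs : SmoothFunNear d s p) (hX : SmoothVFieldNear X p)
    (hXs : ∀ᶠ q in 𝓝 p, dirDeriv s q (X q) = 1) {n : ℕ} {u : M → ℂ} (h : PowDvdNear d s n u p)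
    (c γ : ℂ) : PowDvdNear d s n (BoundaryCalculus.eulerCoeff s X c γ u) p := by
  obtain ⟨v, v', hv, hv', h⟩ := h.eulerCoeff hs hX hXs c γ
  exact ⟨_, ((SmoothFunNear.const _).mul hv).add (hs.ofReal.mul hv'), h⟩

theorem PowDvdNear.eulerCoeff_succ (hs : SmoothFunNear d s p) (hX : SmoothVFieldNear X p)
    (hXs : ∀ᶠ q in 𝓝 p, dirDeriv s q (X q) = 1) {n : ℕ} {u : M → ℂ} {γ : ℂ}
    (h : PowDvdNear d s n u p) :
    PowDvdNear d s (n + 1) (BoundaryCalculus.eulerCoeff s X (γ + n) γ u) p := by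
  obtain ⟨v, v', hv, hv', h⟩ := h.eulerCoeff hs hX hXs (γ + n) γ
  refine ⟨v', hv', h.mono fun q hq => ?_⟩
  rw [hq]
  ring

/-- Given a relation between powers in distinct classes modulo `ℤ`, all the classes but one can be
made to vanish to high order, keeping the leading coefficient of the remaining one. -/
theorem PowerRelation.exists_reduced (hs : SmoothFunNear d s p) (hp : s p = 0)
    (hX : SmoothVFieldNear X p) (hXs : ∀ᶠ q in 𝓝 p, dirDeriv s q (X q) = 1) {A : Finset ℂ}
    {u : ℂ → M → ℂ} (hu : ∀ γ ∈ A, SmoothFunNear d (u γ) p) (h : PowerRelation s A u p) {α : ℂ}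
    (N : ℕ) (A' : Finset ℂ) (hA' : ∀ β ∈ A', ∀ n : ℕ, α ≠ β + n) :
    ∃ v : ℂ → M → ℂ, (∀ γ ∈ A, SmoothFunNear d (v γ) p) ∧ PowerRelation s A v p ∧
      (v α p = 0 → u α p = 0) ∧ ∀ β ∈ A', β ∈ A → PowDvdNear d s N (v β) p := by
  classical
  induction A' using Finset.induction_on with
  | empty => exact ⟨u, hu, h, id, by simp⟩
  | insert β A' hβ ih =>
    obtain ⟨v, hv, hrel, hαv, hdvd⟩ := ih fun β hβ => hA' β (by simp [hβ])
    have key : ∀ n : ℕ, ∃ v : ℂ → M → ℂ, (∀ γ ∈ A, SmoothFunNear d (v γ) p) ∧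
        PowerRelation s A v p ∧ (v α p = 0 → u α p = 0) ∧
        (∀ β ∈ A', β ∈ A → PowDvdNear d s N (v β) p) ∧ (β ∈ A → PowDvdNear d s n (v β) p) := by
      intro n
      induction n with
      | zero => exact ⟨v, hv, hrel, hαv, hdvd, fun hβA => ⟨v β, hv β hβA, by simp⟩⟩
      | succ n ih =>
        obtain ⟨v, hv, hrel, hαv, hdvd, hβv⟩ := ih
        -- With `c = β + n` the class of `β` gains one order, while the value at `p` of the
        -- coefficient of `s^α` is multiplied by `α - β - n`, nonzero by hypothesis.
        refine ⟨fun γ => BoundaryCalculus.eulerCoeff s X (β + n) γ (v γ),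
          fun γ hγ => eulerCoeff_smooth hs hX (hv γ hγ), hrel.eulerCoeff hs hXs hv _, fun h0 => hαv ?_,
          fun γ hγ hγA => (hdvd γ hγ hγA).eulerCoeff_same hs hX hXs _ _,
          fun hβA => (hβv hβA).eulerCoeff_succ hs hX hXs⟩
        simp only [BoundaryCalculus.eulerCoeff, hp, Complex.ofReal_zero, zero_mul, add_zero] at h0
        exact (mul_eq_zero.1 h0).resolve_left (sub_ne_zero.2 (hA' β (by simp) n))
    obtain ⟨v, hv, hrel, hαv, hdvd, hβv⟩ := key N
    refine ⟨v, hv, hrel, hαv, fun γ hγ => ?_⟩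
    rcases Finset.mem_insert.1 hγ with rfl | hγ
    · exact hβv
    · exact hdvd γ hγ

/-- Powers with exponents in distinct classes modulo `ℤ` are independent over the germs of smooth
functions, to leading order. -/
theorem PowerRelation.eq_zero (hs : SmoothFunNear d s p) (hp : s p = 0) {Y : VField d M}
    (hY : SmoothVFieldNear Y p) (hYs : dirDeriv s p (Y p) ≠ 0) {A : Finset ℂ}
    {u : ℂ → M → ℂ} (hu : ∀ γ ∈ A, SmoothFunNear d (u γ) p) (h : PowerRelation s A u p) {α : ℂ}
    (hα : α ∈ A) (hA : ∀ β ∈ A, β ≠ α → ∀ n : ℕ, α ≠ β + n) : u α p = 0 := by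
  classical
  have hYs' := hY.dirDeriv hs
  have hinv := hYs'.inv hYs
  have hXs : ∀ᶠ q in 𝓝 p, dirDeriv s q ((dirDeriv s q (Y q))⁻¹ • Y q) = 1 := by
    filter_upwards [hYs'.contMDiffAt.continuousAt.eventually_ne hYs] with q hq
    rw [dirDeriv_smul_right, smul_eq_mul, inv_mul_cancel₀ hq]
  -- `N` is large enough that, after reduction and division by `s^α`, all terms but the one of
  -- exponent `α` carry a power of `s` with positive real part and tend to zero.
  obtain ⟨N, hN⟩ : ∃ N : ℕ, ∀ β ∈ A, 0 < (β - α + N).re := by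
    obtain ⟨N, hN⟩ := exists_nat_gt (∑ β ∈ A, |(α - β).re|)
    refine ⟨N, fun β hβ => ?_⟩
    have h1 := Finset.single_le_sum (f := fun β => |(α - β).re|) (fun _ _ => abs_nonneg _) hβ
    have h2 := (le_abs_self (α - β).re).trans (h1.trans hN.le)
    have h3 := (le_abs_self (α - β).re).trans_lt (h1.trans_lt hN)
    simp only [Complex.sub_re, Complex.add_re, Complex.natCast_re] at h3 ⊢
    linarith
  obtain ⟨v, hv, hrel, hαv, hdvd⟩ := h.exists_reduced hs hp (hY.smul hinv) hXs hu N (A.erase α)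
    fun β hβ => hA β (Finset.mem_of_mem_erase hβ) (Finset.ne_of_mem_erase hβ)
  refine hαv ?_
  have hfreq := frequently_pos hs hp hYs
  have hdvd' : ∀ β, ∃ v' : M → ℂ, β ∈ A.erase α →
      SmoothFunNear d v' p ∧ ∀ᶠ q in 𝓝 p, v β q = (s q : ℂ) ^ N * v' q := fun β => by
    by_cases hβ : β ∈ A.erase α
    · obtain ⟨v', h⟩ := hdvd β hβ (Finset.mem_of_mem_erase hβ)
      exact ⟨v', fun _ => h⟩
    · exact ⟨0, fun h => absurd h hβ⟩
  choose v' hv' using hdvd'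
  have hs0 : Filter.Tendsto s (𝓝 p) (𝓝 0) := hp ▸ hs.contMDiffAt.continuousAt
  have hlim : Filter.Tendsto (fun q => v α q + ∑ β ∈ A.erase α, (s q : ℂ) ^ (β - α + N) * v' β q)
      (𝓝 p) (𝓝 (v α p + ∑ β ∈ A.erase α, 0)) := by
    refine (hv α hα).contMDiffAt.continuousAt.tendsto.add (tendsto_finsetSum _ fun β hβ => ?_)
    have h1 := ((Complex.continuous_ofReal_cpow_const
      (hN β (Finset.mem_of_mem_erase hβ))).tendsto 0).comp hs0
    have hne : β - α + N ≠ 0 := fun h0 => by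
      have := hN β (Finset.mem_of_mem_erase hβ)
      simp [h0] at this
    rw [Complex.ofReal_zero, Complex.zero_cpow hne] at h1
    simpa using h1.mul (hv' β hβ).1.contMDiffAt.continuousAt.tendsto
  -- The relation is available only for `s > 0`; as such points accumulate at `p`, the limit of the
  -- sum is nevertheless forced to be zero.
  have hzero : ∃ᶠ q in 𝓝 p, v α q + ∑ β ∈ A.erase α, (s q : ℂ) ^ (β - α + N) * v' β q = 0 := by
    have hall := (Filter.eventually_all_finset (A.erase α)).2 fun β hβ => (hv' β hβ).2
    refine ((hfreq.and_eventually hrel).and_eventually hall).mono fun q ⟨⟨hq, h1⟩, h2⟩ => ?_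
    have hq0 : (s q : ℂ) ≠ 0 := by exact_mod_cast hq.ne'
    have h3 := h1 hq
    rw [← Finset.add_sum_erase _ _ hα] at h3
    have h4 : (s q : ℂ) ^ α * (v α q + ∑ β ∈ A.erase α, (s q : ℂ) ^ (β - α + N) * v' β q) = 0 := by
      rw [← h3, mul_add, Finset.mul_sum]
      congr 1
      refine Finset.sum_congr rfl fun β hβ => ?_
      rw [h2 β hβ, ← mul_assoc, ← mul_assoc, ← Complex.cpow_add _ _ hq0, ← Complex.cpow_natCast,
        ← Complex.cpow_add _ _ hq0]
      congr 2
      ring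
    exact (mul_eq_zero.1 h4).resolve_left (by simp [Complex.cpow_eq_zero_iff, hq0])
  by_contra hne
  have h5 := hlim.eventually_ne (b₂ := (0 : ℂ)) (by simpa using hne)
  obtain ⟨q, h6, h7⟩ := (hzero.and_eventually h5).exists
  exact h7 h6

end Independence

/-! ### Independence for sections, to all orders. -/

section TensorIndependence

variable {d : ℕ} {M : Type*} [TopologicalSpace M] [ChartedSpace (EuclideanSpace ℝ (Fin d)) M]
  [IsManifold (𝓡 d) ∞ M] {g : PseudoMetric d M} {p : M} {k : ℕ} {B : TractorBundle g k}
  {s : M → ℝ} {A : Finset ℂ}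

theorem eq_zero_of_sum_cpow_smul (hs : ∀ p, SmoothFunNear d s p)
    (hI : ∀ p, scaleTractorSq g s p ≠ 0) {φ : ℂ → TensorField d M k}
    (hφ : ∀ γ ∈ A, B.IsSection (φ γ))
    (h : ∀ q, 0 < s q → ∑ γ ∈ A, (s q : ℂ) ^ γ • φ γ q = 0) {α : ℂ} (hα : α ∈ A)
    (hA : ∀ β ∈ A, β ≠ α → ∀ n : ℕ, α ≠ β + n) (hp : s p = 0) : φ α p = 0 := by
  refine MultilinearMap.ext fun v => ?_
  have hu : ∀ γ ∈ A, SmoothFunNear d (fun q => φ γ q fun i => tractorExtend (v i) q) p := fun γ hγ =>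
    (((hφ γ hγ).near p).smooth).eval (T := fun i => tractorExtend (v i))
      fun i => smoothTractorNear_tractorExtend (v i)
  have := PowerRelation.eq_zero (Y := grad g s) (hs p) hp (grad_smooth g (hs p))
    (by rw [dirDeriv_grad_of_eq_zero hp]; exact hI p)
    (u := fun γ q => φ γ q fun i => tractorExtend (v i) q) hu (.of_forall fun q hq => by
      have := congrArg (fun F => F fun i => tractorExtend (v i) q) (h q hq)
      simpa using this) hα hA
  simpa using this

/-- Powers in distinct classes modulo `ℤ` are formally independent. -/
theorem exists_eq_pow_smul_of_sum_cpow_smul (hs : ∀ p, SmoothFunNear d s p)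
    (hI : ∀ p, scaleTractorSq g s p ≠ 0) {φ : ℂ → TensorField d M k}
    (hφ : ∀ γ ∈ A, B.IsSection (φ γ))
    (h : ∀ q, 0 < s q → ∑ γ ∈ A, (s q : ℂ) ^ γ • φ γ q = 0)
    (hA : ∀ α ∈ A, ∀ β ∈ A, β ≠ α → ∀ n : ℕ, α ≠ β + n) (N : ℕ) :
    ∃ ψ : ℂ → TensorField d M k, (∀ γ ∈ A, B.IsSection (ψ γ)) ∧
      (∀ γ ∈ A, ∀ q, φ γ q = (s q : ℂ) ^ N • ψ γ q) ∧
      ∀ q, 0 < s q → ∑ γ ∈ A, (s q : ℂ) ^ γ • ψ γ q = 0 := by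
  induction N with
  | zero => exact ⟨φ, hφ, by simp, h⟩
  | succ N ih =>
    obtain ⟨ψ, hψ, hφψ, hsum⟩ := ih
    -- Every leading coefficient vanishes on the zero locus, so all can be divided by `s`
    -- simultaneously, and the relation survives the division.
    have h0 : ∀ γ ∈ A, ∀ q, s q = 0 → ψ γ q = 0 := fun γ hγ q hq =>
      eq_zero_of_sum_cpow_smul hs hI hψ hsum hγ (hA γ hγ) hq
    refine ⟨fun γ => quotientField g s (ψ γ), fun γ hγ => (hψ γ hγ).quotientField hs hI (h0 γ hγ),
      fun γ hγ q => ?_, fun q hq => ?_⟩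
    · rw [pow_succ, mul_smul, smul_quotientField (h0 γ hγ), hφψ γ hγ]
    · have hq0 : (s q : ℂ) ≠ 0 := by exact_mod_cast hq.ne'
      refine smul_right_injective _ hq0 ?_
      simp only [smul_zero, Finset.smul_sum]
      rw [← hsum q hq]
      exact Finset.sum_congr rfl fun γ hγ => by
        rw [smul_comm, smul_quotientField (h0 γ hγ)]

end TensorIndependence

/-! ### Representatives of exponents modulo `ℤ`. -/

section ExponentClasses

/-- A representative of the class of `β` modulo `ℤ`, bounded in terms of `K`. -/
def classRep (K : ℕ) (β : ℂ) : ℂ := β - (⌊β.re⌋ + K : ℤ)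

/-- The distance of `β` from the representative of its class. -/
def classShift (K : ℕ) (β : ℂ) : ℕ := (⌊β.re⌋ + K).toNat

theorem classRep_add_classShift {K : ℕ} {β : ℂ} (h : |β.re| ≤ K) :
    classRep K β + classShift K β = β := by
  have h1 : (0 : ℤ) ≤ ⌊β.re⌋ + K := by
    have : (-K : ℤ) ≤ ⌊β.re⌋ := Int.le_floor.2 (by push_cast; exact (abs_le.1 h).1)
    omega
  have h2 : ((classShift K β : ℕ) : ℂ) = ((⌊β.re⌋ + K : ℤ) : ℂ) := by
    rw [← Int.cast_natCast, classShift, Int.toNat_of_nonneg h1]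
  rw [h2, classRep, sub_add_cancel]

/-- The real parts of all representatives lie in one half-open interval of length one, so they
cannot differ by a nonzero integer. -/
theorem classRep_eq_of_add_eq {K : ℕ} {β β' : ℂ} {m m' : ℕ}
    (h : classRep K β + m = classRep K β' + m') : m = m' := by
  have h1 := congrArg Complex.re h
  simp only [classRep, Complex.add_re, Complex.sub_re, Complex.intCast_re, Complex.natCast_re,
    Int.cast_add, Int.cast_natCast] at h1
  have h2 : Int.fract β.re + m = Int.fract β'.re + m' := by
    simp only [Int.fract]; linarith
  have h3 := Int.fract_nonneg β.re
  have h4 := Int.fract_lt_one β.re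
  have h5 := Int.fract_nonneg β'.re
  have h6 := Int.fract_lt_one β'.re
  have h7 : (m : ℝ) < m' + 1 := by linarith
  have h8 : (m' : ℝ) < m + 1 := by linarith
  have h9 : m < m' + 1 := by exact_mod_cast h7
  have h10 : m' < m + 1 := by exact_mod_cast h8
  omega

end ExponentClasses

/-! ### Grouping an expansion by exponent classes. -/

section ClassSums

variable {d : ℕ} {M : Type*} [TopologicalSpace M] [ChartedSpace (EuclideanSpace ℝ (Fin d)) M]
  {p : M} {k : ℕ} {s : M → ℝ} {S R : Finset ℂ} {c : ℂ → ℕ → TensorField d M k} {ρ : ℂ → ℂ}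
  {n : ℂ → ℕ}

/-- The part of the truncated expansion `∑_{β ∈ S} s^β (c_{β,0} + s c_{β,1} + ⋯)` with exponents in
the class `α`, divided by `s^α`. -/
def classSum (s : M → ℝ) (S : Finset ℂ) (ρ : ℂ → ℂ) (n : ℂ → ℕ) (c : ℂ → ℕ → TensorField d M k)
    (α : ℂ) (N : ℕ) : TensorField d M k := fun p =>
  ∑ β ∈ S with ρ β = α, (s p : ℂ) ^ n β • polySum s (c β) N p

theorem sum_cpow_smul_eq_sum_classes (hρR : ∀ β ∈ S, ρ β ∈ R) (hρ : ∀ β ∈ S, ρ β + n β = β)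
    (hp : 0 < s p) (a : ℂ → TensorFibre d k p) :
    ∑ β ∈ S, (s p : ℂ) ^ β • a β =
      ∑ α ∈ R, (s p : ℂ) ^ α • ∑ β ∈ S with ρ β = α, (s p : ℂ) ^ n β • a β := by
  have hp0 : (s p : ℂ) ≠ 0 := by exact_mod_cast hp.ne'
  rw [← Finset.sum_fiberwise_of_maps_to hρR]
  refine Finset.sum_congr rfl fun α _ => ?_
  rw [Finset.smul_sum]
  refine Finset.sum_congr rfl fun β hβ => ?_
  obtain ⟨hβS, rfl⟩ := Finset.mem_filter.1 hβ
  rw [smul_smul, ← Complex.cpow_natCast, ← Complex.cpow_add _ _ hp0, hρ β hβS]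

theorem sum_partialSum_eq (hρR : ∀ β ∈ S, ρ β ∈ R) (hρ : ∀ β ∈ S, ρ β + n β = β)
    (hp : 0 < s p) (N : ℕ) :
    (∑ β ∈ S, partialSum s β (c β) N) p =
      ∑ α ∈ R, (s p : ℂ) ^ α • classSum s S ρ n c α N p := by
  rw [Finset.sum_apply, Finset.sum_congr rfl fun β _ => partialSum_eq hp β N,
    sum_cpow_smul_eq_sum_classes hρR hρ hp]
  rfl

end ClassSums

/-! ### Formal solutions for non-integral `h₀`. -/

section FormalSolutions

variable {d : ℕ} {M : Type*} [TopologicalSpace M] [ChartedSpace (EuclideanSpace ℝ (Fin d)) M]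
  [IsManifold (𝓡 d) ∞ M] {g : PseudoMetric d M} {p : M} {k : ℕ} {B : TractorBundle g k}
  {s : M → ℝ} {S R : Finset ℂ} {c : ℂ → ℕ → TensorField d M k} {w : ℂ} {ρ : ℂ → ℂ} {n : ℂ → ℕ}

theorem isSection_classSum (hs : ∀ p, SmoothFunNear d s p)
    (hc : ∀ β ∈ S, ∀ i, B.IsSection (c β i)) (α : ℂ) (N : ℕ) :
    B.IsSection (classSum s S ρ n c α N) :=
  .sum _ fun β hβ => (isSection_polySum hs (hc β (Finset.mem_filter.1 hβ).1) N).pow_smul hs _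

/-- The exponent classes of a formal solution are separately formal solutions. -/
theorem TractorBundle.IsFormalSolution.exists_indicial (hd : d ≠ 0)
    (hs : ∀ p, SmoothFunNear d s p) (hI : ∀ p, scaleTractorSq g s p ≠ 0)
    (hc : B.IsFormalSolution s w S c) (hρR : ∀ β ∈ S, ρ β ∈ R) (hρ : ∀ β ∈ S, ρ β + n β = β)
    (hR : ∀ α ∈ R, ∀ β ∈ R, β ≠ α → ∀ m : ℕ, α ≠ β + m) (N : ℕ) :
    ∃ r : ℂ → TensorField d M k, ∀ α ∈ R, B.IsSection (r α) ∧ ∀ p, 0 < s p →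
      indicial g s w α (classSum s S ρ n c α N) p = (s p : ℂ) ^ (N + 1) • r α p := by
  obtain ⟨hcs, hN⟩ := hc
  obtain ⟨r, hr, hiD⟩ := hN N
  let t : ℂ → TensorField d M k := fun α p => ∑ β ∈ S with ρ β = α, (s p : ℂ) ^ n β • r β p
  have ht : ∀ α, B.IsSection (t α) := fun α =>
    .sum _ fun β hβ => (hr β (Finset.mem_filter.1 hβ).1).pow_smul hs _
  have hΦ := fun α => isSection_classSum (ρ := ρ) (n := n) hs hcs α N
  -- Only the sum over the classes is assumed to be small. Independence, applied to the defects of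
  -- the classes, makes each of them divisible by `s^(N+1)`.
  obtain ⟨ψ, hψ, hψe, -⟩ := exists_eq_pow_smul_of_sum_cpow_smul (A := R) hs hI
    (φ := fun α p => indicial g s w α (classSum s S ρ n c α N) p - (s p : ℂ) ^ (N + 1) • t α p)
    (fun α _ => ((hΦ α).indicial hs).sub ((ht α).pow_smul hs _)) (fun p hp => by
      have hp0 : (s p : ℂ) ≠ 0 := by exact_mod_cast hp.ne'
      have h1 : iDotD g s w (∑ β ∈ S, partialSum s β (c β) N) p =
          ∑ α ∈ R, (s p : ℂ) ^ (α - 1) • indicial g s w α (classSum s S ρ n c α N) p := by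
        have hsm : ∀ α ∈ R, SmoothTensorNear
            (fun q => (s q : ℂ) ^ α • classSum s S ρ n c α N q) p := fun α _ =>
          ((hΦ α).near p).smooth.smul (smoothFunNear_cpow (hs p) hp α)
        rw [← Finset.sum_congr rfl fun α _ =>
          iDotD_cpow_smul_eq hd (hs p) hp ((hΦ α).near p).smooth w α, ← iDotD_sum (hs p) R hsm]
        refine (iDotD_congr g (hs p) (.sum R hsm) ?_).symm
        filter_upwards [eventually_pos (hs p) hp] with q hq
        exact (sum_partialSum_eq hρR hρ hq N).symm
      have h2 := hiD p hp
      have h3 : ∑ β ∈ S, (s p : ℂ) ^ (β + N) • r β p =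
          (s p : ℂ) ^ N • ∑ α ∈ R, (s p : ℂ) ^ α • t α p := by
        rw [← sum_cpow_smul_eq_sum_classes hρR hρ hp, Finset.smul_sum]
        refine Finset.sum_congr rfl fun β _ => ?_
        rw [Complex.cpow_add _ _ hp0, Complex.cpow_natCast, mul_comm, mul_smul]
      rw [h1, h3] at h2
      have h4 := congrArg (fun x => (s p : ℂ) • x) h2
      simp only [Finset.smul_sum, smul_smul] at h4
      simp only [smul_sub, Finset.sum_sub_distrib, smul_smul]
      rw [sub_eq_zero]
      convert h4 using 3 with α _ α _
      · rw [Complex.cpow_sub _ _ hp0, Complex.cpow_one]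
        field_simp
      · ring) hR (N + 1)
  refine ⟨fun α p => t α p + ψ α p, fun α hα => ⟨(ht α).add (hψ α hα), fun p _ => ?_⟩⟩
  rw [smul_add, ← hψe α hα p]
  abel

theorem exists_classSum_sub (hs : ∀ p, SmoothFunNear d s p)
    (hc : ∀ β ∈ S, ∀ i, B.IsSection (c β i)) (α : ℂ) {N N' : ℕ} (h : N ≤ N') :
    ∃ r, B.IsSection r ∧ ∀ p, classSum s S ρ n c α N' p - classSum s S ρ n c α N p =
      (s p : ℂ) ^ (N + 1) • r p := by
  have h1 : ∀ β, ∃ r, β ∈ S → B.IsSection r ∧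
      ∀ p, polySum s (c β) N' p - polySum s (c β) N p = (s p : ℂ) ^ (N + 1) • r p := fun β => by
    by_cases hβ : β ∈ S
    · obtain ⟨r, hr⟩ := exists_polySum_sub hs (hc β hβ) h
      exact ⟨r, fun _ => hr⟩
    · exact ⟨fun _ => 0, fun h => absurd h hβ⟩
  choose r hr using h1
  refine ⟨fun p => ∑ β ∈ S with ρ β = α, (s p : ℂ) ^ n β • r β p,
    .sum _ fun β hβ => (hr β (Finset.mem_filter.1 hβ).1).1.pow_smul hs _, fun p => ?_⟩
  simp only [classSum]
  rw [← Finset.sum_sub_distrib, Finset.smul_sum]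
  refine Finset.sum_congr rfl fun β hβ => ?_
  rw [← smul_sub, (hr β (Finset.mem_filter.1 hβ).1).2, smul_comm]

/-- A coherent sequence of approximate solutions agrees with the solution starting at the only
indicial root in its class. -/
theorem exists_leading_coefficient (hd : d ≠ 0)
    (hs : ∀ p, SmoothFunNear d s p) (hI : ∀ p, scaleTractorSq g s p ≠ 0)
    {Φ : ℕ → TensorField d M k} {α e : ℂ} {m : ℕ} (he : α + m = e) (hΦ : ∀ N, B.IsSection (Φ N))
    (hcoh : ∀ N, m ≤ N → ∃ r, B.IsSection r ∧ ∀ p, Φ N p - Φ m p = (s p : ℂ) ^ (m + 1) • r p)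
    (hind : ∀ N, ∃ r, B.IsSection r ∧
      ∀ p, 0 < s p → indicial g s w α (Φ N) p = (s p : ℂ) ^ (N + 1) • r p)
    (hlt : ∀ i < m, (α + i) * (d + 2 * w - 1 - (α + i)) ≠ 0)
    (hgt : ∀ i : ℕ, (e + (i + 1)) * (d + 2 * w - 1 - (e + (i + 1))) ≠ 0)
    {F : TensorField d M k → ℕ → TensorField d M k}
    (hF : ∀ f, B.IsSection f → B.IsInfiniteOrderSolution s w e f (F f)) :
    ∃ f, B.IsSection f ∧ ∀ N, m ≤ N → ∃ r, B.IsSection r ∧ ∀ p,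
      Φ N p - (s p : ℂ) ^ m • polySum s (F f) (N - m) p = (s p : ℂ) ^ (N + 1) • r p := by
  choose r hr hind using hind
  -- No root precedes `e = α + m` in the class, so each approximation is divisible by `s^m`; the
  -- quotient lives at exponent `e`.
  have hdiv : ∀ N, ∃ f', m ≤ N → B.IsSection f' ∧ (∀ p, Φ N p = (s p : ℂ) ^ m • f' p) ∧
      ∀ p, 0 < s p → indicial g s w e f' p = (s p : ℂ) ^ (N + 1 - m) • r N p := fun N => by
    by_cases hN : m ≤ N
    · obtain ⟨f', h⟩ := (hΦ N).exists_eq_pow_smul hd hs hI (hr N) (j := m) (by omega) (hind N) hlt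
      exact ⟨f', fun _ => he ▸ h⟩
    · exact ⟨fun _ => 0, fun h => absurd h hN⟩
  choose Ψ hΨ using hdiv
  have hf := (hΨ m le_rfl).1
  refine ⟨Ψ m, hf, fun N hN => ?_⟩
  obtain ⟨hΨN, hΦΨ, hindΨ⟩ := hΨ N hN
  obtain ⟨t, ht, htc⟩ := hcoh N hN
  -- Coherence of the approximations makes the boundary value of the quotient independent of `N`, so
  -- the single section `Ψ m` serves as leading coefficient for all orders.
  have hbd : ∀ p, s p = 0 → Ψ N p = Ψ m p := fun p hp => by
    have h1 := ((hΨN.sub hf).sub (ht.pow_smul hs 1)).eq_zero_of_pos hs hI (fun q hq => by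
      have hq0 : (s q : ℂ) ≠ 0 := by exact_mod_cast hq.ne'
      have h2 := htc q
      rw [hΦΨ, (hΨ m le_rfl).2.1, pow_succ, mul_smul, ← smul_sub] at h2
      rw [pow_one, sub_eq_zero]
      exact smul_right_injective _ (pow_ne_zero m hq0) h2) hp
    simpa [hp, sub_eq_zero] using h1
  obtain ⟨hF0, hFs⟩ := hF _ hf
  obtain ⟨v, hv, hindv⟩ := (hFs (N - m)).exists_indicial hd hs
  have hP := isSection_polySum hs (hFs 0).1 (N - m)
  have hNm : N + 1 - m = N - m + 1 := by omega
  obtain ⟨Δ, hΔ, hΔe⟩ := (hΨN.sub hP).exists_eq_pow_succ_smul hd hs hI ((hr N).sub hv) (w := w)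
    (β := e) (N := N - m) (fun p hp => by rw [polySum_of_eq_zero hp, hF0, hbd p hp, sub_self])
    (fun p hp => by
      rw [indicial_sub (hs p) (hΨN.near p).smooth (hP.near p).smooth, hindv p hp, hindΨ p hp, hNm,
        smul_sub]) hgt
  refine ⟨Δ, hΔ, fun p => ?_⟩
  rw [hΦΨ, ← smul_sub, hΔe, smul_smul, ← pow_add, show m + (N - m + 1) = N + 1 by omega]

theorem isBigO_partialSum_sub (hs : ∀ p, SmoothFunNear d s p) {β : ℂ} (hβ : β ∈ S)
    {f : ℕ → TensorField d M k} (hf : ∀ i, B.IsSection (f i)) {N N' : ℕ} (h : N ≤ N') (a : ℂ) :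
    B.IsBigO s S (N + 1) (fun p => a • (partialSum s β f N' p - partialSum s β f N p)) := by
  obtain ⟨r, hr, h⟩ := exists_polySum_sub hs hf h
  refine .of_eq hβ (hr.const_smul a) fun p hp => ?_
  have hp0 : (s p : ℂ) ≠ 0 := by exact_mod_cast hp.ne'
  rw [partialSum_eq hp, partialSum_eq hp, ← smul_sub, h, Complex.cpow_add _ _ hp0,
    Complex.cpow_natCast]
  module

/-- If the two indicial roots are not congruent modulo `ℤ`, every formal solution is the sum of
solutions starting at the indicial roots. -/
theorem TractorBundle.IsFormalSolution.exists_eq (hd : d ≠ 0)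
    (hs : ∀ p, SmoothFunNear d s p) (hI : ∀ p, scaleTractorSq g s p ≠ 0)
    (hc : B.IsFormalSolution s w S c) {b : ℂ} (hb : b = d + 2 * w - 1) (hbZ : ∀ m : ℤ, b ≠ m)
    {F G : TensorField d M k → ℕ → TensorField d M k}
    (hF : ∀ f, B.IsSection f → B.IsInfiniteOrderSolution s w 0 f (F f))
    (hG : ∀ f, B.IsSection f → B.IsInfiniteOrderSolution s w b f (G f)) :
    ∃ f₀ f₁, B.IsSection f₀ ∧ B.IsSection f₁ ∧
      B.FormalEq s (S ∪ {0, b}) (fun N => ∑ α ∈ S, partialSum s α (c α) N)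
        (fun N => partialSum s 0 (F f₀) N + partialSum s b (G f₁) N) := by
  classical
  set T : Finset ℂ := S ∪ {0, b} with hT
  have hST : S ⊆ T := Finset.subset_union_left
  have h0T : (0 : ℂ) ∈ T := by simp [hT]
  have hbT : b ∈ T := by simp [hT]
  -- A common bound on the real parts makes every exponent its class representative plus a natural
  -- number.
  obtain ⟨K, hK⟩ : ∃ K : ℕ, ∀ β ∈ T, |β.re| ≤ K := by
    obtain ⟨K, hK⟩ := exists_nat_ge (∑ β ∈ T, |β.re|)
    exact ⟨K, fun β hβ =>
      (Finset.single_le_sum (f := fun β : ℂ => |β.re|) (fun _ _ => abs_nonneg _) hβ).trans hK⟩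
  set ρ := classRep K with hρdef
  set n := classShift K with hndef
  have hρ : ∀ β ∈ T, ρ β + n β = β := fun β hβ => classRep_add_classShift (hK β hβ)
  set R := T.image ρ with hRdef
  have hρR : ∀ β ∈ T, ρ β ∈ R := fun β hβ => Finset.mem_image_of_mem ρ hβ
  have hsep : ∀ α ∈ R, ∀ β ∈ R, ∀ m m' : ℕ, α + m = β + m' → m = m' ∧ α = β := by
    intro α hα β hβ m m' h
    obtain ⟨α, -, rfl⟩ := Finset.mem_image.1 hα
    obtain ⟨β, -, rfl⟩ := Finset.mem_image.1 hβ
    have h1 := classRep_eq_of_add_eq h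
    exact ⟨h1, by rw [h1] at h; exact add_right_cancel h⟩
  have hR : ∀ α ∈ R, ∀ β ∈ R, β ≠ α → ∀ m : ℕ, α ≠ β + m := fun α hα β hβ hne m h =>
    hne (hsep α hα β hβ 0 m (by simpa using h)).2.symm
  have hpoly : ∀ γ : ℂ, γ * (d + 2 * w - 1 - γ) = 0 ↔ γ = 0 ∨ γ = b := fun γ => by
    rw [mul_eq_zero, ← hb, sub_eq_zero, eq_comm (a := b)]
  have hroot : ∀ α ∈ R, ∀ i : ℕ, (α + i) * (d + 2 * w - 1 - (α + i)) = 0 →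
      (i = n 0 ∧ α = ρ 0) ∨ (i = n b ∧ α = ρ b) := fun α hα i h => by
    rcases (hpoly _).1 h with h | h
    · exact .inl (hsep α hα _ (hρR 0 h0T) i (n 0) (by rw [h, hρ 0 h0T]))
    · exact .inr (hsep α hα _ (hρR b hbT) i (n b) (by rw [h, hρ b hbT]))
  -- The two roots lie in different classes because `b` is not an integer; hence each class contains
  -- at most one root.
  have hne : ρ 0 ≠ ρ b := fun h => by
    refine hbZ (n b - n 0) ?_
    have h1 := hρ 0 h0T
    have h2 := hρ b hbT
    rw [← h] at h2
    push_cast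
    linear_combination h1 - h2
  have hcs := hc.1
  have hindAll : ∀ N, ∃ r : ℂ → TensorField d M k, ∀ α ∈ R, B.IsSection (r α) ∧ ∀ p, 0 < s p →
      indicial g s w α (classSum s S ρ n c α N) p = (s p : ℂ) ^ (N + 1) • r α p := fun N =>
    hc.exists_indicial hd hs hI (fun β hβ => hρR β (hST hβ)) (fun β hβ => hρ β (hST hβ)) hR N
  choose r hr using hindAll
  have hΦ := fun α N => isSection_classSum (ρ := ρ) (n := n) hs hcs α N
  have hgt : ∀ (e : ℂ) (i : ℕ), e = 0 ∨ e = b →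
      (e + (i + 1)) * (d + 2 * w - 1 - (e + (i + 1))) ≠ 0 := fun e i he h => by
    rcases (hpoly _).1 h with h | h <;> rcases he with rfl | rfl
    · have : ((i : ℂ) + 1) ≠ 0 := by exact_mod_cast Nat.succ_ne_zero i
      exact this (by simpa using h)
    · exact hbZ (-(i + 1)) (by push_cast; linear_combination h)
    · exact hbZ (i + 1) (by push_cast; linear_combination -h)
    · have : ((i : ℂ) + 1) ≠ 0 := by exact_mod_cast Nat.succ_ne_zero i
      exact this (by linear_combination h)
  obtain ⟨f₀, hf₀, hf₀e⟩ := exists_leading_coefficient hd hs hI (hρ 0 h0T) (hΦ (ρ 0))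
    (fun N hN => exists_classSum_sub hs hcs (ρ 0) hN)
    (fun N => ⟨r N (ρ 0), hr N _ (hρR 0 h0T)⟩) (fun i hi h => by
      rcases hroot _ (hρR 0 h0T) i h with h | h
      · omega
      · exact hne h.2) (fun i => hgt 0 i (.inl rfl)) hF
  obtain ⟨f₁, hf₁, hf₁e⟩ := exists_leading_coefficient hd hs hI (hρ b hbT) (hΦ (ρ b))
    (fun N hN => exists_classSum_sub hs hcs (ρ b) hN)
    (fun N => ⟨r N (ρ b), hr N _ (hρR b hbT)⟩) (fun i hi h => by
      rcases hroot _ (hρR b hbT) i h with h | h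
      · exact hne h.2.symm
      · omega) (fun i => hgt b i (.inr rfl)) hG
  refine ⟨f₀, f₁, hf₀, hf₁, fun N => ?_⟩
  -- A class error `s^(N'+1)` is measured from the representative, which lies `n β` below `β`. The
  -- surplus in `N'` ensures order `N + 1` relative to every exponent.
  set N' := N + ∑ β ∈ T, n β with hN'
  have hnN' : ∀ β ∈ T, N + n β ≤ N' := fun β hβ =>
    Nat.add_le_add_left (Finset.single_le_sum (fun _ _ => Nat.zero_le _) hβ) N
  have hF₀ := ((hF f₀ hf₀).2 0).1
  have hG₁ := ((hG f₁ hf₁).2 0).1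
  -- The expected content of each class: the solution starting at the root that it contains, or zero
  -- if it contains none.
  let Ψ : ℂ → TensorField d M k := fun α p =>
    if α = ρ 0 then (s p : ℂ) ^ n 0 • polySum s (F f₀) (N' - n 0) p
    else if α = ρ b then (s p : ℂ) ^ n b • polySum s (G f₁) (N' - n b) p else 0
  have hΔ : ∀ α ∈ R, ∃ Δ, B.IsSection Δ ∧
      ∀ p, classSum s S ρ n c α N' p - Ψ α p = (s p : ℂ) ^ (N' + 1) • Δ p := fun α hα => by
    by_cases h0 : α = ρ 0
    · obtain ⟨Δ, hΔ, h⟩ := hf₀e N' (by have := hnN' 0 h0T; omega)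
      exact ⟨Δ, hΔ, fun p => by simpa [Ψ, h0] using h p⟩
    · by_cases h1 : α = ρ b
      · obtain ⟨Δ, hΔ, h⟩ := hf₁e N' (by have := hnN' b hbT; omega)
        exact ⟨Δ, hΔ, fun p => by simpa [Ψ, h1, hne.symm] using h p⟩
      -- In a class without root nothing obstructs repeated division, so the whole class is of
      -- higher order.
      · obtain ⟨Δ, hΔ, h, -⟩ := (hΦ α N').exists_eq_pow_smul hd hs hI (hr N' α hα).1 le_rfl
          (hr N' α hα).2 fun i _ h => by
            rcases hroot α hα i h with h | h
            · exact h0 h.2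
            · exact h1 h.2
        exact ⟨Δ, hΔ, fun p => by simpa [Ψ, h0, h1] using h p⟩
  have hmain : B.IsBigO s T (N + 1) fun p =>
      ∑ α ∈ R, (s p : ℂ) ^ α • (classSum s S ρ n c α N' p - Ψ α p) := by
    refine .sum R fun α hα => ?_
    obtain ⟨Δ, hΔ, h⟩ := hΔ α hα
    obtain ⟨β, hβ, rfl⟩ := Finset.mem_image.1 hα
    refine .of_eq hβ (hΔ.pow_smul hs (N' - N - n β)) fun p hp => ?_
    have hp0 : (s p : ℂ) ≠ 0 := by exact_mod_cast hp.ne'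
    have h2 : N' + 1 = n β + (N + 1) + (N' - N - n β) := by have := hnN' β hβ; omega
    have h3 : (s p : ℂ) ^ (β + (N + 1 : ℕ)) = (s p : ℂ) ^ ρ β * (s p : ℂ) ^ (n β + (N + 1)) := by
      rw [← Complex.cpow_natCast, ← Complex.cpow_add _ _ hp0]
      congr 1
      push_cast
      linear_combination -(hρ β hβ)
    rw [h, h3, smul_smul, smul_smul, h2, pow_add _ (n β + (N + 1)), mul_assoc]
  have hS : B.IsBigO s T (N + 1) fun p => ∑ β ∈ S,
      (-1 : ℂ) • (partialSum s β (c β) N' p - partialSum s β (c β) N p) :=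
    .sum S fun β hβ => isBigO_partialSum_sub hs (hST hβ) (hcs β hβ) (by omega) _
  have h₀ : B.IsBigO s T (N + 1) _ := isBigO_partialSum_sub hs h0T hF₀ (N := N) (N' := N' - n 0)
    (by have := hnN' 0 h0T; omega) 1
  have h₁ : B.IsBigO s T (N + 1) _ := isBigO_partialSum_sub hs hbT hG₁ (N := N) (N' := N' - n b)
    (by have := hnN' b hbT; omega) 1
  -- The difference is split through longer truncations: the given expansion from `N` to `N'`, the
  -- comparison of classes at `N'`, and each solution from its longer truncation back to `N`.
  refine (((hS.add hmain).add h₀).add h₁).congr fun p hp => ?_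
  have hp0 : (s p : ℂ) ≠ 0 := by exact_mod_cast hp.ne'
  have hpow : ∀ β ∈ T, (s p : ℂ) ^ ρ β * (s p : ℂ) ^ n β = (s p : ℂ) ^ β := fun β hβ => by
    rw [← Complex.cpow_natCast, ← Complex.cpow_add _ _ hp0, hρ β hβ]
  have hΨ : ∑ α ∈ R, (s p : ℂ) ^ α • Ψ α p =
      partialSum s 0 (F f₀) (N' - n 0) p + partialSum s b (G f₁) (N' - n b) p := by
    rw [← Finset.sum_subset (s₁ := {ρ 0, ρ b}), Finset.sum_pair hne]
    · simp only [Ψ, if_true, if_neg hne.symm]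
      rw [partialSum_eq hp, partialSum_eq hp, smul_smul, smul_smul, hpow 0 h0T, hpow b hbT]
    · intro α hα
      rcases Finset.mem_insert.1 hα with rfl | hα
      · exact hρR 0 h0T
      · exact Finset.mem_singleton.1 hα ▸ hρR b hbT
    · intro α _ hα
      simp only [Finset.mem_insert, Finset.mem_singleton, not_or] at hα
      simp [Ψ, hα.1, hα.2]
  have hu := sum_partialSum_eq (c := c) (R := R) (fun β hβ => hρR β (hST hβ))
    (fun β hβ => hρ β (hST hβ)) hp N'
  simp only [smul_sub, Finset.sum_sub_distrib, Pi.sub_apply, Pi.add_apply, Finset.sum_apply,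
    neg_one_smul, one_smul, Finset.sum_neg_distrib] at hu ⊢
  rw [← hu, hΨ]
  abel

end FormalSolutions

end BoundaryCalculus

end

/-! ### The proposition. -/

theorem proposition5p6 {d : ℕ} (hd : 3 ≤ d) {M : Type*} [TopologicalSpace M] [T2Space M]
    [SecondCountableTopology M] [ChartedSpace (EuclideanSpace ℝ (Fin d)) M]
    [IsManifold (𝓡 d) ∞ M]
    (g : PseudoMetric d M)
    (s : M → ℝ) (hs : ContMDiff (𝓡 d) 𝓘(ℝ, ℝ) ∞ s)
    (hI : ∀ p, scaleTractorSq g s p ≠ 0)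
    {k : ℕ} (B : TractorBundle g k)
    (w₀ h₀ : ℂ) (hh : h₀ = d + 2 * w₀) :
    -- solutions of the form `σ^α (f_0 + σ f_1 + ⋯)` exist only if `α = 0` or `α = h₀ - 1`
    (∀ (α : ℂ) (f : ℕ → TensorField d M k) (ℓ : ℕ), B.SolvesToOrder s w₀ α f ℓ →
      (∃ p, s p = 0 ∧ f 0 p ≠ 0) → α = 0 ∨ α = h₀ - 1) ∧
    -- every section along the zero locus extends to a section over `M`
    (∀ φ : TensorField d M k, B.IsSectionAlong s φ →
      ∃ f₀, B.IsSection f₀ ∧ ∀ p, s p = 0 → f₀ p = φ p) ∧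
    -- solutions of the first kind
    ((∀ n : ℤ, 2 ≤ n → h₀ ≠ n) →
      (∀ f₀, B.IsSection f₀ →
        B.IsInfiniteOrderSolution s w₀ 0 f₀ (normalOrdered g s w₀ (besselK h₀) f₀)) ∧
      (∀ f₀ f₀', B.IsSection f₀ → B.IsSection f₀' → (∀ p, s p = 0 → f₀ p = f₀' p) →
        B.FormalEq s {0}
          (partialSum s 0 (normalOrdered g s w₀ (besselK h₀) f₀))
          (partialSum s 0 (normalOrdered g s w₀ (besselK h₀) f₀')))) ∧
    -- solutions of the second kind
    ((∀ n : ℤ, n ≤ 0 → h₀ ≠ n) →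
      (∀ f₀, B.IsSection f₀ →
        B.IsInfiniteOrderSolution s w₀ (h₀ - 1) f₀
          (normalOrdered g s (-d - w₀ + 1) (besselK (2 - h₀)) f₀)) ∧
      (∀ f₀ f₀', B.IsSection f₀ → B.IsSection f₀' → (∀ p, s p = 0 → f₀ p = f₀' p) →
        B.FormalEq s {h₀ - 1}
          (partialSum s (h₀ - 1) (normalOrdered g s (-d - w₀ + 1) (besselK (2 - h₀)) f₀))
          (partialSum s (h₀ - 1) (normalOrdered g s (-d - w₀ + 1) (besselK (2 - h₀)) f₀')))) ∧
    -- generic weights: the solutions are distinct and span the space of formal solutions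
    ((∀ n : ℤ, h₀ ≠ n) →
      (∀ f₀ f₁, B.IsSection f₀ → B.IsSection f₁ →
        (∃ p, s p = 0 ∧ f₀ p ≠ 0) → (∃ p, s p = 0 ∧ f₁ p ≠ 0) →
        ¬ B.FormalEq s {0, h₀ - 1}
          (partialSum s 0 (normalOrdered g s w₀ (besselK h₀) f₀))
          (partialSum s (h₀ - 1) (normalOrdered g s (-d - w₀ + 1) (besselK (2 - h₀)) f₁))) ∧
      (∀ (S : Finset ℂ) (c : ℂ → ℕ → TensorField d M k), B.IsFormalSolution s w₀ S c →
        ∃ f₀ f₁, B.IsSection f₀ ∧ B.IsSection f₁ ∧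
          B.FormalEq s (S ∪ {0, h₀ - 1})
            (fun N => ∑ α ∈ S, partialSum s α (c α) N)
            (fun N => partialSum s 0 (normalOrdered g s w₀ (besselK h₀) f₀) N
              + partialSum s (h₀ - 1)
                  (normalOrdered g s (-d - w₀ + 1) (besselK (2 - h₀)) f₁) N))) := by
  have hd0 : d ≠ 0 := by omega
  have hs' : ∀ p, SmoothFunNear d s p := fun p => .of_forall fun q => hs.contMDiffAt
  -- The weight of the second leading coefficient is that of `s^(-(h₀-1))` times a section of weight
  -- `w₀`.
  have hw : -(d : ℂ) - w₀ + 1 = w₀ - (h₀ - 1) := by rw [hh]; ring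
  have sol₀ : (∀ n : ℤ, 2 ≤ n → h₀ ≠ n) → ∀ f₀, B.IsSection f₀ →
      B.IsInfiniteOrderSolution s w₀ 0 f₀ (normalOrdered g s w₀ (besselK h₀) f₀) := by
    intro hZ f₀ hf₀
    have := hf₀.isInfiniteOrderSolution_normalOrdered hd0 hs' hI (w := w₀) (β := 0) (h := h₀)
      (by ring) (fun m => by rw [hh]; ring) fun m h => hZ (m + 2) (by omega) (by
        push_cast; linear_combination -h)
    rwa [sub_zero] at this
  have sol₁ : (∀ n : ℤ, n ≤ 0 → h₀ ≠ n) → ∀ f₀, B.IsSection f₀ →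
      B.IsInfiniteOrderSolution s w₀ (h₀ - 1) f₀
        (normalOrdered g s (-d - w₀ + 1) (besselK (2 - h₀)) f₀) := by
    intro hZ f₀ hf₀
    rw [hw]
    exact hf₀.isInfiniteOrderSolution_normalOrdered hd0 hs' hI (w := w₀) (β := h₀ - 1)
      (h := 2 - h₀) (by rw [hh]; ring) (fun m => by rw [hh]; ring) fun m h =>
        hZ (-m) (by omega) (by push_cast; linear_combination h)
  have hsucc : ∀ i : ℕ, ((i : ℂ) + 1) ≠ 0 := fun i => by exact_mod_cast Nat.succ_ne_zero i
  refine ⟨fun α f ℓ hf ⟨p, hp, hfp⟩ => ?_, fun φ hφ => hφ.exists_extension hs', fun hZ =>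
    ⟨sol₀ hZ, fun f₀ f₀' hf₀ hf₀' h => ?_⟩, fun hZ => ⟨sol₁ hZ, fun f₀ f₀' hf₀ hf₀' h => ?_⟩,
    fun hZ => ⟨fun f₀ f₁ hf₀ hf₁ h₀' _ hEq => ?_, fun S c hc => ?_⟩⟩
  · refine (mul_eq_zero.1 (hf.indicial_root hd0 hs' hI hp hfp)).imp_right fun h => ?_
    rw [hh]
    linear_combination -h
  · refine TractorBundle.formalEq_of_isInfiniteOrderSolution hd0 hs' hI (sol₀ hZ f₀ hf₀)
      (sol₀ hZ f₀' hf₀') h fun i => ?_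
    rw [zero_add, ← hh]
    exact mul_ne_zero (hsucc i) fun h => hZ (i + 2) (by omega) (by push_cast; linear_combination h)
  · refine TractorBundle.formalEq_of_isInfiniteOrderSolution hd0 hs' hI (sol₁ hZ f₀ hf₀)
      (sol₁ hZ f₀' hf₀') h fun i => ?_
    rw [← hh]
    exact mul_ne_zero (fun h => hZ (-i) (by omega) (by push_cast; linear_combination h))
      fun h => hsucc i (by linear_combination -h)
  · obtain ⟨r, hr, hEq⟩ := hEq 0
    obtain ⟨p, hp, hfp⟩ := h₀'
    refine hfp ?_
    have h1 : (0 : ℂ) ≠ h₀ - 1 := fun h => hZ 1 (by push_cast; linear_combination -h)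
    have hsec := fun α hα => (hr α hα).smul fun p => (hs' p).ofReal
    -- Formal equality at order `0` already suffices. Collecting the exponents `0` and `h₀ - 1`,
    -- with the error terms absorbed into the coefficients, gives a relation of powers in distinct
    -- classes, so `f₀` would vanish on the zero locus.
    let φ : ℂ → TensorField d M k := fun α q =>
      if α = 0 then f₀ q - (s q : ℂ) • r 0 q else (-1 : ℂ) • f₁ q - (s q : ℂ) • r (h₀ - 1) q
    have h2 := eq_zero_of_sum_cpow_smul (A := {0, h₀ - 1}) (φ := φ) (α := 0) hs' hI
      (fun γ hγ => by
        rcases Finset.mem_insert.1 hγ with rfl | hγ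
        · simpa [φ] using hf₀.sub (hsec 0 (by simp))
        · rw [Finset.mem_singleton.1 hγ]
          simpa [φ, h1.symm] using (hf₁.const_smul (-1)).sub (hsec (h₀ - 1) (by simp)))
      (fun q hq => by
        have hq0 : (s q : ℂ) ≠ 0 := by exact_mod_cast hq.ne'
        have h3 := hEq q hq
        rw [Finset.sum_pair h1, Pi.sub_apply, partialSum_eq hq, partialSum_eq hq] at h3
        simp only [polySum, zero_add, Finset.sum_range_one, pow_zero, one_smul,
          (sol₀ (fun n _ => hZ n) f₀ hf₀).1, (sol₁ (fun n _ => hZ n) f₁ hf₁).1,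
          Complex.cpow_add _ _ hq0, Nat.cast_one, Complex.cpow_one, Complex.cpow_zero] at h3
        rw [Finset.sum_pair h1]
        simp only [φ, if_true, if_neg h1.symm, Complex.cpow_zero]
        refine Eq.trans ?_ (sub_eq_zero.2 h3)
        module)
      (by simp) (fun β hβ hne n h => by
        rcases Finset.mem_insert.1 hβ with rfl | hβ
        · exact hne rfl
        · rw [Finset.mem_singleton.1 hβ] at h
          exact hZ (1 - n) (by push_cast; linear_combination -h)) hp
    simpa [φ, hp] using h2
  · refine hc.exists_eq hd0 hs' hI (by rw [hh]) (fun m h => hZ (m + 1) ?_)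
      (sol₀ fun n _ => hZ n) (sol₁ fun n _ => hZ n)
    push_cast
    linear_combination h
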